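/- Let $K\ge 1$ and $j_1,\dots,j_K\ge 1$ be integers, let $a_k>0$ and $p_{jk}>0$ ($1\le k\le K$, $1\le j\le j_k$) be real numbers, and let $$\Omega_2=\Big\{z=(z_{jk})\in\mathbb C^{d}:\ \sum_{k=1}^K\Big(\sum_{j=1}^{j_k}|z_{jk}|^{2p_{jk}}\Big)^{a_k}<1\Big\},\qquad d=j_1+\cdots+j_K .$$ Let $L^2_a(\Omega_2)$ be the Bergman space of holomorphic functions on $\Omega_2$ that are square-integrable with respect to Lebesgue measure, and let $M_{z_{jk}}$ be the multiplication by the coordinate function $z_{jk}$ on it. For $0<p<\infty$, a bounded operator $T$ on a Hilbert space is called $p$-summable if $(TT^*)^{p/2}$ is trace class, and the Bergman module $L^2_a(\Omega_2)$ is called $p$-essentially normal if all commutators $[M_{z_{jk}},M_{z_{il}}^*]$, for any two coordinates $z_{jk},z_{il}$, are $p$-summable. Then, for every $0<p<\infty$, the Bergman module $L^2_a(\Omega_2)$ is $p$-essentially normal if and only if $$p>\begin{cases}\frac12,& d=1,\\ \max\{d,q_1,\dots,q_K\},& d>1,\end{cases}$$ where for each $k=1,\dots,K$ $$q_k=\begin{cases}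 \max\{a_kp_{jk}(d-j_k): j=1,\dots,j_k\},& j_k=1,\\ \max\{p_{jk}(d-1),\ a_kp_{jk}(d-j_k): j=1,\dots,j_k\},& j_k>1=a_k,\\ \max\Big\{p_{jk}(d-1),\ a_kp_{jk}(d-j_k),\ \dfrac{2a_k(d-j_k)}{1/p_{jk}+1/p_{lk}}: j,l=1,\dots,j_k,\ j\ne l\Big\},& j_k>1\ne a_k. \end{cases}$$ -/

import Mathlib

open MeasureTheory Filter Topology
open scoped ENNReal

theorem setIntegral_closedBall_rotate {σ : Type*} [Fintype σ] (r : ℝ) (F : (σ → ℂ) → ℂ) (u : ℂ)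
    (hu : ‖u‖ = 1) :
    ∫ z in Metric.closedBall (0 : σ → ℂ) r, F (u • z) =
      ∫ z in Metric.closedBall (0 : σ → ℂ) r, F z := by
  have hmp : MeasurePreserving (fun (z : σ → ℂ) (i : σ) => u * z i) :=
    volume_preserving_pi (f := fun _ w => u * w) fun _ =>
      (rotation (⟨u, by simpa [Submonoid.unitSphere] using hu⟩ : Circle)).measurePreserving
  have hu0 : u ≠ 0 := by rintro rfl; simp at hu
  have hemb : MeasurableEmbedding (fun (z : σ → ℂ) (i : σ) => u * z i) :=
    (Homeomorph.smulOfNeZero u hu0 : (σ → ℂ) ≃ₜ (σ → ℂ)).measurableEmbedding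
  have := hmp.setIntegral_preimage_emb hemb F (Metric.closedBall (0 : σ → ℂ) r)
  have hpre : (fun (z : σ → ℂ) (i : σ) => u * z i) ⁻¹' Metric.closedBall (0 : σ → ℂ) r
      = Metric.closedBall (0 : σ → ℂ) r := by
    ext z
    have : (fun i => u * z i) = u • z := rfl
    simp [this, norm_smul, hu]
  rw [hpre] at this
  exact this

/-- Mean value property of holomorphic functions of several variables. -/
theorem volume_smul_eq_setIntegral {σ : Type*} [Fintype σ] {G : (σ → ℂ) → ℂ} {D : Set (σ → ℂ)}
    (hG : DifferentiableOn ℂ G D) (z₀ : σ → ℂ) {r : ℝ} (hr : Metric.closedBall z₀ r ⊆ D) :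
    (volume (Metric.closedBall z₀ r)).toReal • G z₀ = ∫ z in Metric.closedBall z₀ r, G z := by
  set B := Metric.closedBall (0 : σ → ℂ) r with hB
  have hBm : MeasurableSet B := Metric.isClosed_closedBall.measurableSet
  have hBc : IsCompact B := isCompact_closedBall 0 r
  have hmem : ∀ z ∈ B, ∀ u : ℂ, ‖u‖ ≤ 1 → z₀ + u • z ∈ D := by
    intro z hz u hu
    apply hr
    simp only [hB, mem_closedBall_zero_iff] at hz
    simp only [Metric.mem_closedBall, dist_self_add_left, norm_smul]
    nlinarith [norm_nonneg z, norm_nonneg u]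
  have htrans : ∀ F : (σ → ℂ) → ℂ,
      ∫ z in Metric.closedBall z₀ r, F z = ∫ z in B, F (z₀ + z) := by
    intro F
    have := (measurePreserving_add_left (volume : Measure (σ → ℂ)) z₀).setIntegral_preimage_emb
      (measurableEmbedding_addLeft z₀) F (Metric.closedBall z₀ r)
    rw [← this]
    congr 2
    simp [hB]
  have hmean : ∀ z ∈ B, Real.circleAverage (fun u : ℂ => G (z₀ + u • z)) 0 1 = G z₀ := by
    intro z hz
    have hd : DifferentiableOn ℂ (fun u : ℂ => G (z₀ + u • z)) (Metric.closedBall 0 1) := by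
      refine hG.comp (t := D) (f := fun u : ℂ => z₀ + u • z) ?_ ?_
      · fun_prop
      · intro u hu
        exact hmem z hz u (by simpa using hu)
    have := DiffContOnCl.circleAverage (f := fun u : ℂ => G (z₀ + u • z)) (c := 0) (R := 1)
      (by rw [abs_one]; exact hd.diffContOnCl_ball (U := Metric.closedBall 0 1) subset_rfl)
    simpa using this
  have hcont : ContinuousOn (fun q : ℝ × (σ → ℂ) => G (z₀ + circleMap 0 1 q.1 • q.2))
      (Set.univ ×ˢ B) := by
    refine hG.continuousOn.comp (t := D)
      (f := fun q : ℝ × (σ → ℂ) => z₀ + circleMap 0 1 q.1 • q.2) ?_ ?_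
    · have := continuous_circleMap 0 1
      fun_prop
    · intro q hq
      exact hmem q.2 hq.2 _ (by simp)
  have hint : Integrable (Function.uncurry fun (θ : ℝ) (z : σ → ℂ) =>
      G (z₀ + circleMap 0 1 θ • z))
      ((volume.restrict (Set.uIoc 0 (2 * Real.pi))).prod (volume.restrict B)) := by
    rw [Measure.prod_restrict]
    have : IntegrableOn (fun q : ℝ × (σ → ℂ) => G (z₀ + circleMap 0 1 q.1 • q.2))
        (Set.uIcc 0 (2 * Real.pi) ×ˢ B) (volume.prod volume) :=
      (hcont.mono (Set.prod_mono (Set.subset_univ _) subset_rfl)).integrableOn_compact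
        (isCompact_uIcc.prod hBc)
    exact this.mono_set (Set.prod_mono Set.uIoc_subset_uIcc subset_rfl)
  rw [htrans]
  have hvol : volume (Metric.closedBall z₀ r) = volume B := by
    rw [hB, Measure.addHaar_closedBall_center]
  calc (volume (Metric.closedBall z₀ r)).toReal • G z₀ = ∫ z in B, G z₀ := by
        rw [hvol, setIntegral_const]; rfl
    _ = ∫ z in B, (2 * Real.pi)⁻¹ • ∫ θ in (0)..(2 * Real.pi), G (z₀ + circleMap 0 1 θ • z) := by
        refine setIntegral_congr_fun hBm fun z hz => ?_
        exact (hmean z hz).symm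
    _ = (2 * Real.pi)⁻¹ • ∫ θ in (0)..(2 * Real.pi), ∫ z in B, G (z₀ + circleMap 0 1 θ • z) := by
        rw [integral_smul, intervalIntegral_integral_swap hint]
    _ = (2 * Real.pi)⁻¹ • ∫ θ in (0)..(2 * Real.pi), ∫ z in B, G (z₀ + z) := by
        congr 1
        refine intervalIntegral.integral_congr fun θ _ => ?_
        exact setIntegral_closedBall_rotate r (fun z => G (z₀ + z)) _ (by simp)
    _ = ∫ z in B, G (z₀ + z) := by
        rw [intervalIntegral.integral_const, sub_zero, smul_smul,
          inv_mul_cancel₀ (by positivity), one_smul]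

/-- The Bergman space `L²ₐ(D)` of an open set `D ⊆ ℂ^σ`: the classes in `L²(D)` (with respect to
Lebesgue measure) that have a representative which is holomorphic on `D`. -/
def bergmanSpace {σ : Type*} [Fintype σ] (D : TopologicalSpace.Opens (σ → ℂ)) :
    Submodule ℂ (Lp ℂ 2 (volume.restrict (D : Set (σ → ℂ)))) where
  carrier := {f | ∃ g : (σ → ℂ) → ℂ, DifferentiableOn ℂ g D ∧
    f =ᵐ[volume.restrict (D : Set (σ → ℂ))] g}
  zero_mem' := ⟨0, differentiableOn_const 0, Lp.coeFn_zero _ _ _⟩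
  add_mem' := by
    rintro f₁ f₂ ⟨g₁, hg₁, h₁⟩ ⟨g₂, hg₂, h₂⟩
    exact ⟨g₁ + g₂, hg₁.add hg₂, (Lp.coeFn_add f₁ f₂).trans (h₁.add h₂)⟩
  smul_mem' := by
    rintro c f ⟨g, hg, h⟩
    exact ⟨c • g, hg.const_smul c, (Lp.coeFn_smul c f).trans (h.const_smul c)⟩

/-- Point evaluations on the Bergman space are locally uniformly bounded. -/
theorem norm_sq_mul_volume_le {σ : Type*} [Fintype σ] {D : TopologicalSpace.Opens (σ → ℂ)}
    (f : Lp ℂ 2 (volume.restrict (D : Set (σ → ℂ)))) {g : (σ → ℂ) → ℂ}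
    (hg : DifferentiableOn ℂ g D) (hfg : f =ᵐ[volume.restrict (D : Set (σ → ℂ))] g)
    {z : σ → ℂ} {r : ℝ} (hr : Metric.closedBall z r ⊆ D) :
    ‖g z‖ ^ 2 * (volume (Metric.closedBall z r)).toReal ≤ ‖f‖ ^ 2 := by
  have h1 : (volume (Metric.closedBall z r)).toReal • g z ^ 2 =
      ∫ w in Metric.closedBall z r, g w ^ 2 := volume_smul_eq_setIntegral (hg.pow 2) z hr
  have hint : IntegrableOn (fun w => ‖g w‖ ^ 2) D := by
    have := (memLp_two_iff_integrable_sq_norm (Lp.memLp f).1).1 (Lp.memLp f)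
    refine this.congr ?_
    filter_upwards [hfg] with w hw
    rw [hw]
  have hnorm : ‖f‖ ^ 2 = ∫ w in D, ‖g w‖ ^ 2 := by
    have h2 : (‖f‖ ^ 2 : ℂ) = inner ℂ f f := (inner_self_eq_norm_sq_to_K f).symm
    rw [L2.inner_def] at h2
    have h3 : ∀ a, inner ℂ (f a) (f a) = ((‖f a‖ ^ 2 : ℝ) : ℂ) := by
      intro a
      rw [inner_self_eq_norm_sq_to_K]; push_cast; rfl
    simp_rw [h3] at h2
    have h5 : (∫ a in D, ((‖f a‖ ^ 2 : ℝ) : ℂ)) = ((∫ a in D, ‖f a‖ ^ 2 : ℝ) : ℂ) :=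
      integral_ofReal
    have h4 : ‖f‖ ^ 2 = ∫ a in D, ‖f a‖ ^ 2 := by
      exact_mod_cast h2.trans h5
    rw [h4]
    refine integral_congr_ae ?_
    filter_upwards [hfg] with w hw
    rw [hw]
  calc ‖g z‖ ^ 2 * (volume (Metric.closedBall z r)).toReal
      = ‖(volume (Metric.closedBall z r)).toReal • g z ^ 2‖ := by
        rw [norm_smul, norm_pow, Real.norm_of_nonneg ENNReal.toReal_nonneg, mul_comm]
    _ = ‖∫ w in Metric.closedBall z r, g w ^ 2‖ := by rw [h1]
    _ ≤ ∫ w in Metric.closedBall z r, ‖g w ^ 2‖ := norm_integral_le_integral_norm _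
    _ = ∫ w in Metric.closedBall z r, ‖g w‖ ^ 2 := by simp_rw [norm_pow]
    _ ≤ ∫ w in D, ‖g w‖ ^ 2 :=
        setIntegral_mono_set hint (Eventually.of_forall fun _ => by positivity)
          (LE.le.eventuallyLE hr)
    _ = ‖f‖ ^ 2 := hnorm.symm

/-- Cauchy estimate for the Fréchet derivative. -/
theorem norm_fderiv_le_of_closedBall {σ : Type*} [Fintype σ] {g : (σ → ℂ) → ℂ} {z : σ → ℂ}
    {r C : ℝ} (hr : 0 < r) (hg : ∀ w ∈ Metric.closedBall z r, DifferentiableAt ℂ g w)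
    (hC : ∀ w ∈ Metric.closedBall z r, ‖g w‖ ≤ C) : ‖fderiv ℂ g z‖ ≤ C / r := by
  have hC0 : 0 ≤ C := (norm_nonneg _).trans (hC z (Metric.mem_closedBall_self hr.le))
  refine ContinuousLinearMap.opNorm_le_of_unit_norm (by positivity) fun v hv => ?_
  have hmem : ∀ u ∈ Metric.closedBall (0 : ℂ) r, z + u • v ∈ Metric.closedBall z r := by
    intro u hu
    simpa [norm_smul, hv] using hu
  have hd : DifferentiableOn ℂ (fun u : ℂ => g (z + u • v)) (Metric.closedBall 0 r) := by
    intro u hu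
    have := hg _ (hmem u hu)
    exact (DifferentiableAt.comp u (f := fun u : ℂ => z + u • v) this
      (by fun_prop)).differentiableWithinAt
  have hder : HasDerivAt (fun u : ℂ => g (z + u • v)) (fderiv ℂ g z v) 0 := by
    have h1 : HasDerivAt (fun u : ℂ => z + u • v) v 0 := by
      simpa using ((hasDerivAt_id (0 : ℂ)).smul_const v).const_add z
    have h2 : HasFDerivAt g (fderiv ℂ g z) (z + (0 : ℂ) • v) := by
      simpa using (hg z (Metric.mem_closedBall_self hr.le)).hasFDerivAt
    exact h2.comp_hasDerivAt 0 h1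
  rw [← hder.deriv]
  exact Complex.norm_deriv_le_of_forall_mem_sphere_norm_le hr
    (hd.diffContOnCl_ball (U := Metric.closedBall 0 r) subset_rfl)
    fun u hu => hC _ (hmem u (Metric.sphere_subset_closedBall hu))

theorem isClosed_bergmanSpace {σ : Type*} [Fintype σ] (D : TopologicalSpace.Opens (σ → ℂ)) :
    IsClosed (bergmanSpace D : Set (Lp ℂ 2 (volume.restrict (D : Set (σ → ℂ))))) := by
  refine isClosed_of_closure_subset fun f hf => ?_
  obtain ⟨F, hF, hFf⟩ := mem_closure_iff_seq_limit.1 hf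
  choose g hg hFg using hF
  have hCau : CauchySeq F := hFf.cauchySeq
  have hda : ∀ n, ∀ w ∈ D, DifferentiableAt ℂ (g n) w := fun n w hw =>
    (hg n).differentiableAt (D.isOpen.mem_nhds hw)
  -- pointwise control of differences by the norm
  have hbound : ∀ (z : σ → ℂ) (r : ℝ), 0 < r → Metric.closedBall z r ⊆ D → ∀ m n,
      ‖g m z - g n z‖ ≤ ‖F m - F n‖ / √(volume (Metric.closedBall (0 : σ → ℂ) r)).toReal := by
    intro z r hr hsub m n
    have h := norm_sq_mul_volume_le (F m - F n) ((hg m).sub (hg n))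
      ((Lp.coeFn_sub (F m) (F n)).trans ((hFg m).sub (hFg n))) hsub
    rw [Measure.addHaar_closedBall_center] at h
    have hpos : 0 < (volume (Metric.closedBall (0 : σ → ℂ) r)).toReal :=
      ENNReal.toReal_pos (Metric.measure_closedBall_pos _ _ hr).ne'
        (isCompact_closedBall _ _).measure_lt_top.ne
    rw [le_div_iff₀ (Real.sqrt_pos.2 hpos)]
    refine abs_le_of_sq_le_sq' ?_ (norm_nonneg _) |>.2
    rw [mul_pow, Real.sq_sqrt hpos.le]
    exact h
  have hunif : ∀ (z : σ → ℂ), z ∈ D → ∃ r > 0, Metric.closedBall z r ⊆ D ∧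
      UniformCauchySeqOn g atTop (Metric.closedBall z r) ∧
      UniformCauchySeqOn (fun n => fderiv ℂ (g n)) atTop (Metric.closedBall z r) := by
    intro z hz
    obtain ⟨ρ, hρ, hsub⟩ := Metric.nhds_basis_closedBall.mem_iff.1 (D.isOpen.mem_nhds hz)
    set r := ρ / 3 with hr
    have hr0 : 0 < r := by positivity
    set s := √(volume (Metric.closedBall (0 : σ → ℂ) r)).toReal with hs
    have hs0 : 0 < s := Real.sqrt_pos.2 (ENNReal.toReal_pos
      (Metric.measure_closedBall_pos _ _ hr0).ne' (isCompact_closedBall _ _).measure_lt_top.ne)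
    have hballs : ∀ w ∈ Metric.closedBall z r, ∀ w' ∈ Metric.closedBall w r,
        Metric.closedBall w' r ⊆ D := by
      intro w hw w' hw' x hx
      apply hsub
      simp only [Metric.mem_closedBall] at *
      linarith [dist_triangle x w' z, dist_triangle w' w z]
    have hself : ∀ w : σ → ℂ, w ∈ Metric.closedBall w r := fun w =>
      Metric.mem_closedBall_self hr0.le
    refine ⟨r, hr0, fun x hx => hballs x hx x (hself x) (hself x), ?_, ?_⟩
    · rw [Metric.uniformCauchySeqOn_iff]
      intro ε hε
      obtain ⟨N, hN⟩ := Metric.cauchySeq_iff.1 hCau (ε * s) (by positivity)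
      refine ⟨N, fun m hm n hn x hx => ?_⟩
      rw [dist_eq_norm]
      refine (hbound x r hr0 (hballs x hx x (hself x)) m n).trans_lt ?_
      rw [div_lt_iff₀ hs0, ← dist_eq_norm]
      exact hN m hm n hn
    · rw [Metric.uniformCauchySeqOn_iff]
      intro ε hε
      obtain ⟨N, hN⟩ := Metric.cauchySeq_iff.1 hCau (ε * r * s) (by positivity)
      refine ⟨N, fun m hm n hn x hx => ?_⟩
      have hxD : ∀ w ∈ Metric.closedBall x r, w ∈ D := fun w hw => hballs x hx w hw (hself w)
      have h := norm_fderiv_le_of_closedBall (g := g m - g n) hr0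
        (fun w hw => (hda m w (hxD w hw)).sub (hda n w (hxD w hw)))
        (fun w hw => hbound w r hr0 (hballs x hx w hw) m n)
      rw [fderiv_sub (hda m x (hxD x (hself x))) (hda n x (hxD x (hself x)))] at h
      rw [dist_eq_norm]
      refine h.trans_lt ?_
      rw [div_div, div_lt_iff₀ (by positivity), ← dist_eq_norm]
      calc _ < _ := hN m hm n hn
        _ = _ := by ring
  have hlim : ∀ z : σ → ℂ, ∃ y : ℂ, z ∈ D → Tendsto (fun n => g n z) atTop (𝓝 y) := by
    intro z
    by_cases hz : z ∈ D
    · obtain ⟨r, hr, -, hu, -⟩ := hunif z hz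
      obtain ⟨y, hy⟩ := cauchySeq_tendsto_of_complete
        (hu.cauchySeq (Metric.mem_closedBall_self hr.le))
      exact ⟨y, fun _ => hy⟩
    · exact ⟨0, fun h => absurd h hz⟩
  choose G hG using hlim
  refine ⟨G, fun z hz => ?_, ?_⟩
  · obtain ⟨r, hr, hsub, -, hu⟩ := hunif z hz
    have hlim' : ∀ w : σ → ℂ, ∃ y, w ∈ Metric.closedBall z r →
        Tendsto (fun n => fderiv ℂ (g n) w) atTop (𝓝 y) := by
      intro w
      by_cases hw : w ∈ Metric.closedBall z r
      · obtain ⟨y, hy⟩ := cauchySeq_tendsto_of_complete (hu.cauchySeq hw)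
        exact ⟨y, fun _ => hy⟩
      · exact ⟨0, fun h => absurd h hw⟩
    choose G' hG' using hlim'
    have hsub' := Metric.ball_subset_closedBall.trans hsub
    have := hasFDerivAt_of_tendstoUniformlyOn (𝕜 := ℂ) (f := g) (g := G) (g' := G')
      (f' := fun n => fderiv ℂ (g n)) Metric.isOpen_ball
      ((hu.tendstoUniformlyOn_of_tendsto hG').mono Metric.ball_subset_closedBall)
      (fun n x hx => (hda n x (hsub' hx)).hasFDerivAt) (fun x hx => hG x (hsub' hx))
      (x := z) (Metric.mem_ball_self hr)
    exact this.differentiableAt.differentiableWithinAt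
  · obtain ⟨ns, hns, hae⟩ := (tendstoInMeasure_of_tendsto_Lp hFf).exists_seq_tendsto_ae
    have hall : ∀ᵐ x ∂volume.restrict (D : Set (σ → ℂ)), ∀ n, F n x = g n x :=
      ae_all_iff.2 hFg
    filter_upwards [hae, hall, ae_restrict_mem D.isOpen.measurableSet] with x h1 h2 h3
    have h4 := (hG x h3).comp hns.tendsto_atTop
    refine tendsto_nhds_unique h1 (h4.congr fun n => (h2 (ns n)).symm)

/-- The Bergman space is closed in `L²`, hence a Hilbert space. -/
instance instCompleteSpaceBergmanSpace {σ : Type*} [Fintype σ]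
    (D : TopologicalSpace.Opens (σ → ℂ)) : CompleteSpace (bergmanSpace D) :=
  (isClosed_bergmanSpace D).completeSpace_coe

theorem memLp_top_coordinate {σ : Type*} [Fintype σ] {D : TopologicalSpace.Opens (σ → ℂ)}
    (hD : Bornology.IsBounded (D : Set (σ → ℂ))) (i : σ) :
    MemLp (fun z : σ → ℂ => z i) ∞ (volume.restrict (D : Set (σ → ℂ))) := by
  obtain ⟨C, hC⟩ := hD.exists_norm_le
  refine memLp_top_of_bound (measurable_pi_apply i).aestronglyMeasurable C ?_
  filter_upwards [ae_restrict_mem D.isOpen.measurableSet] with z hz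
  exact (norm_le_pi_norm z i).trans (hC z hz)

/-- The operator `f ↦ zᵢ f` on the Bergman space of a bounded open set. -/
noncomputable def coordinateMul {σ : Type*} [Fintype σ] (D : TopologicalSpace.Opens (σ → ℂ))
    (hD : Bornology.IsBounded (D : Set (σ → ℂ))) (i : σ) : bergmanSpace D →L[ℂ] bergmanSpace D :=
  (((ContinuousLinearMap.mul ℂ ℂ).holderL (volume.restrict (D : Set (σ → ℂ))) ∞ 2 2
      ((memLp_top_coordinate hD i).toLp _)).comp (bergmanSpace D).subtypeL).codRestrict
    (bergmanSpace D) (by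
      rintro ⟨f, g, hg, hfg⟩
      refine ⟨fun z => z i * g z, (by fun_prop : DifferentiableOn ℂ (fun z : σ → ℂ => z i) D).mul hg,
        (ContinuousLinearMap.coeFn_holder _ _ _).trans ?_⟩
      filter_upwards [(memLp_top_coordinate hD i).coeFn_toLp, hfg] with z h1 h2
      change (memLp_top_coordinate hD i).toLp _ z * f z = z i * g z
      rw [h1, h2])

theorem coordinateMul_ae_eq {σ : Type*} [Fintype σ] (D : TopologicalSpace.Opens (σ → ℂ))
    (hD : Bornology.IsBounded (D : Set (σ → ℂ))) (i : σ) (f : bergmanSpace D) :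
    (coordinateMul D hD i f : Lp ℂ 2 (volume.restrict (D : Set (σ → ℂ))))
      =ᵐ[volume.restrict (D : Set (σ → ℂ))]
    fun z => z i * (f : Lp ℂ 2 (volume.restrict (D : Set (σ → ℂ)))) z := by
  refine (ContinuousLinearMap.coeFn_holder _ _ _).trans ?_
  filter_upwards [(memLp_top_coordinate hD i).coeFn_toLp] with z h1
  change (memLp_top_coordinate hD i).toLp _ z *
    (f : Lp ℂ 2 (volume.restrict (D : Set (σ → ℂ)))) z = _
  rw [h1]

/-- A bounded operator `A` is trace class when the trace `∑ ⟨|A| eᵢ, eᵢ⟩` of its absolute value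
`|A| = (A* A)^(1/2)` in a Hilbert basis is finite (the sum does not depend on the basis). -/
def IsTraceClass.{u} {H : Type u} [NormedAddCommGroup H] [InnerProductSpace ℂ H] [CompleteSpace H]
    (A : H →L[ℂ] H) : Prop :=
  ∃ (ι : Type u) (b : HilbertBasis ι ℂ H),
    Summable fun i => (inner ℂ (b i) (CFC.abs A (b i))).re

/-- `T` is (Schatten) `p`-summable when `(T T*)^(p/2)`, formed by the continuous functional
calculus, is trace class. -/
def IsSchattenSummable {H : Type*} [NormedAddCommGroup H] [InnerProductSpace ℂ H]
    [CompleteSpace H] (p : ℝ) (T : H →L[ℂ] H) : Prop :=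
  IsTraceClass ((T * ContinuousLinearMap.adjoint T) ^ (p / 2))

/-- A tuple of operators is `p`-essentially normal when it is commuting and all commutators
`[Tᵢ, Tⱼ*]` are `p`-summable. -/
def IsEssentiallyNormalTuple {H σ : Type*} [NormedAddCommGroup H] [InnerProductSpace ℂ H]
    [CompleteSpace H] (p : ℝ) (T : σ → H →L[ℂ] H) : Prop :=
  (∀ i j, Commute (T i) (T j)) ∧
  ∀ i j, IsSchattenSummable p
    (T i * ContinuousLinearMap.adjoint (T j) - ContinuousLinearMap.adjoint (T j) * T i)

/-- The `p`-essential normality of the Bergman module of a bounded open set `D`, i.e. of the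
module generated by the multiplications by the coordinate functions. -/
def IsEssentiallyNormalBergmanModule {σ : Type*} [Fintype σ] (p : ℝ)
    (D : TopologicalSpace.Opens (σ → ℂ)) (hD : Bornology.IsBounded (D : Set (σ → ℂ))) : Prop :=
  IsEssentiallyNormalTuple p (coordinateMul D hD)

/-- The generalized egg domain `{∑ₖ (∑ⱼ |zⱼₖ|^(2 rⱼₖ))^(aₖ) < 1}`; the `k`-th block has `n k`
variables, and the coordinate `zⱼₖ` is `z ⟨k, j⟩`. -/
def eggDomain {K : ℕ} (n : Fin K → ℕ) (a : Fin K → ℝ) (r : (k : Fin K) → Fin (n k) → ℝ)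
    (ha : ∀ k, 0 < a k) (hr : ∀ k j, 0 < r k j) :
    TopologicalSpace.Opens ((Σ k : Fin K, Fin (n k)) → ℂ) where
  carrier := {z | ∑ k, (∑ j, ‖z ⟨k, j⟩‖ ^ (2 * r k j)) ^ a k < 1}
  is_open' := by
    refine isOpen_lt ?_ continuous_const
    refine continuous_finsetSum _ fun k _ => Continuous.rpow_const ?_ fun _ => Or.inr (ha k).le
    refine continuous_finsetSum _ fun j _ => Continuous.rpow_const (by fun_prop) fun _ => Or.inr ?_
    linarith [hr k j]

theorem isBounded_eggDomain {K : ℕ} (n : Fin K → ℕ) (a : Fin K → ℝ)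
    (r : (k : Fin K) → Fin (n k) → ℝ) (ha : ∀ k, 0 < a k) (hr : ∀ k j, 0 < r k j) :
    Bornology.IsBounded
      (eggDomain n a r ha hr : Set ((Σ k : Fin K, Fin (n k)) → ℂ)) := by
  refine (Metric.isBounded_closedBall (x := 0) (r := 1)).subset fun z hz => ?_
  rw [mem_closedBall_zero_iff, pi_norm_le_iff_of_nonneg zero_le_one]
  rintro ⟨k, j⟩
  by_contra! h
  have hz' : ∑ k, (∑ j, ‖z ⟨k, j⟩‖ ^ (2 * r k j)) ^ a k < 1 := hz
  have h1 : (1 : ℝ) ≤ ‖z ⟨k, j⟩‖ ^ (2 * r k j) :=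
    Real.one_le_rpow h.le (by linarith [hr k j])
  have h2 : ‖z ⟨k, j⟩‖ ^ (2 * r k j) ≤ ∑ j, ‖z ⟨k, j⟩‖ ^ (2 * r k j) :=
    Finset.single_le_sum (f := fun j => ‖z ⟨k, j⟩‖ ^ (2 * r k j))
      (fun _ _ => by positivity) (Finset.mem_univ j)
  have h3 : (1 : ℝ) ≤ (∑ j, ‖z ⟨k, j⟩‖ ^ (2 * r k j)) ^ a k :=
    Real.one_le_rpow (h1.trans h2) (ha k).le
  have h4 : (∑ j, ‖z ⟨k, j⟩‖ ^ (2 * r k j)) ^ a k ≤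
      ∑ k, (∑ j, ‖z ⟨k, j⟩‖ ^ (2 * r k j)) ^ a k :=
    Finset.single_le_sum (f := fun k => (∑ j, ‖z ⟨k, j⟩‖ ^ (2 * r k j)) ^ a k)
      (fun _ _ => by positivity) (Finset.mem_univ k)
  linarith

/-- The number `q_k`. Each `⨆` is over a finite nonempty set of reals, i.e. a maximum (the index
set of the last one is nonempty in the case in which it is used). -/
noncomputable def blockExponent {K : ℕ} (n : Fin K → ℕ) (a : Fin K → ℝ)
    (r : (k : Fin K) → Fin (n k) → ℝ) (k : Fin K) : ℝ :=
  let d : ℝ := ∑ k, (n k : ℝ)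
  if n k = 1 then
    ⨆ j : Fin (n k), a k * r k j * (d - n k)
  else if a k = 1 then
    max (⨆ j : Fin (n k), r k j * (d - 1)) (⨆ j : Fin (n k), a k * r k j * (d - n k))
  else
    max (max (⨆ j : Fin (n k), r k j * (d - 1)) (⨆ j : Fin (n k), a k * r k j * (d - n k)))
      (⨆ jl : {jl : Fin (n k) × Fin (n k) // jl.1 ≠ jl.2},
        2 * a k * (d - n k) / (1 / r k jl.1.1 + 1 / r k jl.1.2))

/-- The critical exponent: `1/2` in dimension `d = 1`, and `max {d, q_1, …, q_K}` if `d > 1`. -/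
noncomputable def criticalExponent {K : ℕ} (n : Fin K → ℕ) (a : Fin K → ℝ)
    (r : (k : Fin K) → Fin (n k) → ℝ) : ℝ :=
  if ∑ k, n k = 1 then 1 / 2 else max (∑ k, (n k : ℝ)) (⨆ k, blockExponent n a r k)

/-! The domain is a bounded complete Reinhardt domain, so the normalized monomials form an
orthonormal basis of the Bergman space and every coordinate multiplication is a weighted shift `e α
↦ w i α • e (α + εᵢ)` (`exists_hilbertBasis_coordinateMul`). A commutator `[Mᵢ, Mⱼ*]` carries each
`e (β + εⱼ)` to a multiple of `e (β + εᵢ)`. On the face `αⱼ = 0` it is zero if `i ≠ j` and is `-w i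
α ^ 2` if `i = j`. Hence `T T*` is diagonal, and `p`-summability is convergence of explicit series
over multi-indices (`isSchattenSummable_commutator_iff`).

The squared norms `exp W` of the monomials are quotients of Gamma values
(`monomialNormSq_eggDomain`). The commutator weight is `exp ((ΔᵢW + ΔⱼW) / 2) * (1 - exp (ΔᵢΔⱼW))`.
Let `x = αᵢ + 1`, let `X` be the size of the block of `i`, `S` the total size, and `r`, `a` the
exponents at `i`. The asymptotics of `Γ(t + δ) / Γ(t)` give `exp (ΔᵢW) ≍ x^(1/r) X^(1/(ra) - 1/r)
S^(-1/(ra))` (`exists_abs_eggLogNormSq_sub_le`). The mixed second difference is at most a constant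
times the reciprocal of the geometric mean of `βᵢ + 1` and `βⱼ + 1`
(`exists_abs_second_difference_le`).

Sufficiency: everything is dominated by the series of `(exp (ΔᵢW) / x)^p`, whose term is comparable
to `x^(-p) (X/x)^(-p/r) (S/X)^(-p/(ra))`. Since `x ≤ X ≤ S`, a comparison with `∏ (αₛ + 1)^(-(1+η))`
reduces convergence to `p > d`, `p > r(d - 1)` (void for a block of one variable) and `p > ar(d -
n)`, where `n` is the block length (`summable_exp_eggWeightLog_sub`).

Necessity: each inequality comes from a family of dilated boxes (`card_lt_of_summable`). All
coordinates of order `N` give `d < p`; the face `αᵢ = 0` gives `r(d - 1) < p`; a whole block equal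
to zero gives `ar(d - n) < p`. The third family in `q_k` adds nothing, because its members are
harmonic means of two members of the family `ar(d - n)`. In dimension one the weights are those of
the disc, the self-commutator decays like `m^(-2)`, and the threshold is `1/2`. -/

/-! ### Taylor coefficients of holomorphic functions along complex lines -/

/-- Cauchy's formula for Taylor coefficients, as a circle average. -/
theorem circleAverage_inv_pow_mul {k : ℂ → ℂ} {R : ℝ} (hR : 0 < R)
    (hk : DifferentiableOn ℂ k (Metric.closedBall 0 R)) (m : ℕ) :
    Real.circleAverage (fun u => (u ^ m)⁻¹ * k u) 0 R =
      ((m.factorial : ℂ))⁻¹ * iteratedDeriv m k 0 := by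
  rw [Real.circleAverage_eq_circleIntegral hR.ne']
  have h := hk.circleIntegral_one_div_sub_center_pow_smul hR m
  have h2 : (∮ z in C(0, R), (z - 0)⁻¹ • ((z ^ m)⁻¹ * k z)) =
      ∮ z in C(0, R), (1 / (z - 0) ^ (m + 1)) • k z := by
    refine circleIntegral.integral_congr hR.le fun z _ => ?_
    simp only [sub_zero, smul_eq_mul, one_div, pow_succ, mul_inv]
    ring
  rw [h2, h, smul_smul]
  congr 1
  field_simp [Complex.two_pi_I_ne_zero]

/-- Directional derivatives of a holomorphic function of several variables are holomorphic. -/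
theorem differentiableOn_fderiv_apply {σ : Type*} [Fintype σ] {g : (σ → ℂ) → ℂ}
    {D : Set (σ → ℂ)} (hD : IsOpen D) (hg : DifferentiableOn ℂ g D) (v : σ → ℂ) :
    DifferentiableOn ℂ (fun z => fderiv ℂ g z v) D := by
  intro z₀ hz₀
  refine DifferentiableAt.differentiableWithinAt ?_
  obtain ⟨ρ, hρ, hsub⟩ := Metric.nhds_basis_closedBall.mem_iff.1 (hD.mem_nhds hz₀)
  have hda : ∀ w ∈ D, DifferentiableAt ℂ g w := fun w hw => hg.differentiableAt (hD.mem_nhds hw)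
  obtain ⟨R, hR, hRv⟩ : ∃ R > 0, R * ‖v‖ ≤ ρ / 3 :=
    ⟨ρ / 3 / (‖v‖ + 1), by positivity, by
      rw [div_mul_eq_mul_div, div_le_iff₀ (by positivity)]
      nlinarith [norm_nonneg v]⟩
  have hmem : ∀ z ∈ Metric.ball z₀ (ρ / 3), ∀ u ∈ Metric.closedBall (0 : ℂ) R,
      z + u • v ∈ Metric.closedBall z₀ (2 * (ρ / 3)) := by
    intro z hz u hu
    have h1 : ‖z - z₀‖ < ρ / 3 := by simpa [dist_eq_norm] using hz
    have h2 : ‖u‖ ≤ R := by simpa using hu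
    rw [Metric.mem_closedBall, dist_eq_norm, add_sub_right_comm]
    refine (norm_add_le _ _).trans ?_
    rw [norm_smul]
    nlinarith [norm_nonneg v]
  have hsub2 : Metric.closedBall z₀ (2 * (ρ / 3)) ⊆ D :=
    (Metric.closedBall_subset_closedBall (by linarith)).trans hsub
  obtain ⟨C, hC⟩ := (isCompact_closedBall z₀ ρ).exists_bound_of_continuousOn
    (hg.continuousOn.mono hsub)
  -- Cauchy's formula on the circle of radius `R` in direction `v` writes the derivative as an
  -- integral of values of `g`, which can be differentiated in `z` under the integral sign.
  have hform : ∀ z ∈ Metric.ball z₀ (ρ / 3), fderiv ℂ g z v =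
      (2 * Real.pi)⁻¹ • ∫ θ in (0)..(2 * Real.pi),
        (circleMap 0 R θ ^ 1)⁻¹ * g (z + circleMap 0 R θ • v) := by
    intro z hz
    have hd : DifferentiableOn ℂ (fun u : ℂ => g (z + u • v)) (Metric.closedBall 0 R) := by
      intro u hu
      exact (DifferentiableAt.comp u (f := fun u : ℂ => z + u • v)
        (hda _ (hsub2 (hmem z hz u hu))) (by fun_prop)).differentiableWithinAt
    have h1 := circleAverage_inv_pow_mul hR hd 1
    have hder : HasDerivAt (fun u : ℂ => g (z + u • v)) (fderiv ℂ g z v) 0 := by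
      have h1 : HasDerivAt (fun u : ℂ => z + u • v) v 0 := by
        simpa using ((hasDerivAt_id (0 : ℂ)).smul_const v).const_add z
      have h2 : HasFDerivAt g (fderiv ℂ g z) (z + (0 : ℂ) • v) := by
        have := hda _ (hsub2 (hmem z hz 0 (by simpa using hR.le)))
        simpa using (by simpa using this : DifferentiableAt ℂ g z).hasFDerivAt
      exact h2.comp_hasDerivAt 0 h1
    rw [iteratedDeriv_one, hder.deriv, Real.circleAverage_def] at h1
    simpa using h1.symm
  have hball : Metric.ball z₀ (ρ / 3) ∈ 𝓝 z₀ := Metric.ball_mem_nhds _ (by positivity)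
  refine DifferentiableAt.congr_of_eventuallyEq ?_ (eventually_of_mem hball hform)
  refine DifferentiableAt.const_smul (c := (2 * Real.pi)⁻¹) ?_
  simp only [pow_one]
  have hcm := continuous_circleMap 0 R
  have hne : ∀ θ, circleMap 0 R θ ≠ 0 := fun θ => circleMap_ne_center hR.ne'
  have hcmem : ∀ θ, circleMap 0 R θ ∈ Metric.closedBall (0 : ℂ) R := fun θ =>
    circleMap_mem_closedBall 0 hR.le θ
  have hcont : ∀ z ∈ Metric.ball z₀ (ρ / 3),
      Continuous (fun θ => (circleMap 0 R θ)⁻¹ * g (z + circleMap 0 R θ • v)) := by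
    intro z hz
    refine (hcm.inv₀ hne).mul ?_
    refine hg.continuousOn.comp_continuous (by fun_prop) fun θ => hsub2 (hmem z hz _ (hcmem θ))
  simp only [intervalIntegral.integral_of_le Real.two_pi_pos.le]
  -- The dominating constant is the Cauchy estimate on balls of radius `ρ / 3`, which stay inside
  -- the ball of radius `ρ` where `‖g‖ ≤ C`.
  refine (hasFDerivAt_integral_of_dominated_of_fderiv_le (𝕜 := ℂ)
    (F := fun z θ => (circleMap 0 R θ)⁻¹ * g (z + circleMap 0 R θ • v))
    (F' := fun z θ => (circleMap 0 R θ)⁻¹ • fderiv ℂ g (z + circleMap 0 R θ • v))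
    (bound := fun _ => R⁻¹ * (C / (ρ / 3))) hball ?_ ?_ ?_ ?_ ?_ ?_).differentiableAt
  · exact eventually_of_mem hball fun z hz => (hcont z hz).aestronglyMeasurable
  · exact ((hcont z₀ (Metric.mem_ball_self (by positivity))).continuousOn.integrableOn_compact
      (K := Set.Icc 0 (2 * Real.pi)) isCompact_Icc).mono_set Set.Ioc_subset_Icc_self
  · refine AEStronglyMeasurable.smul (hcm.inv₀ hne).aestronglyMeasurable ?_
    have h := (measurable_fderiv ℂ g).comp
      (by fun_prop : Measurable fun θ => z₀ + circleMap 0 R θ • v)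
    exact h.aestronglyMeasurable
  · refine Eventually.of_forall fun θ z hz => ?_
    rw [norm_smul, norm_inv, norm_circleMap_zero, abs_of_pos hR]
    gcongr
    have hball2 : Metric.closedBall (z + circleMap 0 R θ • v) (ρ / 3) ⊆
        Metric.closedBall z₀ ρ := by
      refine Metric.closedBall_subset_closedBall' ?_
      have := hmem z hz _ (hcmem θ)
      rw [Metric.mem_closedBall] at this
      linarith
    exact norm_fderiv_le_of_closedBall (by positivity) (fun w hw => hda w (hsub (hball2 hw)))
      fun w hw => hC w (hball2 hw)
  · exact integrable_const _
  · refine Eventually.of_forall fun θ z hz => ?_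
    have h := (hda _ (hsub2 (hmem z hz _ (hcmem θ)))).hasFDerivAt
    have h2 : HasFDerivAt (fun z => z + circleMap 0 R θ • v) (ContinuousLinearMap.id ℂ (σ → ℂ)) z :=
      (hasFDerivAt_id z).add_const _
    simpa using (h.comp z h2).const_mul _

/-- The Taylor coefficients along complex lines through the origin are homogeneous polynomials. -/
theorem exists_isHomogeneous_eval_eq_iteratedDeriv {σ : Type*} [Fintype σ]
    {D : Set (σ → ℂ)} (hD : IsOpen D) (h0 : (0 : σ → ℂ) ∈ D) (m : ℕ) :
    ∀ {g : (σ → ℂ) → ℂ}, DifferentiableOn ℂ g D →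
    ∃ q : MvPolynomial σ ℂ, q.IsHomogeneous m ∧
      ∀ z, iteratedDeriv m (fun u : ℂ => g (u • z)) 0 = MvPolynomial.eval z q := by
  classical
  induction m with
  | zero =>
    intro g _
    exact ⟨MvPolynomial.C (g 0), MvPolynomial.isHomogeneous_C _ _, fun z => by simp⟩
  | succ m ih =>
    intro g hg
    choose q hq hqe using fun i => ih (differentiableOn_fderiv_apply hD hg (Pi.single i 1))
    -- The derivative of `u ↦ g (u • z)` is `∑ zᵢ ∂ᵢg (u • z)`, and the induction hypothesis applies
    -- to each partial derivative.
    refine ⟨∑ i, MvPolynomial.X i * q i, ?_, fun z => ?_⟩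
    · refine MvPolynomial.IsHomogeneous.sum _ _ _ fun i _ => ?_
      rw [add_comm]
      exact (MvPolynomial.isHomogeneous_X ℂ i).mul (hq i)
    · have hopen : ∀ᶠ u : ℂ in 𝓝 0, u • z ∈ D := by
        have : Continuous fun u : ℂ => u • z := by fun_prop
        exact this.continuousAt.eventually_mem (by simpa using hD.mem_nhds h0)
      rw [iteratedDeriv_succ']
      have hev : deriv (fun u : ℂ => g (u • z)) =ᶠ[𝓝 0]
          fun u => ∑ i, z i * fderiv ℂ g (u • z) (Pi.single i 1) := by
        filter_upwards [hopen] with u hu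
        have h1 : HasDerivAt (fun u : ℂ => u • z) z u := by
          simpa using (hasDerivAt_id u).smul_const z
        have h2 := (hg.differentiableAt (hD.mem_nhds hu)).hasFDerivAt.comp_hasDerivAt u h1
        refine h2.deriv.trans ?_
        generalize fderiv ℂ g (u • z) = l
        conv_lhs => rw [pi_eq_sum_univ' z]
        simp
      rw [hev.iteratedDeriv_eq]
      have hcd : ∀ i, ContDiffAt ℂ m (fun u : ℂ => fderiv ℂ g (u • z) (Pi.single i 1)) 0 := by
        intro i
        have : AnalyticAt ℂ (fun u : ℂ => fderiv ℂ g (u • z) (Pi.single i 1)) 0 := by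
          rw [Complex.analyticAt_iff_eventually_differentiableAt]
          filter_upwards [hopen] with u hu
          exact DifferentiableAt.comp u (g := fun z => fderiv ℂ g z (Pi.single i 1))
            (f := fun u : ℂ => u • z) ((differentiableOn_fderiv_apply hD hg _).differentiableAt
            (hD.mem_nhds hu)) (by fun_prop)
        exact this.contDiffAt
      rw [iteratedDeriv_fun_sum fun i _ => contDiffAt_const.mul (hcd i)]
      simp only [map_sum, map_mul, MvPolynomial.eval_X]
      refine Finset.sum_congr rfl fun i _ => ?_
      rw [iteratedDeriv_const_mul _ (hcd i), hqe]

/-! ### Complete Reinhardt domains and completeness of the monomials -/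

theorem measurePreserving_pi_mul {σ : Type*} [Fintype σ] {u : σ → ℂ} (hu : ∀ i, ‖u i‖ = 1) :
    MeasurePreserving (fun (z : σ → ℂ) (i : σ) => u i * z i) :=
  volume_preserving_pi (f := fun i w => u i * w) fun i =>
    (rotation (⟨u i, by simpa [Submonoid.unitSphere] using hu i⟩ : Circle)).measurePreserving

theorem measurableEmbedding_pi_mul {σ : Type*} [Fintype σ] {u : σ → ℂ} (hu : ∀ i, u i ≠ 0) :
    MeasurableEmbedding (fun (z : σ → ℂ) (i : σ) => u i * z i) :=
  (Homeomorph.piCongrRight fun i => Homeomorph.mulLeft₀ (u i) (hu i)).measurableEmbedding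

/-- A complete Reinhardt domain: closed under shrinking the moduli of the coordinates. -/
def IsCompleteReinhardt {σ : Type*} (D : Set (σ → ℂ)) : Prop :=
  ∀ z ∈ D, ∀ w : σ → ℂ, (∀ i, ‖w i‖ ≤ ‖z i‖) → w ∈ D

theorem IsCompleteReinhardt.preimage_mul {σ : Type*} {D : Set (σ → ℂ)}
    (hD : IsCompleteReinhardt D) {u : σ → ℂ} (hu : ∀ i, ‖u i‖ = 1) :
    (fun (z : σ → ℂ) (i : σ) => u i * z i) ⁻¹' D = D := by
  ext z
  exact ⟨fun h => hD _ h _ fun i => by simp [hu], fun h => hD _ h _ fun i => by simp [hu]⟩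

theorem IsCompleteReinhardt.measurePreserving {σ : Type*} [Fintype σ] {D : Set (σ → ℂ)}
    (hD : IsCompleteReinhardt D) (hm : MeasurableSet D) {u : σ → ℂ} (hu : ∀ i, ‖u i‖ = 1) :
    MeasurePreserving (fun (z : σ → ℂ) (i : σ) => u i * z i) (volume.restrict D)
      (volume.restrict D) := by
  have := (measurePreserving_pi_mul hu).restrict_preimage hm
  rwa [hD.preimage_mul hu] at this

theorem IsCompleteReinhardt.setIntegral_mul {σ : Type*} [Fintype σ] {D : Set (σ → ℂ)}
    (hD : IsCompleteReinhardt D) (hm : MeasurableSet D) {u : σ → ℂ} (hu : ∀ i, ‖u i‖ = 1)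
    (F : (σ → ℂ) → ℂ) : ∫ z in D, F (fun i => u i * z i) = ∫ z in D, F z :=
  (hD.measurePreserving hm hu).integral_comp
    (measurableEmbedding_pi_mul fun i h => by simpa [h] using hu i) F

/-- The monomial `z^α`. -/
def monomialFun {σ : Type*} [Fintype σ] (α : σ → ℕ) (z : σ → ℂ) : ℂ := ∏ i, z i ^ α i

theorem differentiable_monomialFun {σ : Type*} [Fintype σ] (α : σ → ℕ) :
    Differentiable ℂ (monomialFun α) := by
  unfold monomialFun
  fun_prop

theorem MemLp.integrable_conj_mul {X : Type*} [MeasurableSpace X] {μ : Measure X} {f g : X → ℂ}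
    (hf : MemLp f 2 μ) (hg : MemLp g 2 μ) :
    Integrable (fun x => (starRingEnd ℂ) (f x) * g x) μ :=
  MemLp.integrable_mul (p := 2) (q := 2) hf.star hg

theorem Continuous.memLp_restrict_of_isBounded {σ : Type*} [Fintype σ]
    {D : Set (σ → ℂ)} (hm : MeasurableSet D) (hb : Bornology.IsBounded D) {f : (σ → ℂ) → ℂ}
    (hf : Continuous f) : MemLp f 2 (volume.restrict D) := by
  have hfin : IsFiniteMeasure (volume.restrict D) :=
    ⟨by simpa using hb.measure_lt_top⟩
  obtain ⟨C, hC⟩ := (hb.isCompact_closure).exists_bound_of_continuousOn hf.continuousOn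
  refine MemLp.of_bound hf.aestronglyMeasurable C ?_
  filter_upwards [ae_restrict_mem hm] with z hz
  exact hC z (subset_closure hz)

/-- Pairing a holomorphic function with a homogeneous polynomial only sees the homogeneous
component of the same degree. -/
theorem setIntegral_conj_eval_mul {σ : Type*} [Fintype σ] {D : Set (σ → ℂ)}
    (hDo : IsOpen D) (hD : IsCompleteReinhardt D) (hb : Bornology.IsBounded D)
    {g : (σ → ℂ) → ℂ} (hg : DifferentiableOn ℂ g D) (hg2 : MemLp g 2 (volume.restrict D))
    {m : ℕ} {q : MvPolynomial σ ℂ} (hq : q.IsHomogeneous m) :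
    ∫ z in D, (starRingEnd ℂ) (MvPolynomial.eval z q) * g z =
      ∫ z in D, (starRingEnd ℂ) (MvPolynomial.eval z q) *
        ((m.factorial : ℂ)⁻¹ * iteratedDeriv m (fun u : ℂ => g (u • z)) 0) := by
  have hm := hDo.measurableSet
  have hqc : Continuous fun z => MvPolynomial.eval z q := MvPolynomial.continuous_eval q
  set h : (σ → ℂ) → ℂ := fun z => (starRingEnd ℂ) (MvPolynomial.eval z q) * g z with hh
  have hint : IntegrableOn h D :=
    MemLp.integrable_conj_mul (hqc.memLp_restrict_of_isBounded hm hb) hg2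
  have hcD : ∀ θ : ℝ, ∀ z ∈ D, circleMap 0 1 θ • z ∈ D := fun θ z hz =>
    hD z hz _ fun i => by simp
  have hrot : ∀ θ : ℝ, ∫ z in D, h (circleMap 0 1 θ • z) = ∫ z in D, h z := fun θ =>
    hD.setIntegral_mul hm (u := fun _ => circleMap 0 1 θ) (by simp) h
  have hcm := continuous_circleMap 0 1
  have hcont : ContinuousOn (fun p : ℝ × (σ → ℂ) => h (circleMap 0 1 p.1 • p.2))
      (Set.univ ×ˢ D) := by
    refine ContinuousOn.mul (Continuous.continuousOn ?_) ?_
    · exact Complex.continuous_conj.comp (hqc.comp (by fun_prop))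
    · exact hg.continuousOn.comp (f := fun p : ℝ × (σ → ℂ) => circleMap 0 1 p.1 • p.2)
        (by fun_prop) fun p hp => hcD p.1 p.2 hp.2
  have hI : Integrable (Function.uncurry fun (θ : ℝ) (z : σ → ℂ) => h (circleMap 0 1 θ • z))
      ((volume.restrict (Set.uIoc 0 (2 * Real.pi))).prod (volume.restrict D)) := by
    have hmeas : AEStronglyMeasurable
        (Function.uncurry fun (θ : ℝ) (z : σ → ℂ) => h (circleMap 0 1 θ • z))
        ((volume.restrict (Set.uIoc 0 (2 * Real.pi))).prod (volume.restrict D)) := by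
      rw [Measure.prod_restrict]
      exact (hcont.mono (Set.prod_mono (Set.subset_univ _) subset_rfl)).aestronglyMeasurable
        (measurableSet_uIoc.prod hm)
    -- `g` need not be bounded on `D`; integrability on the product holds because rotation leaves
    -- the `L¹` norm of each slice unchanged.
    rw [integrable_prod_iff hmeas]
    have hmp : ∀ θ : ℝ, MeasurePreserving (fun z : σ → ℂ => circleMap 0 1 θ • z)
        (volume.restrict D) (volume.restrict D) := fun θ =>
      hD.measurePreserving hm (u := fun _ => circleMap 0 1 θ) (by simp)
    have hme : ∀ θ : ℝ, MeasurableEmbedding (fun z : σ → ℂ => circleMap 0 1 θ • z) := fun θ =>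
      measurableEmbedding_pi_mul (u := fun _ => circleMap 0 1 θ) fun i h => by
        simpa [h] using norm_circleMap_zero 1 θ
    refine ⟨Eventually.of_forall fun θ => ((hmp θ).integrable_comp_emb (hme θ)).2 hint, ?_⟩
    have : (fun θ : ℝ => ∫ z in D, ‖Function.uncurry
        (fun (θ : ℝ) (z : σ → ℂ) => h (circleMap 0 1 θ • z)) (θ, z)‖) =
        fun _ => ∫ z in D, ‖h z‖ := by
      funext θ
      exact (hmp θ).integral_comp (hme θ) fun z => ‖h z‖
    rw [this, Set.uIoc_of_le Real.two_pi_pos.le]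
    exact integrable_const _
  have hkey : ∀ z ∈ D, (2 * Real.pi)⁻¹ • ∫ θ in (0)..(2 * Real.pi), h (circleMap 0 1 θ • z) =
      (starRingEnd ℂ) (MvPolynomial.eval z q) *
        ((m.factorial : ℂ)⁻¹ * iteratedDeriv m (fun u : ℂ => g (u • z)) 0) := by
    intro z hz
    have hd : DifferentiableOn ℂ (fun u : ℂ => g (u • z)) (Metric.closedBall 0 1) := by
      refine hg.comp (f := fun u : ℂ => u • z) (by fun_prop) fun u hu => hD z hz _ fun i => ?_
      have : ‖u‖ ≤ 1 := by simpa using hu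
      simpa using mul_le_mul_of_nonneg_right this (norm_nonneg (z i))
    rw [← circleAverage_inv_pow_mul one_pos hd m, Real.circleAverage_def, mul_smul_comm,
      ← intervalIntegral.integral_const_mul]
    congr 1
    refine intervalIntegral.integral_congr fun θ _ => ?_
    have h1 : MvPolynomial.eval (circleMap 0 1 θ • z) q =
        circleMap 0 1 θ ^ m * MvPolynomial.eval z q := by
      rw [MvPolynomial.eval_eq', MvPolynomial.eval_eq', Finset.mul_sum]
      refine Finset.sum_congr rfl fun d hd => ?_
      have hdeg : ∑ i, d i = m := by
        rw [← Finsupp.degree_eq_sum, Finsupp.degree_eq_weight_one]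
        exact hq (MvPolynomial.mem_support_iff.1 hd)
      simp only [Pi.smul_apply, smul_eq_mul, mul_pow, Finset.prod_mul_distrib,
        Finset.prod_pow_eq_pow_sum, hdeg]
      ring
    -- On the unit circle conjugation is inversion, so homogeneity of `q` produces exactly the
    -- factor `(u ^ m)⁻¹` of Cauchy's formula.
    have h2 : (starRingEnd ℂ) (circleMap 0 1 θ) = (circleMap 0 1 θ)⁻¹ := by
      rw [Complex.inv_def, Complex.normSq_eq_norm_sq]
      simp
    simp only [hh, h1, map_mul, map_pow, h2, inv_pow]
    ring
  calc ∫ z in D, h z = (2 * Real.pi)⁻¹ • ∫ θ in (0)..(2 * Real.pi), ∫ z in D, h z := by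
        rw [intervalIntegral.integral_const, sub_zero, smul_smul,
          inv_mul_cancel₀ (by positivity), one_smul]
    _ = (2 * Real.pi)⁻¹ • ∫ θ in (0)..(2 * Real.pi), ∫ z in D, h (circleMap 0 1 θ • z) := by
        simp_rw [hrot]
    _ = ∫ z in D, (2 * Real.pi)⁻¹ • ∫ θ in (0)..(2 * Real.pi), h (circleMap 0 1 θ • z) := by
        rw [integral_smul, intervalIntegral_integral_swap hI]
    _ = _ := setIntegral_congr_fun hm hkey

/-- A square-integrable holomorphic function that is orthogonal to all monomials vanishes. -/
theorem ae_eq_zero_of_forall_setIntegral_monomialFun {σ : Type*} [Fintype σ] {D : Set (σ → ℂ)}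
    (hDo : IsOpen D) (hD : IsCompleteReinhardt D) (hb : Bornology.IsBounded D)
    {g : (σ → ℂ) → ℂ} (hg : DifferentiableOn ℂ g D) (hg2 : MemLp g 2 (volume.restrict D))
    (horth : ∀ α, ∫ z in D, (starRingEnd ℂ) (monomialFun α z) * g z = 0) :
    g =ᵐ[volume.restrict D] 0 := by
  have hm := hDo.measurableSet
  rcases D.eq_empty_or_nonempty with rfl | ⟨w, hw⟩
  · simp only [Measure.restrict_empty, ae_zero]; exact Filter.eventually_bot
  have h0 : (0 : σ → ℂ) ∈ D := hD w hw _ fun i => by simp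
  choose q hq hqe using fun m => exists_isHomogeneous_eval_eq_iteratedDeriv hDo h0 m hg
  have hqc : ∀ m, Continuous fun z => MvPolynomial.eval z (q m) := fun m =>
    MvPolynomial.continuous_eval _
  have hz : ∀ m, (fun z => MvPolynomial.eval z (q m)) =ᵐ[volume.restrict D] 0 := by
    intro m
    have h1 := setIntegral_conj_eval_mul hDo hD hb hg hg2 (hq m)
    have h2 : ∫ z in D, (starRingEnd ℂ) (MvPolynomial.eval z (q m)) * g z = 0 := by
      have : ∀ z, (starRingEnd ℂ) (MvPolynomial.eval z (q m)) * g z =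
          ∑ d ∈ (q m).support, (starRingEnd ℂ) ((q m).coeff d) *
            ((starRingEnd ℂ) (monomialFun d z) * g z) := by
        intro z
        rw [MvPolynomial.eval_eq', map_sum, Finset.sum_mul]
        refine Finset.sum_congr rfl fun d _ => ?_
        rw [map_mul, mul_assoc]; rfl
      simp_rw [this]
      rw [integral_finsetSum (q m).support fun d _ => Integrable.const_mul (MemLp.integrable_conj_mul
        ((differentiable_monomialFun d).continuous.memLp_restrict_of_isBounded hm hb) hg2) _]
      refine Finset.sum_eq_zero fun d _ => ?_
      rw [integral_const_mul, horth, mul_zero]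
    rw [h2] at h1
    simp_rw [hqe] at h1
    -- Pairing `g` with its own Taylor polynomial `q m` makes the integrand `‖q m‖² / m!`, so `q m`
    -- vanishes almost everywhere.
    have h3 : ∀ z, (starRingEnd ℂ) (MvPolynomial.eval z (q m)) *
        ((m.factorial : ℂ)⁻¹ * MvPolynomial.eval z (q m)) =
        (m.factorial : ℂ)⁻¹ * ((‖MvPolynomial.eval z (q m)‖ ^ 2 : ℝ) : ℂ) := by
      intro z
      push_cast
      rw [← Complex.conj_mul']
      ring
    simp_rw [h3] at h1
    rw [integral_const_mul] at h1
    have h5 : ∫ z in D, ((‖MvPolynomial.eval z (q m)‖ ^ 2 : ℝ) : ℂ) =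
      ((∫ z in D, ‖MvPolynomial.eval z (q m)‖ ^ 2 : ℝ) : ℂ) := integral_ofReal
    rw [h5] at h1
    have h4 : ∫ z in D, ‖MvPolynomial.eval z (q m)‖ ^ 2 = 0 := by
      have := (mul_eq_zero.1 h1.symm).resolve_left
        (inv_ne_zero (by exact_mod_cast m.factorial_ne_zero))
      exact_mod_cast this
    have hqL := (hqc m).memLp_restrict_of_isBounded hm hb
    rw [integral_eq_zero_iff_of_nonneg (fun z => by positivity)
      ((memLp_two_iff_integrable_sq_norm hqL.1).1 hqL)] at h4
    filter_upwards [h4] with z hz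
    simpa using hz
  have hall : ∀ᵐ z ∂volume.restrict D, ∀ m, MvPolynomial.eval z (q m) = 0 :=
    ae_all_iff.2 hz
  filter_upwards [hall, ae_restrict_mem hm] with z hz hzD
  have hopen : IsOpen {u : ℂ | u • z ∈ D} := hDo.preimage (by fun_prop)
  -- Openness of `D` gives a disc of radius larger than 1, so the Taylor series of `u ↦ g (u • z)`
  -- may be evaluated at `u = 1`.
  have hball : ∃ R > 1, Metric.ball (0 : ℂ) R ⊆ {u : ℂ | u • z ∈ D} := by
    obtain ⟨ε, hε, hsub⟩ := Metric.isOpen_iff.1 hopen 1 (by simpa using hzD)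
    refine ⟨1 + ε / 2, by linarith, fun u hu => ?_⟩
    have hu' : ‖u‖ < 1 + ε / 2 := by simpa using hu
    have : ((1 + ε / 2 : ℝ) : ℂ) • z ∈ D := hsub (by
      rw [Metric.mem_ball, dist_eq_norm]
      push_cast
      rw [add_sub_cancel_left]
      rw [norm_div, Complex.norm_of_nonneg hε.le, Complex.norm_ofNat]
      linarith)
    refine hD _ this _ fun i => ?_
    simp only [Pi.smul_apply, smul_eq_mul, norm_mul]
    gcongr
    rw [Complex.norm_of_nonneg (by positivity)]
    exact hu'.le
  obtain ⟨R, hR, hsub⟩ := hball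
  have hd : DifferentiableOn ℂ (fun u : ℂ => g (u • z)) (Metric.ball 0 R) :=
    hg.comp (f := fun u : ℂ => u • z) (by fun_prop) hsub
  have hs := Complex.hasSum_taylorSeries_on_ball hd (z := 1) (by simpa using hR)
  simp only [hqe, hz, smul_zero, one_smul] at hs
  simpa using hs.unique hasSum_zero

/-! ### Functional calculus on eigenvectors and summability of diagonal operators -/

theorem ContinuousLinearMap.mem_spectrum_real_of_apply_eq_smul {H : Type*} [NormedAddCommGroup H]
    [InnerProductSpace ℂ H] [CompleteSpace H] {A : H →L[ℂ] H} {x : H} (hx : x ≠ 0) {μ : ℝ}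
    (h : A x = (μ : ℂ) • x) : μ ∈ spectrum ℝ A := by
  rw [spectrum.mem_iff]
  rintro ⟨u, hu⟩
  have h0 : (u : H →L[ℂ] H) x = 0 := by
    rw [hu, sub_apply, h, Algebra.algebraMap_eq_smul_one]
    simp
  apply hx
  calc x = (1 : H →L[ℂ] H) x := rfl
    _ = ((↑u⁻¹ : H →L[ℂ] H) * ↑u) x := by rw [u.inv_mul]
    _ = (↑u⁻¹ : H →L[ℂ] H) ((u : H →L[ℂ] H) x) := rfl
    _ = 0 := by rw [h0, map_zero]

/-- The continuous functional calculus acts on an eigenvector by the value at the eigenvalue. -/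
theorem cfc_apply_of_apply_eq_smul {H : Type*} [NormedAddCommGroup H] [InnerProductSpace ℂ H]
    [CompleteSpace H] {A : H →L[ℂ] H} (hA : IsSelfAdjoint A) {x : H} {μ : ℝ}
    (h : A x = (μ : ℂ) • x) {f : ℝ → ℝ} (hf : ContinuousOn f (spectrum ℝ A)) :
    cfc f A x = ((f μ : ℝ) : ℂ) • x := by
  rcases eq_or_ne x 0 with rfl | hx
  · simp
  have hμ := ContinuousLinearMap.mem_spectrum_real_of_apply_eq_smul hx h
  rw [cfc_apply f A hA hf]
  -- Stone–Weierstrass: the identity holds for constants and for the coordinate function, and is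
  -- stable under sums, products and limits.
  suffices H : ∀ g : C(spectrum ℝ A, ℝ), cfcHom hA g x = ((g ⟨μ, hμ⟩ : ℝ) : ℂ) • x from H _
  have hid : cfcHom hA ((ContinuousMap.id ℝ).restrict (spectrum ℝ A)) x = (μ : ℂ) • x := by
    rw [cfcHom_id, h]
  intro g
  induction g using ContinuousMap.induction_on_of_compact with
  | const r =>
    have : ContinuousMap.const (spectrum ℝ A) r = algebraMap ℝ C(spectrum ℝ A, ℝ) r := rfl
    rw [this, AlgHomClass.commutes, Algebra.algebraMap_eq_smul_one]
    simp
  | id => exact hid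
  | star_id =>
    have : star ((ContinuousMap.id ℝ).restrict (spectrum ℝ A)) =
        (ContinuousMap.id ℝ).restrict (spectrum ℝ A) := by ext; simp
    rw [this]
    exact hid
  | add f g hf hg => simp [map_add, hf, hg, add_smul]
  | mul f g hf hg =>
    simp only [map_mul, mul_apply_eq_comp, hg, map_smul, hf, ContinuousMap.mul_apply,
      smul_smul]
    push_cast
    rw [mul_comm]
  | frequently f h =>
    refine h.mem_of_closed (isClosed_eq ?_ ?_)
    · exact (ContinuousLinearMap.apply ℂ H x).continuous.comp (cfcHom_continuous hA)
    · have : Continuous fun g : C(spectrum ℝ A, ℝ) => g ⟨μ, hμ⟩ := by fun_prop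
      fun_prop

theorem rpow_apply_of_apply_eq_smul {H : Type*} [NormedAddCommGroup H] [InnerProductSpace ℂ H]
    [CompleteSpace H] {A : H →L[ℂ] H} (hA : 0 ≤ A) {x : H} {μ : ℝ}
    (h : A x = (μ : ℂ) • x) {s : ℝ} (hs : 0 < s) :
    (A ^ s) x = ((μ ^ s : ℝ) : ℂ) • x := by
  rw [CFC.rpow_eq_cfc_real hA]
  exact cfc_apply_of_apply_eq_smul (IsSelfAdjoint.of_nonneg hA) h
    (Real.continuous_rpow_const hs.le).continuousOn

/-- A positive operator that is diagonal in a Hilbert basis is trace class exactly when its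
eigenvalues are summable. -/
theorem isTraceClass_iff_summable.{u} {H : Type u} [NormedAddCommGroup H] [InnerProductSpace ℂ H]
    [CompleteSpace H] {ι : Type u} (e : HilbertBasis ι ℂ H) {B : H →L[ℂ] H} (hB : 0 ≤ B)
    {ν : ι → ℝ} (hν : ∀ i, B (e i) = (ν i : ℂ) • e i) : IsTraceClass B ↔ Summable ν := by
  have habs : CFC.abs B = B := CFC.abs_of_nonneg B hB
  have hee : ∀ i, inner ℂ (e i) (e i) = (1 : ℂ) := fun i => by
    rw [inner_self_eq_norm_sq_to_K, e.orthonormal.1 i]; simp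
  have hdiag : ∀ i, (inner ℂ (e i) (B (e i))).re = ν i := fun i => by
    rw [hν, inner_smul_right, hee]; simp
  have hpos : B.IsPositive := (ContinuousLinearMap.nonneg_iff_isPositive B).1 hB
  have hν0 : ∀ i, 0 ≤ ν i := fun i => by
    rw [← hdiag i]
    exact hpos.re_inner_nonneg_right (e i)
  constructor
  · rintro ⟨κ, b, hs⟩
    rw [habs] at hs
    have hsum : ∀ j, HasSum (fun i => ν i * ‖inner ℂ (e i) (b j)‖ ^ 2)
        (inner ℂ (b j) (B (b j))).re := by
      intro j
      have h1 := e.hasSum_inner_mul_inner (b j) (B (b j))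
      have h2 := Complex.hasSum_re h1
      convert h2 using 2 with i
      have h3 : inner ℂ (e i) (B (b j)) = (ν i : ℂ) * inner ℂ (e i) (b j) := by
        rw [← hpos.isSelfAdjoint.adjoint_eq, ContinuousLinearMap.adjoint_inner_right, hν,
          inner_smul_left, Complex.conj_ofReal]
      rw [h3, mul_left_comm, ← inner_conj_symm (b j) (e i), Complex.conj_mul',
        ← Complex.ofReal_pow, ← Complex.ofReal_mul, Complex.ofReal_re]
    have hb1 : ∀ i, HasSum (fun j => ν i * ‖inner ℂ (e i) (b j)‖ ^ 2) (ν i) := by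
      intro i
      have h1 := b.hasSum_inner_mul_inner (e i) (e i)
      have h2 := (Complex.hasSum_re h1).mul_left (ν i)
      rw [hee, Complex.one_re, mul_one] at h2
      have h3 : ∀ j, (inner ℂ (e i) (b j) * inner ℂ (b j) (e i)).re =
          ‖inner ℂ (e i) (b j)‖ ^ 2 := fun j => by
        rw [← inner_conj_symm (b j) (e i), Complex.mul_conj', ← Complex.ofReal_pow,
          Complex.ofReal_re]
      simpa only [h3] using h2
    -- Basis independence is Tonelli for `ν i * ‖⟪e i, b j⟫‖²`: summing over `i` gives the diagonal
    -- entries in the basis `b`, summing over `j` gives `ν i`.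
    have hprod : Summable fun q : κ × ι => ν q.2 * ‖inner ℂ (e q.2) (b q.1)‖ ^ 2 := by
      rw [summable_prod_of_nonneg fun q => by have := hν0 q.2; positivity]
      exact ⟨fun j => (hsum j).summable, by simpa only [(hsum _).tsum_eq] using hs⟩
    have := hprod.prod_symm.prod
    simpa only [Prod.swap, (hb1 _).tsum_eq] using this
  · intro hs
    exact ⟨ι, e, by simpa only [habs, hdiag] using hs⟩

theorem isSchattenSummable_iff_summable.{u} {H : Type u} [NormedAddCommGroup H]
    [InnerProductSpace ℂ H] [CompleteSpace H] {ι : Type u} (e : HilbertBasis ι ℂ H)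
    {T : H →L[ℂ] H} {s : ι → ℝ} (hs : ∀ i, (T * ContinuousLinearMap.adjoint T) (e i) = (s i : ℂ) • e i)
    {p : ℝ} (hp : 0 < p) : IsSchattenSummable p T ↔ Summable fun i => s i ^ (p / 2) := by
  have hT : 0 ≤ T * ContinuousLinearMap.adjoint T := mul_star_self_nonneg T
  exact isTraceClass_iff_summable e CFC.rpow_nonneg fun i =>
    rpow_apply_of_apply_eq_smul hT (hs i) (by positivity)

theorem HilbertBasis.ext_inner {H : Type*} [NormedAddCommGroup H] [InnerProductSpace ℂ H]
    {ι : Type*} (e : HilbertBasis ι ℂ H) {x y : H}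
    (h : ∀ i, inner ℂ (e i) x = inner ℂ (e i) y) : x = y := by
  apply e.repr.injective
  ext i
  simpa only [HilbertBasis.repr_apply_apply] using h i

theorem HilbertBasis.inner_eq_ite {H : Type*} [NormedAddCommGroup H] [InnerProductSpace ℂ H]
    {ι : Type*} [DecidableEq ι] (e : HilbertBasis ι ℂ H) (i j : ι) :
    inner ℂ (e i) (e j) = if i = j then (1 : ℂ) else 0 := orthonormal_iff_ite.1 e.orthonormal i j

theorem adjoint_commutator {σ H : Type*} [NormedAddCommGroup H] [InnerProductSpace ℂ H]
    [CompleteSpace H] {M : σ → H →L[ℂ] H} (i j : σ) :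
    ContinuousLinearMap.adjoint
      (M i * ContinuousLinearMap.adjoint (M j) - ContinuousLinearMap.adjoint (M j) * M i) =
    M j * ContinuousLinearMap.adjoint (M i) - ContinuousLinearMap.adjoint (M i) * M j := by
  simp only [← ContinuousLinearMap.star_eq_adjoint, star_sub, star_mul, star_star]

/-! ### Commutators of weighted shifts on multi-indices -/

section WeightedShift

variable {σ : Type*} [DecidableEq σ]

theorem add_single_injective (i : σ) :
    Function.Injective fun β : σ → ℕ => β + Pi.single i 1 := add_left_injective (Pi.single i 1)

theorem mem_range_add_single {i : σ} {α : σ → ℕ} :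
    α ∈ Set.range (fun β : σ → ℕ => β + Pi.single i 1) ↔ α i ≠ 0 := by
  constructor
  · rintro ⟨β, rfl⟩
    simp
  · intro h
    refine ⟨α - Pi.single i 1, ?_⟩
    funext j
    by_cases hj : j = i
    · subst hj
      simp; omega
    · simp [hj]

/-- The multi-indices split into the image of the shift by `εᵢ` and the face `α i = 0`, where the
commutators act by two different formulas. -/
theorem summable_iff_add_single (i : σ) {F : (σ → ℕ) → ℝ} :
    Summable F ↔ Summable (fun β : σ → ℕ => F (β + Pi.single i 1)) ∧
      Summable fun α => if α i = 0 then F α else 0 := by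
  have h1 : Summable (fun β : σ → ℕ => F (β + Pi.single i 1)) ↔
      Summable fun α => if α i = 0 then 0 else F α := by
    rw [← (add_single_injective i).summable_iff (f := fun α => if α i = 0 then 0 else F α)]
    · simp [Function.comp_def]
    · intro α hα
      rw [mem_range_add_single, not_not] at hα
      simp [hα]
  rw [h1]
  constructor
  · intro h
    constructor
    · refine (h.indicator {α | α i ≠ 0}).congr fun α => ?_
      by_cases hα : α i = 0 <;> simp [hα]
    · refine (h.indicator {α | α i = 0}).congr fun α => ?_
      by_cases hα : α i = 0 <;> simp [hα]
  · rintro ⟨h, h'⟩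
    refine (h.add h').congr fun α => ?_
    split_ifs <;> simp

variable {H : Type*} [NormedAddCommGroup H] [InnerProductSpace ℂ H] [CompleteSpace H]
  (e : HilbertBasis (σ → ℕ) ℂ H) {M : σ → H →L[ℂ] H} {w : σ → (σ → ℕ) → ℝ}

theorem adjoint_shift_apply_add (hM : ∀ i α, M i (e α) = (w i α : ℂ) • e (α + Pi.single i 1))
    (i : σ) (β : σ → ℕ) :
    ContinuousLinearMap.adjoint (M i) (e (β + Pi.single i 1)) = (w i β : ℂ) • e β := by
  classical
  refine e.ext_inner fun γ => ?_
  rw [ContinuousLinearMap.adjoint_inner_right, hM, inner_smul_left, inner_smul_right,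
    e.inner_eq_ite, e.inner_eq_ite]
  by_cases h : γ = β
  · simp [h]
  · simp [h]

theorem adjoint_shift_apply_zero (hM : ∀ i α, M i (e α) = (w i α : ℂ) • e (α + Pi.single i 1))
    {i : σ} {α : σ → ℕ} (hα : α i = 0) :
    ContinuousLinearMap.adjoint (M i) (e α) = 0 := by
  classical
  refine e.ext_inner fun γ => ?_
  rw [ContinuousLinearMap.adjoint_inner_right, hM, inner_smul_left, e.inner_eq_ite, if_neg]
  · simp
  · rintro rfl
    simp at hα

/-- The weight of the commutator `[Mᵢ, Mⱼ*]` of weighted shifts: it maps `e (β + εⱼ)` to a multiple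
of `e (β + εᵢ)`. -/
def commutatorWeight (w : σ → (σ → ℕ) → ℝ) (i j : σ) (β : σ → ℕ) : ℝ :=
  w i β * w j β - w i (β + Pi.single j 1) * w j (β + Pi.single i 1)

theorem commutator_apply_add (hM : ∀ i α, M i (e α) = (w i α : ℂ) • e (α + Pi.single i 1))
    (i j : σ) (β : σ → ℕ) :
    (M i * ContinuousLinearMap.adjoint (M j) - ContinuousLinearMap.adjoint (M j) * M i)
      (e (β + Pi.single j 1)) = (commutatorWeight w i j β : ℂ) • e (β + Pi.single i 1) := by
  rw [sub_apply, mul_apply_eq_comp, mul_apply_eq_comp,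
    adjoint_shift_apply_add e hM, hM, map_smul, map_smul, hM, add_right_comm,
    adjoint_shift_apply_add e hM, smul_smul, smul_smul, ← sub_smul, commutatorWeight]
  push_cast
  congr 1
  ring

theorem commutator_apply_zero (hM : ∀ i α, M i (e α) = (w i α : ℂ) • e (α + Pi.single i 1))
    (i j : σ) {α : σ → ℕ} (hα : α j = 0) :
    (M i * ContinuousLinearMap.adjoint (M j) - ContinuousLinearMap.adjoint (M j) * M i) (e α) =
      ((if i = j then -w i α ^ 2 else 0 : ℝ) : ℂ) • e α := by
  rw [sub_apply, mul_apply_eq_comp, mul_apply_eq_comp,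
    adjoint_shift_apply_zero e hM hα, map_zero, zero_sub, hM, map_smul]
  split_ifs with hij
  · subst hij
    rw [adjoint_shift_apply_add e hM, smul_smul, ← neg_smul]
    push_cast
    congr 1
    ring
  · rw [adjoint_shift_apply_zero e hM]
    · simp
    · simp [hα, Ne.symm hij]

/-- The adjoint of `[Mᵢ, Mⱼ*]` is `[Mⱼ, Mᵢ*]`, so the two shifts cancel and `T T*` is diagonal, with
squared commutator weights as eigenvalues at `β + εᵢ`. On the face `α i = 0` the operator `Mᵢ*`
vanishes, and only `i = j` leaves a nonzero term. -/
theorem isSchattenSummable_commutator_iff.{u} {σ H : Type u} [DecidableEq σ]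
    [NormedAddCommGroup H] [InnerProductSpace ℂ H] [CompleteSpace H]
    (e : HilbertBasis (σ → ℕ) ℂ H) {M : σ → H →L[ℂ] H} {w : σ → (σ → ℕ) → ℝ}
    (hM : ∀ i α, M i (e α) = (w i α : ℂ) • e (α + Pi.single i 1))
    (i j : σ) {p : ℝ} (hp : 0 < p) :
    IsSchattenSummable p
      (M i * ContinuousLinearMap.adjoint (M j) - ContinuousLinearMap.adjoint (M j) * M i) ↔
    Summable (fun β => |commutatorWeight w i j β| ^ p) ∧
      Summable (fun α => if α i = 0 ∧ i = j then |w i α ^ 2| ^ p else 0) := by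
  have hsymm : ∀ β, commutatorWeight w j i β = commutatorWeight w i j β := fun β => by
    unfold commutatorWeight; ring
  set s : (σ → ℕ) → ℝ := fun α => if α i = 0 then (if i = j then w i α ^ 2 else 0) ^ 2
    else commutatorWeight w i j (α - Pi.single i 1) ^ 2 with hs
  have hsadd : ∀ β, s (β + Pi.single i 1) = commutatorWeight w i j β ^ 2 := fun β => by
    simp [hs]
  have hpow : ∀ x : ℝ, (x ^ 2) ^ (p / 2) = |x| ^ p := fun x => by
    rw [← sq_abs, ← Real.rpow_natCast_mul (abs_nonneg x)]
    congr 1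
    push_cast
    ring
  have hp2 : p / 2 ≠ 0 := by positivity
  rw [isSchattenSummable_iff_summable e (s := s) _ hp, summable_iff_add_single i]
  · simp only [hsadd, hpow]
    refine and_congr_right fun _ => ?_
    refine summable_congr fun α => ?_
    by_cases hα : α i = 0
    · by_cases hij : i = j
      · subst hij
        simp only [hs, hα, if_true, and_true, hpow]
      · simp [hs, hα, hij, Real.zero_rpow hp2]
    · simp [hα]
  · intro α
    rw [adjoint_commutator, mul_apply_eq_comp]
    by_cases hα : α i = 0
    · rw [commutator_apply_zero e hM j i hα, map_smul]
      by_cases hij : i = j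
      · subst hij
        rw [commutator_apply_zero e hM i i hα, smul_smul]
        simp only [hs, hα, if_true]
        push_cast
        congr 1
        ring
      · simp [hs, hα, hij, Ne.symm hij]
    · obtain ⟨β, rfl⟩ := mem_range_add_single.2 hα
      dsimp only
      rw [commutator_apply_add e hM j i, map_smul, commutator_apply_add e hM i j, hsadd, hsymm,
        smul_smul]
      push_cast
      congr 1
      ring

end WeightedShift

/-! ### The monomial basis of the Bergman space -/

theorem monomialFun_add_single {σ : Type*} [Fintype σ] [DecidableEq σ] (α : σ → ℕ) (i : σ)
    (z : σ → ℂ) : monomialFun (α + Pi.single i 1) z = z i * monomialFun α z := by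
  simp only [monomialFun, Pi.add_apply, pow_add, Finset.prod_mul_distrib]
  rw [mul_comm]
  congr 1
  rw [Finset.prod_eq_single i] <;> simp +contextual

theorem monomialFun_mul {σ : Type*} [Fintype σ] (α : σ → ℕ) (u z : σ → ℂ) :
    monomialFun α (fun i => u i * z i) = monomialFun α u * monomialFun α z := by
  simp [monomialFun, mul_pow, Finset.prod_mul_distrib]

/-- Rotation by the angle `π / (b - a)` turns the relative phase of the two powers into a sign. -/
theorem exists_circle_conj_pow_mul_pow {a b : ℕ} (h : a ≠ b) :
    ∃ u : ℂ, ‖u‖ = 1 ∧ (starRingEnd ℂ) (u ^ a) * u ^ b = -1 := by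
  have hN : ((b : ℤ) - a : ℤ) ≠ 0 := sub_ne_zero.2 (by exact_mod_cast h.symm)
  set N : ℤ := (b : ℤ) - a with hNdef
  set u : ℂ := Complex.exp (((Real.pi / N : ℝ) : ℂ) * Complex.I) with hu
  have hn : ‖u‖ = 1 := Complex.norm_exp_ofReal_mul_I _
  have hu0 : u ≠ 0 := Complex.exp_ne_zero _
  have hc : (starRingEnd ℂ) u = u⁻¹ := by
    rw [Complex.inv_def, Complex.normSq_eq_norm_sq, hn]; simp
  refine ⟨u, hn, ?_⟩
  have h1 : (starRingEnd ℂ) (u ^ a) * u ^ b = u ^ N := by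
    rw [map_pow, hc, inv_pow, hNdef, zpow_sub₀ hu0, zpow_natCast, zpow_natCast]
    field_simp
  rw [h1, hu, ← Complex.exp_int_mul]
  have hNC : (N : ℂ) ≠ 0 := by exact_mod_cast hN
  have : (N : ℂ) * (((Real.pi / N : ℝ) : ℂ) * Complex.I) = Real.pi * Complex.I := by
    push_cast
    field_simp
  rw [this, Complex.exp_pi_mul_I]

/-- Rotating only a coordinate in which the exponents differ changes the sign of the integrand but
preserves the integral. -/
theorem IsCompleteReinhardt.setIntegral_conj_monomialFun_mul {σ : Type*} [Fintype σ]
    {D : Set (σ → ℂ)} (hD : IsCompleteReinhardt D) (hm : MeasurableSet D) {α β : σ → ℕ}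
    (h : α ≠ β) : ∫ z in D, (starRingEnd ℂ) (monomialFun α z) * monomialFun β z = 0 := by
  classical
  obtain ⟨i, hi⟩ := Function.ne_iff.1 h
  obtain ⟨u, hu, hup⟩ := exists_circle_conj_pow_mul_pow hi
  set v : σ → ℂ := Function.update 1 i u with hv
  have hv1 : ∀ j, ‖v j‖ = 1 := fun j => by
    by_cases hj : j = i
    · subst hj; simp [hv, hu]
    · simp [hv, hj]
  have hvm : ∀ γ : σ → ℕ, monomialFun γ v = u ^ γ i := fun γ => by
    rw [monomialFun, Finset.prod_eq_single i]
    · simp [hv]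
    · intro j _ hj; simp [hv, hj]
    · simp
  have h1 := hD.setIntegral_mul hm hv1
    fun z => (starRingEnd ℂ) (monomialFun α z) * monomialFun β z
  have h2 : ∀ z, (starRingEnd ℂ) (monomialFun α fun i => v i * z i) *
      (monomialFun β fun i => v i * z i) =
      -((starRingEnd ℂ) (monomialFun α z) * monomialFun β z) := fun z => by
    rw [monomialFun_mul, monomialFun_mul, hvm, hvm, map_mul, ← neg_one_mul, ← hup]
    ring
  simp_rw [h2, integral_neg] at h1
  exact self_eq_neg.1 h1.symm

/-- The squared norm of the monomial `z^α` in the Bergman space of `D`. -/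
noncomputable def monomialNormSq {σ : Type*} [Fintype σ] (D : Set (σ → ℂ)) (α : σ → ℕ) : ℝ :=
  ∫ z in D, ‖monomialFun α z‖ ^ 2

theorem memLp_monomialFun {σ : Type*} [Fintype σ] {D : TopologicalSpace.Opens (σ → ℂ)}
    (hb : Bornology.IsBounded (D : Set (σ → ℂ))) (α : σ → ℕ) :
    MemLp (monomialFun α) 2 (volume.restrict (D : Set (σ → ℂ))) :=
  (differentiable_monomialFun α).continuous.memLp_restrict_of_isBounded D.isOpen.measurableSet hb

section Bergman

variable {σ : Type*} [Fintype σ] {D : TopologicalSpace.Opens (σ → ℂ)}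
  (hb : Bornology.IsBounded (D : Set (σ → ℂ)))

/-- The monomial `z^α` as an element of the Bergman space. -/
noncomputable def bergmanMonomial (α : σ → ℕ) : bergmanSpace D :=
  ⟨(memLp_monomialFun hb α).toLp _, monomialFun α, (differentiable_monomialFun α).differentiableOn,
    (memLp_monomialFun hb α).coeFn_toLp⟩

theorem inner_bergmanMonomial_left (α : σ → ℕ) (f : bergmanSpace D) {g : (σ → ℂ) → ℂ}
    (hg : (f : Lp ℂ 2 (volume.restrict (D : Set (σ → ℂ)))) =ᵐ[volume.restrict (D : Set (σ → ℂ))] g) :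
    inner ℂ (bergmanMonomial hb α) f =
      ∫ z in D, (starRingEnd ℂ) (monomialFun α z) * g z := by
  rw [Submodule.coe_inner, L2.inner_def]
  refine integral_congr_ae ?_
  filter_upwards [(memLp_monomialFun hb α).coeFn_toLp, hg] with z h1 h2
  rw [h2, RCLike.inner_apply, mul_comm]
  change (starRingEnd ℂ) ((memLp_monomialFun hb α).toLp _ z) * g z = _
  rw [h1]

theorem inner_bergmanMonomial (hD : IsCompleteReinhardt (D : Set (σ → ℂ))) [DecidableEq σ]
    (α β : σ → ℕ) : inner ℂ (bergmanMonomial hb α) (bergmanMonomial hb β) =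
      if α = β then ((monomialNormSq (D : Set (σ → ℂ)) α : ℝ) : ℂ) else 0 := by
  rw [inner_bergmanMonomial_left hb α _ (memLp_monomialFun hb β).coeFn_toLp]
  split_ifs with h
  · subst h
    have : ∀ z, (starRingEnd ℂ) (monomialFun α z) * monomialFun α z =
        ((‖monomialFun α z‖ ^ 2 : ℝ) : ℂ) := fun z => by
      rw [Complex.conj_mul']; push_cast; rfl
    simp_rw [this]
    exact integral_ofReal
  · exact hD.setIntegral_conj_monomialFun_mul D.isOpen.measurableSet h

theorem coordinateMul_bergmanMonomial [DecidableEq σ] (i : σ) (α : σ → ℕ) :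
    coordinateMul D hb i (bergmanMonomial hb α) = bergmanMonomial hb (α + Pi.single i 1) := by
  apply Subtype.ext
  apply Lp.ext
  filter_upwards [coordinateMul_ae_eq D hb i (bergmanMonomial hb α),
    (memLp_monomialFun hb α).coeFn_toLp,
    (memLp_monomialFun hb (α + Pi.single i 1)).coeFn_toLp] with z h1 h2 h3
  rw [h1]
  change z i * (memLp_monomialFun hb α).toLp _ z = (memLp_monomialFun hb _).toLp _ z
  rw [h2, h3, monomialFun_add_single]

theorem commute_coordinateMul (i j : σ) : Commute (coordinateMul D hb i) (coordinateMul D hb j) := by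
  refine ContinuousLinearMap.ext fun f => Subtype.ext (Lp.ext ?_)
  filter_upwards [coordinateMul_ae_eq D hb i (coordinateMul D hb j f),
    coordinateMul_ae_eq D hb j (coordinateMul D hb i f), coordinateMul_ae_eq D hb i f,
    coordinateMul_ae_eq D hb j f] with z h1 h2 h3 h4
  refine h1.trans (Eq.trans ?_ h2.symm)
  rw [h3, h4]
  ring

theorem bergmanSpace_inner_smul_left (c : ℂ) (x y : bergmanSpace D) :
    inner ℂ (c • x) y = (starRingEnd ℂ) c * inner ℂ x y := inner_smul_left x y c

theorem bergmanSpace_inner_smul_right (c : ℂ) (x y : bergmanSpace D) :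
    inner ℂ x (c • y) = c * inner ℂ x y := inner_smul_right x y c

/-- The normalized monomials form a Hilbert basis of the Bergman space of a bounded complete
Reinhardt domain. -/
theorem exists_hilbertBasis_bergmanMonomial [DecidableEq σ]
    (hD : IsCompleteReinhardt (D : Set (σ → ℂ)))
    (hpos : ∀ α, 0 < monomialNormSq (D : Set (σ → ℂ)) α) :
    ∃ e : HilbertBasis (σ → ℕ) ℂ (bergmanSpace D), ∀ α,
      e α = (((√(monomialNormSq (D : Set (σ → ℂ)) α))⁻¹ : ℝ) : ℂ) • bergmanMonomial hb α := by
  set v : (σ → ℕ) → bergmanSpace D := fun α =>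
    (((√(monomialNormSq (D : Set (σ → ℂ)) α))⁻¹ : ℝ) : ℂ) • bergmanMonomial hb α with hv
  have hs : ∀ α, √(monomialNormSq (D : Set (σ → ℂ)) α) ≠ 0 := fun α =>
    (Real.sqrt_pos.2 (hpos α)).ne'
  have horth : Orthonormal ℂ v := by
    rw [orthonormal_iff_ite]
    intro α β
    simp only [hv, bergmanSpace_inner_smul_left, bergmanSpace_inner_smul_right,
      inner_bergmanMonomial hb hD, Complex.conj_ofReal]
    split_ifs with h
    · subst h
      norm_cast
      field_simp [hs α]
      rw [Real.sq_sqrt (hpos α).le]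
    · simp
  refine ⟨HilbertBasis.mkOfOrthogonalEqBot horth ?_, fun α => by
    rw [HilbertBasis.coe_mkOfOrthogonalEqBot]⟩
  rw [Submodule.eq_bot_iff]
  intro f hf
  obtain ⟨g, hg, hfg⟩ := f.2
  have h1 : ∀ α, ∫ z in D, (starRingEnd ℂ) (monomialFun α z) * g z = 0 := by
    intro α
    rw [← inner_bergmanMonomial_left hb α f hfg]
    have := hf (v α) (Submodule.subset_span ⟨α, rfl⟩)
    rw [bergmanSpace_inner_smul_left] at this
    exact (mul_eq_zero.1 this).resolve_left (by simpa using hs α)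
  have hg2 : MemLp g 2 (volume.restrict (D : Set (σ → ℂ))) := (memLp_congr_ae hfg).1 (Lp.memLp _)
  have := ae_eq_zero_of_forall_setIntegral_monomialFun D.isOpen hD hb hg hg2 h1
  apply Subtype.ext
  exact (Lp.eq_zero_iff_ae_eq_zero).2 (hfg.trans this)

theorem exists_hilbertBasis_coordinateMul [DecidableEq σ]
    (hD : IsCompleteReinhardt (D : Set (σ → ℂ)))
    (hpos : ∀ α, 0 < monomialNormSq (D : Set (σ → ℂ)) α) :
    ∃ e : HilbertBasis (σ → ℕ) ℂ (bergmanSpace D), ∀ i α, coordinateMul D hb i (e α) =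
      ((√(monomialNormSq (D : Set (σ → ℂ)) (α + Pi.single i 1) /
        monomialNormSq (D : Set (σ → ℂ)) α) : ℝ) : ℂ) • e (α + Pi.single i 1) := by
  obtain ⟨e, he⟩ := exists_hilbertBasis_bergmanMonomial hb hD hpos
  refine ⟨e, fun i α => ?_⟩
  rw [he, he, map_smul, coordinateMul_bergmanMonomial, smul_smul, Real.sqrt_div (hpos _).le]
  congr 1
  have := (Real.sqrt_pos.2 (hpos (α + Pi.single i 1))).ne'
  norm_cast
  field_simp

/-- Essential normality of the Bergman module in terms of the weights of the shifts. -/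
theorem isEssentiallyNormalBergmanModule_iff {σ : Type} [Fintype σ] [DecidableEq σ]
    {D : TopologicalSpace.Opens (σ → ℂ)} (hb : Bornology.IsBounded (D : Set (σ → ℂ)))
    (hD : IsCompleteReinhardt (D : Set (σ → ℂ)))
    (hpos : ∀ α, 0 < monomialNormSq (D : Set (σ → ℂ)) α) {w : σ → (σ → ℕ) → ℝ}
    (hw : ∀ i α, w i α = √(monomialNormSq (D : Set (σ → ℂ)) (α + Pi.single i 1) /
        monomialNormSq (D : Set (σ → ℂ)) α)) {p : ℝ} (hp : 0 < p) :
    IsEssentiallyNormalBergmanModule p D hb ↔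
      ∀ i j, Summable (fun β => |commutatorWeight w i j β| ^ p) ∧
        Summable (fun α => if α i = 0 ∧ i = j then |w i α ^ 2| ^ p else 0) := by
  obtain ⟨e, he⟩ := exists_hilbertBasis_coordinateMul hb hD hpos
  simp only [← hw] at he
  rw [IsEssentiallyNormalBergmanModule, IsEssentiallyNormalTuple,
    and_iff_right (commute_coordinateMul hb)]
  exact forall_congr' fun i => forall_congr' fun j => isSchattenSummable_commutator_iff e he i j hp

end Bergman

/-! ### Norms of monomials on egg domains through Gamma integrals -/

/-- Layer cake: write `exp (-Ψ)` as the integral of `exp (-u)` over `u > Ψ` and exchange integrals;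
the power growth of the sublevel sets then produces a Gamma integral. -/
theorem lintegral_exp_neg_of_measure_lt {X : Type*} [MeasurableSpace X] {μ : Measure X} [SFinite μ]
    {Ψ : X → ℝ} (hΨ : Measurable Ψ) (h0 : ∀ x, 0 ≤ Ψ x) {G : ℝ} (hG : 0 ≤ G) {v : ℝ≥0∞}
    (hv : ∀ t > 0, μ {x | Ψ x < t} = ENNReal.ofReal (t ^ G) * v) :
    ∫⁻ x, ENNReal.ofReal (Real.exp (-Ψ x)) ∂μ = ENNReal.ofReal (Real.Gamma (1 + G)) * v := by
  have h1 : ∀ y : ℝ, ENNReal.ofReal (Real.exp (-y)) =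
      ∫⁻ u, (Set.Ioi y).indicator (fun u => ENNReal.ofReal (Real.exp (-u))) u := by
    intro y
    rw [lintegral_indicator measurableSet_Ioi, ← integral_exp_neg_Ioi,
      ofReal_integral_eq_lintegral_ofReal (integrableOn_exp_neg_Ioi y)
        (Eventually.of_forall fun _ => (Real.exp_pos _).le)]
  have hmeas : Measurable (Function.uncurry fun (x : X) (u : ℝ) =>
      (Set.Ioi (Ψ x)).indicator (fun u => ENNReal.ofReal (Real.exp (-u))) u) := by
    have h2 : MeasurableSet {q : X × ℝ | Ψ q.1 < q.2} :=
      measurableSet_lt (hΨ.comp measurable_fst) measurable_snd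
    have h3 : Measurable fun q : X × ℝ => ENNReal.ofReal (Real.exp (-q.2)) := by fun_prop
    exact h3.indicator h2
  simp_rw [fun x => h1 (Ψ x)]
  rw [lintegral_lintegral_swap hmeas.aemeasurable]
  have h4 : ∀ u : ℝ, ∫⁻ x, (Set.Ioi (Ψ x)).indicator
      (fun u => ENNReal.ofReal (Real.exp (-u))) u ∂μ =
      (Set.Ioi 0).indicator (fun u => ENNReal.ofReal (Real.exp (-u) * u ^ ((1 + G) - 1)) * v) u := by
    intro u
    have h5 : ∀ x, (Set.Ioi (Ψ x)).indicator (fun u => ENNReal.ofReal (Real.exp (-u))) u =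
        {x | Ψ x < u}.indicator (fun _ => ENNReal.ofReal (Real.exp (-u))) x := fun x => by
      simp [Set.indicator]
    simp_rw [h5]
    rw [lintegral_indicator (measurableSet_lt hΨ measurable_const), setLIntegral_const]
    by_cases hu : 0 < u
    · rw [hv u hu, Set.indicator_of_mem (Set.mem_Ioi.2 hu),
        ENNReal.ofReal_mul (Real.exp_pos _).le, mul_assoc]
      congr 3
      ring_nf
    · rw [Set.indicator_of_notMem (by simpa using hu)]
      have : {x | Ψ x < u} = ∅ := by
        ext x
        simp only [Set.mem_ofPred_eq, Set.mem_empty_iff_false, iff_false, not_lt]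
        exact (not_lt.1 hu).trans (h0 x)
      simp [this]
  simp_rw [h4]
  rw [lintegral_indicator measurableSet_Ioi, lintegral_mul_const _ (by fun_prop),
    Real.Gamma_eq_integral (by linarith), ofReal_integral_eq_lintegral_ofReal
    (Real.GammaIntegral_convergent (by linarith))]
  filter_upwards [ae_restrict_mem measurableSet_Ioi] with u hu
  have : (0 : ℝ) < u := hu
  positivity

/-- A real dilation by `s i` of a complex coordinate has Jacobian `s i ^ 2`. -/
theorem lintegral_pi_mul_eq {ι : Type*} [Fintype ι] {s : ι → ℝ} (hs : ∀ i, 0 < s i)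
    (f : (ι → ℂ) → ℝ≥0∞) :
    ∫⁻ z, f z = ENNReal.ofReal (∏ i, s i ^ 2) * ∫⁻ z : ι → ℂ, f fun i => (s i : ℂ) * z i := by
  set T : (ι → ℂ) ≃ᵐ (ι → ℂ) := (Homeomorph.piCongrRight fun i =>
    Homeomorph.mulLeft₀ (s i : ℂ) (by exact_mod_cast (hs i).ne')).toMeasurableEquiv with hT
  have hTapp : ∀ z, T z = fun i => (s i : ℂ) * z i := fun z => rfl
  have hvol : (volume : Measure (ι → ℂ)) = ENNReal.ofReal (∏ i, s i ^ 2) •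
      Measure.map T volume := by
    rw [volume_pi]
    refine Measure.pi_eq fun B hB => ?_
    rw [Measure.smul_apply, T.map_apply, smul_eq_mul]
    have hpre : T ⁻¹' (Set.univ.pi B) = Set.univ.pi fun i => (fun w : ℂ => s i • w) ⁻¹' B i := by
      ext z
      simp [hTapp, Set.mem_pi]
    rw [hpre, Measure.pi_pi, ENNReal.ofReal_prod_of_nonneg fun i _ => by positivity,
      ← Finset.prod_mul_distrib]
    refine Finset.prod_congr rfl fun i _ => ?_
    rw [Measure.addHaar_preimage_smul _ (hs i).ne', ← mul_assoc, ← ENNReal.ofReal_mul (by positivity),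
      Complex.finrank_real_complex, abs_of_pos (inv_pos.2 (pow_pos (hs i) 2)),
      mul_inv_cancel₀ (pow_pos (hs i) 2).ne', ENNReal.ofReal_one, one_mul]
  conv_lhs => rw [hvol]
  rw [lintegral_smul_measure, T.measurableEmbedding.lintegral_map]
  rfl

/-- Integration of `|z^α|² exp (-Φ^a)` for a weighted homogeneous `Φ`. -/
theorem integral_norm_monomialFun_sq_mul_exp {ι : Type*} [Fintype ι] (α : ι → ℕ) {c : ι → ℝ}
    (hc : ∀ i, 0 ≤ c i) {Φ : (ι → ℂ) → ℝ} (hΦ : Measurable Φ) (h0 : ∀ z, 0 ≤ Φ z)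
    (hhom : ∀ t : ℝ, 0 < t → ∀ z, Φ (fun i => ((t ^ c i : ℝ) : ℂ) * z i) = t * Φ z)
    {a : ℝ} (ha : 0 < a) :
    ∫ z, ‖monomialFun α z‖ ^ 2 * Real.exp (-Φ z ^ a) =
      Real.Gamma (1 + (∑ i, 2 * c i * (α i + 1)) / a) *
        ∫ z in {z | Φ z < 1}, ‖monomialFun α z‖ ^ 2 := by
  set G := ∑ i, 2 * c i * (α i + 1) with hG
  have hG0 : 0 ≤ G := Finset.sum_nonneg fun i _ => by have := hc i; positivity
  have hmc : Continuous fun z : ι → ℂ => ‖monomialFun α z‖ ^ 2 :=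
    ((differentiable_monomialFun α).continuous.norm).pow 2
  set μ : Measure (ι → ℂ) := volume.withDensity fun z => ENNReal.ofReal (‖monomialFun α z‖ ^ 2)
    with hμ
  have hdm : Measurable fun z : ι → ℂ => ENNReal.ofReal (‖monomialFun α z‖ ^ 2) :=
    hmc.measurable.ennreal_ofReal
  have hset : ∀ t, MeasurableSet {z | Φ z < t} := fun t => measurableSet_lt hΦ measurable_const
  -- The dilation by `t ^ c i` scales volume by `t ^ ∑ 2 cᵢ` and the density by `t ^ ∑ 2 cᵢ αᵢ`;
  -- together this is `t ^ G`.
  have hscale : ∀ t > 0, μ {z | Φ z < t} = ENNReal.ofReal (t ^ G) * μ {z | Φ z < 1} := by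
    intro t ht
    rw [hμ, withDensity_apply _ (hset t), withDensity_apply _ (hset 1),
      ← lintegral_indicator (hset t), ← lintegral_indicator (hset 1),
      lintegral_pi_mul_eq (s := fun i => t ^ c i) (fun i => Real.rpow_pos_of_pos ht _)]
    have h1 : ∀ z, {z | Φ z < t}.indicator (fun z => ENNReal.ofReal (‖monomialFun α z‖ ^ 2))
        (fun i => ((t ^ c i : ℝ) : ℂ) * z i) =
        ENNReal.ofReal (∏ i, (t ^ c i) ^ (2 * α i)) * {z | Φ z < 1}.indicator
          (fun z => ENNReal.ofReal (‖monomialFun α z‖ ^ 2)) z := by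
      intro z
      have hiff : Φ (fun i => ((t ^ c i : ℝ) : ℂ) * z i) < t ↔ Φ z < 1 := by
        rw [hhom t ht]
        exact mul_lt_iff_lt_one_right ht
      by_cases hz : Φ z < 1
      · rw [Set.indicator_of_mem (by exact hiff.2 hz), Set.indicator_of_mem (by exact hz),
          ← ENNReal.ofReal_mul (by positivity), monomialFun_mul, norm_mul, mul_pow]
        congr 2
        rw [monomialFun, norm_prod, ← Finset.prod_pow]
        refine Finset.prod_congr rfl fun i _ => ?_
        rw [norm_pow, Complex.norm_of_nonneg (by positivity), ← pow_mul, mul_comm 2]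
      · rw [Set.indicator_of_notMem (by exact fun h => hz (hiff.1 h)),
          Set.indicator_of_notMem (by exact hz), mul_zero]
    simp_rw [h1]
    rw [lintegral_const_mul _ (hdm.indicator (hset 1)), ← mul_assoc,
      ← ENNReal.ofReal_mul (by positivity), ← Finset.prod_mul_distrib]
    congr 2
    rw [hG, Real.rpow_sum_of_pos ht]
    refine Finset.prod_congr rfl fun i _ => ?_
    rw [← pow_add, ← Real.rpow_mul_natCast ht.le]
    congr 1
    push_cast
    ring
  -- Sublevel sets of `Φ ^ a` are those of `Φ` at level `t ^ (1/a)`, hence the exponent `G / a`.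
  have hlay := lintegral_exp_neg_of_measure_lt (μ := μ) (Ψ := fun z => Φ z ^ a)
    (hΦ.pow_const a) (fun z => Real.rpow_nonneg (h0 z) a) (div_nonneg hG0 ha.le)
    (v := μ {z | Φ z < 1}) (by
      intro t ht
      have : {z | Φ z ^ a < t} = {z | Φ z < t ^ a⁻¹} := by
        ext z
        simp only [Set.mem_ofPred_eq]
        rw [Real.lt_rpow_inv_iff_of_pos (h0 z) ht.le ha]
      rw [this, hscale _ (Real.rpow_pos_of_pos ht _), ← Real.rpow_mul ht.le,
        div_eq_inv_mul])
  have hme : Measurable fun z => ‖monomialFun α z‖ ^ 2 * Real.exp (-Φ z ^ a) :=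
    hmc.measurable.mul (hΦ.pow_const a).neg.exp
  rw [integral_eq_lintegral_of_nonneg_ae (Eventually.of_forall fun z => by positivity)
    hme.aestronglyMeasurable,
    integral_eq_lintegral_of_nonneg_ae (Eventually.of_forall fun z => by positivity)
    hmc.aestronglyMeasurable, ← withDensity_apply _ (hset 1), ← hμ,
    ← ENNReal.toReal_ofReal (Real.Gamma_pos_of_pos (s := 1 + G / a) (by positivity)).le,
    ← ENNReal.toReal_mul, ← hlay, hμ, lintegral_withDensity_eq_lintegral_mul _ hdm
    (by fun_prop)]
  congr 1
  refine lintegral_congr fun z => ?_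
  rw [Pi.mul_apply, ENNReal.ofReal_mul (by positivity)]

theorem Complex.integral_norm_pow_mul_exp_neg_rpow (m : ℕ) {r : ℝ} (hr : 0 < r) :
    ∫ x : ℂ, ‖x ^ m‖ ^ 2 * Real.exp (-‖x‖ ^ (2 * r)) =
      Real.pi / r * Real.Gamma ((m + 1) / r) := by
  calc ∫ x : ℂ, ‖x ^ m‖ ^ 2 * Real.exp (-‖x‖ ^ (2 * r))
      = ∫ x in Set.Ioi (0 : ℝ) ×ˢ Set.Ioo (-Real.pi) Real.pi,
          x.1 * (|x.1| ^ (2 * m) * Real.exp (-|x.1| ^ (2 * r))) := by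
        rw [← Complex.integral_comp_polarCoord_symm, polarCoord_target]
        simp_rw [norm_pow, Complex.norm_polarCoord_symm, smul_eq_mul, ← pow_mul, mul_comm m 2]
    _ = (∫ x in Set.Ioi (0 : ℝ), x * |x| ^ (2 * m) * Real.exp (-|x| ^ (2 * r))) *
          ∫ _ in Set.Ioo (-Real.pi) Real.pi, 1 := by
        rw [← setIntegral_prod_mul, Measure.volume_eq_prod]
        simp_rw [mul_one]
        congr! 2; ring
    _ = 2 * Real.pi * ∫ x in Set.Ioi (0 : ℝ), x * |x| ^ (2 * m) * Real.exp (-|x| ^ (2 * r)) := by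
        simp_rw [integral_const, measureReal_restrict_apply MeasurableSet.univ, Set.univ_inter,
          Real.volume_real_Ioo_of_le (a := -Real.pi) (b := Real.pi)
            (by linarith [Real.pi_nonneg]),
          sub_neg_eq_add, ← two_mul, smul_eq_mul, mul_one, mul_comm]
    _ = 2 * Real.pi * ∫ x in Set.Ioi (0 : ℝ),
          x ^ ((2 * m + 1 : ℕ) : ℝ) * Real.exp (-x ^ (2 * r)) := by
        congr 1
        refine setIntegral_congr_fun measurableSet_Ioi fun x hx => ?_
        have : (0 : ℝ) < x := hx
        simp only [abs_of_pos this, Real.rpow_natCast]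
        ring
    _ = Real.pi / r * Real.Gamma ((m + 1) / r) := by
        rw [_root_.integral_rpow_mul_exp_neg_rpow (by positivity) (lt_of_lt_of_le (by norm_num) (Nat.cast_nonneg _))]
        have : (((2 * m + 1 : ℕ) : ℝ) + 1) / (2 * r) = (m + 1) / r := by
          push_cast
          field_simp
          ring
        rw [this]
        field_simp

theorem measurePreserving_sigmaCurry {K : Type*} [Fintype K] {n : K → Type*} [∀ k, Fintype (n k)] :
    MeasurePreserving (MeasurableEquiv.piCurry fun (k : K) (_ : n k) => ℂ) := by
  have h : MeasurePreserving (MeasurableEquiv.piCurry fun (k : K) (_ : n k) => ℂ).symm := by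
    refine ⟨MeasurableEquiv.measurable _, ?_⟩
    rw [eq_comm, volume_pi]
    refine Measure.pi_eq fun B hB => ?_
    rw [MeasurableEquiv.map_apply]
    have : (MeasurableEquiv.piCurry fun (k : K) (_ : n k) => ℂ).symm ⁻¹' (Set.univ.pi B) =
        Set.univ.pi fun k => Set.univ.pi fun j => B ⟨k, j⟩ := by
      ext z
      simp [MeasurableEquiv.coe_piCurry_symm, Set.mem_pi, Sigma.uncurry, Sigma.forall]
    rw [this, volume_pi_pi]
    simp_rw [volume_pi_pi]
    rw [Fintype.prod_sigma]
  exact h.symm _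

theorem integral_sigma_prod_eq_prod {K : Type*} [Fintype K] {n : K → Type*} [∀ k, Fintype (n k)]
    (f : (k : K) → (n k → ℂ) → ℝ) :
    ∫ z : (Σ k, n k) → ℂ, ∏ k, f k (fun j => z ⟨k, j⟩) = ∏ k, ∫ z, f k z := by
  rw [← integral_fintype_prod_volume_eq_prod]
  exact measurePreserving_sigmaCurry.integral_comp' (fun z => ∏ k, f k (z k))

/-- The integrals for the exponents `a` and `1` are Gamma multiples of the same integral over the
sublevel set. For exponent `1` the integrand factors over the coordinates, so the ratio of the Gamma
values gives the general case. -/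
theorem integral_norm_monomialFun_sq_mul_exp_sum {ι : Type*} [Fintype ι] (α : ι → ℕ) {r : ι → ℝ}
    (hr : ∀ i, 0 < r i) {a : ℝ} (ha : 0 < a) :
    ∫ z : ι → ℂ, ‖monomialFun α z‖ ^ 2 * Real.exp (-(∑ i, ‖z i‖ ^ (2 * r i)) ^ a) =
      Real.Gamma (1 + (∑ i, (α i + 1) / r i) / a) / Real.Gamma (1 + ∑ i, (α i + 1) / r i) *
        ∏ i, (Real.pi / r i * Real.Gamma ((α i + 1) / r i)) := by
  have hm : Measurable fun z : ι → ℂ => ∑ i, ‖z i‖ ^ (2 * r i) := by fun_prop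
  have h0 : ∀ z : ι → ℂ, 0 ≤ ∑ i, ‖z i‖ ^ (2 * r i) := fun z =>
    Finset.sum_nonneg fun i _ => by positivity
  have hhom : ∀ t : ℝ, 0 < t → ∀ z : ι → ℂ,
      ∑ i, ‖((t ^ (1 / (2 * r i)) : ℝ) : ℂ) * z i‖ ^ (2 * r i) = t * ∑ i, ‖z i‖ ^ (2 * r i) := by
    intro t ht z
    rw [Finset.mul_sum]
    refine Finset.sum_congr rfl fun i _ => ?_
    have := hr i
    rw [norm_mul, Complex.norm_of_nonneg (by positivity),
      Real.mul_rpow (by positivity) (by positivity), ← Real.rpow_mul ht.le,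
      one_div_mul_cancel (by positivity), Real.rpow_one]
  have hc : ∀ i, 0 ≤ 1 / (2 * r i) := fun i => by have := hr i; positivity
  have hG : ∑ i, 2 * (1 / (2 * r i)) * ((α i : ℝ) + 1) = ∑ i, ((α i : ℝ) + 1) / r i := by
    refine Finset.sum_congr rfl fun i _ => ?_
    have := hr i
    field_simp
  have h1 := integral_norm_monomialFun_sq_mul_exp α hc hm h0 hhom one_pos
  have h2 := integral_norm_monomialFun_sq_mul_exp α hc hm h0 hhom ha
  rw [hG] at h1 h2
  have h3 : ∫ z : ι → ℂ, ‖monomialFun α z‖ ^ 2 *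
      Real.exp (-(∑ i, ‖z i‖ ^ (2 * r i)) ^ (1 : ℝ)) =
      ∏ i, (Real.pi / r i * Real.Gamma ((α i + 1) / r i)) := by
    simp_rw [← fun i => Complex.integral_norm_pow_mul_exp_neg_rpow (α i) (hr i)]
    rw [← integral_fintype_prod_volume_eq_prod]
    refine integral_congr_ae (Eventually.of_forall fun z => ?_)
    simp only [Real.rpow_one, Finset.prod_mul_distrib, ← Real.exp_sum, Finset.sum_neg_distrib,
      monomialFun, norm_prod, Finset.prod_pow]
  have hpos : 0 < Real.Gamma (1 + ∑ i, ((α i : ℝ) + 1) / r i) := Real.Gamma_pos_of_pos (by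
    have : 0 ≤ ∑ i, ((α i : ℝ) + 1) / r i := Finset.sum_nonneg fun i _ => by
      have := hr i; positivity
    linarith)
  rw [h2, ← h3, h1, div_one]
  field_simp

section Egg

variable {K : ℕ} {n : Fin K → ℕ} {a : Fin K → ℝ} {r : (k : Fin K) → Fin (n k) → ℝ}

theorem isCompleteReinhardt_eggDomain (ha : ∀ k, 0 < a k) (hr : ∀ k j, 0 < r k j) :
    IsCompleteReinhardt (eggDomain n a r ha hr : Set ((Σ k : Fin K, Fin (n k)) → ℂ)) := by
  intro z hz w hw
  refine lt_of_le_of_lt ?_ (show ∑ k, (∑ j, ‖z ⟨k, j⟩‖ ^ (2 * r k j)) ^ a k < 1 from hz)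
  refine Finset.sum_le_sum fun k _ => ?_
  refine Real.rpow_le_rpow (Finset.sum_nonneg fun j _ => by positivity) ?_ (ha k).le
  refine Finset.sum_le_sum fun j _ => ?_
  exact Real.rpow_le_rpow (norm_nonneg _) (hw _) (by linarith [hr k j])

/-- The defining function `Φ` of the domain is weighted homogeneous and `exp (-Φ)` factors over the
blocks. The integral of `‖z^α‖² exp (-Φ)` over the whole space therefore determines the one over `Φ
< 1`. -/
theorem monomialNormSq_eggDomain (ha : ∀ k, 0 < a k) (hr : ∀ k j, 0 < r k j)
    (α : (Σ k : Fin K, Fin (n k)) → ℕ) :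
    monomialNormSq (eggDomain n a r ha hr : Set ((Σ k : Fin K, Fin (n k)) → ℂ)) α =
      (∏ k, (Real.Gamma (1 + (∑ j, (α ⟨k, j⟩ + 1) / r k j) / a k) /
        Real.Gamma (1 + ∑ j, (α ⟨k, j⟩ + 1) / r k j) *
        ∏ j, (Real.pi / r k j * Real.Gamma ((α ⟨k, j⟩ + 1) / r k j)))) /
        Real.Gamma (1 + ∑ k, (∑ j, (α ⟨k, j⟩ + 1) / r k j) / a k) := by
  set Φ : ((Σ k : Fin K, Fin (n k)) → ℂ) → ℝ := fun z =>
    ∑ k, (∑ j, ‖z ⟨k, j⟩‖ ^ (2 * r k j)) ^ a k with hΦ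
  have hm : Measurable Φ := by fun_prop
  have h0 : ∀ z, 0 ≤ Φ z := fun z => Finset.sum_nonneg fun k _ =>
    Real.rpow_nonneg (Finset.sum_nonneg fun i _ => by positivity) _
  have hhom : ∀ t : ℝ, 0 < t → ∀ z, Φ (fun i =>
      ((t ^ (1 / (2 * r i.1 i.2 * a i.1)) : ℝ) : ℂ) * z i) = t * Φ z := by
    intro t ht z
    simp only [hΦ]
    rw [Finset.mul_sum]
    refine Finset.sum_congr rfl fun k _ => ?_
    have hak := ha k
    have : ∀ j, ‖((t ^ (1 / (2 * r k j * a k)) : ℝ) : ℂ) * z ⟨k, j⟩‖ ^ (2 * r k j) =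
        t ^ (a k)⁻¹ * ‖z ⟨k, j⟩‖ ^ (2 * r k j) := by
      intro j
      have := hr k j
      rw [norm_mul, Complex.norm_of_nonneg (by positivity),
        Real.mul_rpow (by positivity) (by positivity), ← Real.rpow_mul ht.le]
      congr 2
      field_simp
    simp_rw [this]
    rw [← Finset.mul_sum, Real.mul_rpow (by positivity)
      (Finset.sum_nonneg fun i _ => by positivity), ← Real.rpow_mul ht.le,
      inv_mul_cancel₀ hak.ne', Real.rpow_one]
  have hc : ∀ i : Σ k : Fin K, Fin (n k), 0 ≤ 1 / (2 * r i.1 i.2 * a i.1) := fun i => by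
    have := hr i.1 i.2; have := ha i.1; positivity
  have h1 := integral_norm_monomialFun_sq_mul_exp α hc hm h0 hhom one_pos
  have hS : ∑ i : Σ k : Fin K, Fin (n k), 2 * (1 / (2 * r i.1 i.2 * a i.1)) * ((α i : ℝ) + 1) =
      ∑ k, (∑ j, ((α ⟨k, j⟩ : ℝ) + 1) / r k j) / a k := by
    rw [Fintype.sum_sigma]
    refine Finset.sum_congr rfl fun k _ => ?_
    rw [Finset.sum_div]
    refine Finset.sum_congr rfl fun j _ => ?_
    have := hr k j; have := ha k
    field_simp
  rw [hS, div_one] at h1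
  have h2 : ∫ z, ‖monomialFun α z‖ ^ 2 * Real.exp (-Φ z ^ (1 : ℝ)) =
      ∏ k, (Real.Gamma (1 + (∑ j, (α ⟨k, j⟩ + 1) / r k j) / a k) /
        Real.Gamma (1 + ∑ j, (α ⟨k, j⟩ + 1) / r k j) *
        ∏ j, (Real.pi / r k j * Real.Gamma ((α ⟨k, j⟩ + 1) / r k j))) := by
    simp_rw [← fun k => integral_norm_monomialFun_sq_mul_exp_sum (fun j => α ⟨k, j⟩) (hr k) (ha k)]
    rw [← integral_sigma_prod_eq_prod]
    refine integral_congr_ae (Eventually.of_forall fun z => ?_)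
    simp only [Real.rpow_one, Finset.prod_mul_distrib, ← Real.exp_sum, Finset.sum_neg_distrib,
      monomialFun, norm_prod, Finset.prod_pow, Fintype.prod_sigma, hΦ]
  have hpos : 0 < Real.Gamma (1 + ∑ k, (∑ j, ((α ⟨k, j⟩ : ℝ) + 1) / r k j) / a k) :=
    Real.Gamma_pos_of_pos (by
      have : 0 ≤ ∑ k, (∑ j, ((α ⟨k, j⟩ : ℝ) + 1) / r k j) / a k := Finset.sum_nonneg fun k _ =>
        div_nonneg (Finset.sum_nonneg fun j _ => by have := hr k j; positivity) (ha k).le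
      linarith)
  rw [← h2, h1, mul_div_cancel_left₀ _ hpos.ne']
  rfl

end Egg

/-! ### Asymptotics of Gamma quotients and second differences of log Γ -/

/-- Log-convexity of `Γ` between `x` and `x + 1`, together with `Γ(x + 1) = x Γ(x)`. -/
theorem Real.Gamma_add_le_of_lt_one {x s : ℝ} (hx : 0 < x) (hs : 0 < s) (hs1 : s < 1) :
    Real.Gamma (x + s) ≤ Real.Gamma x * x ^ s := by
  have h := Real.Gamma_mul_add_mul_le_rpow_Gamma_mul_rpow_Gamma hx (by linarith : 0 < x + 1)
    (by linarith : 0 < 1 - s) hs (by ring)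
  have hG := Real.Gamma_pos_of_pos hx
  rw [show (1 - s) * x + s * (x + 1) = x + s by ring, Real.Gamma_add_one hx.ne',
    Real.mul_rpow hx.le hG.le, mul_left_comm, ← Real.rpow_add hG] at h
  simpa [mul_comm] using h

/-- The preceding upper bound, started at `x + s` with increment `1 - s`, read backwards. -/
theorem Real.le_Gamma_add_of_lt_one {x s : ℝ} (hx : 0 < x) (hs : 0 < s) (hs1 : s < 1) :
    Real.Gamma x * x ≤ Real.Gamma (x + s) * (x + s) ^ (1 - s) := by
  have h := Real.Gamma_add_le_of_lt_one (x := x + s) (s := 1 - s) (by linarith) (by linarith)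
    (by linarith)
  rwa [show x + s + (1 - s) = x + 1 by ring, Real.Gamma_add_one hx.ne', mul_comm x] at h

/-- Two-sided comparison `Γ(x + δ) / Γ(x) ≍ x ^ δ`, uniformly for `x` bounded below. -/
theorem Real.exists_Gamma_add_div_bounds {δ x₀ : ℝ} (hδ : 0 ≤ δ) (hx₀ : 0 < x₀) :
    ∃ c > 0, ∃ C > 0, ∀ x, x₀ ≤ x →
      c * x ^ δ ≤ Real.Gamma (x + δ) / Real.Gamma x ∧
        Real.Gamma (x + δ) / Real.Gamma x ≤ C * x ^ δ := by
  have hfrac : ∀ s : ℝ, 0 ≤ s → s < 1 → ∃ c > 0, ∃ C > 0, ∀ x, x₀ ≤ x →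
      c * x ^ s ≤ Real.Gamma (x + s) / Real.Gamma x ∧
        Real.Gamma (x + s) / Real.Gamma x ≤ C * x ^ s := by
    intro s hs0 hs1
    rcases hs0.eq_or_lt with rfl | hs
    · refine ⟨1, one_pos, 1, one_pos, fun x hx => ?_⟩
      have := (Real.Gamma_pos_of_pos (hx₀.trans_le hx)).ne'
      simp [this]
    · refine ⟨(1 + 1 / x₀)⁻¹, by positivity, 1, one_pos, fun x hx => ?_⟩
      have hx0 : 0 < x := hx₀.trans_le hx
      have hG := Real.Gamma_pos_of_pos hx0
      rw [le_div_iff₀ hG, div_le_iff₀ hG, one_mul]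
      refine ⟨?_, by rw [mul_comm]; exact Real.Gamma_add_le_of_lt_one hx0 hs hs1⟩
      have h1 := Real.le_Gamma_add_of_lt_one hx0 hs hs1
      have hGs := Real.Gamma_pos_of_pos (by linarith : 0 < x + s)
      have h2 : (x + s) ^ (1 - s) ≤ (1 + 1 / x₀) * x ^ (1 - s) := by
        have h3 : x + s ≤ (1 + 1 / x₀) * x := by
          have : 1 ≤ 1 / x₀ * x := by rw [one_div_mul_eq_div, le_div_iff₀ hx₀]; linarith
          linarith
        calc (x + s) ^ (1 - s) ≤ ((1 + 1 / x₀) * x) ^ (1 - s) :=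
              Real.rpow_le_rpow (by linarith) h3 (by linarith)
          _ = (1 + 1 / x₀) ^ (1 - s) * x ^ (1 - s) := Real.mul_rpow (by positivity) hx0.le
          _ ≤ (1 + 1 / x₀) * x ^ (1 - s) := by
              gcongr
              have : (1 : ℝ) ≤ 1 + 1 / x₀ := by have : 0 < 1 / x₀ := by positivity
                                                linarith
              calc (1 + 1 / x₀) ^ (1 - s) ≤ (1 + 1 / x₀) ^ (1 : ℝ) :=
                    Real.rpow_le_rpow_of_exponent_le this (by linarith)
                _ = _ := Real.rpow_one _
      have h4 : x ^ s * x ^ (1 - s) = x := by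
        rw [← Real.rpow_add hx0]; simp
      have h5 : 0 < x ^ (1 - s) := Real.rpow_pos_of_pos hx0 _
      have h6 : Real.Gamma x * x ≤ Real.Gamma (x + s) * ((1 + 1 / x₀) * x ^ (1 - s)) :=
        h1.trans (by gcongr)
      rw [inv_mul_eq_div, div_mul_eq_mul_div, div_le_iff₀ (by positivity)]
      refine le_of_mul_le_mul_right ?_ h5
      calc x ^ s * Real.Gamma x * x ^ (1 - s) = Real.Gamma x * (x ^ s * x ^ (1 - s)) := by ring
        _ = Real.Gamma x * x := by rw [h4]
        _ ≤ _ := h6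
        _ = _ := by ring
  -- The integer part of `δ` is handled by the functional equation; each step multiplies the
  -- quotient by `x + (s + m)`, which is comparable to `x` for `x ≥ x₀`.
  have hnat : ∀ (s : ℝ), 0 ≤ s → s < 1 → ∀ m : ℕ, ∃ c > 0, ∃ C > 0, ∀ x, x₀ ≤ x →
      c * x ^ (s + m) ≤ Real.Gamma (x + (s + m)) / Real.Gamma x ∧
        Real.Gamma (x + (s + m)) / Real.Gamma x ≤ C * x ^ (s + m) := by
    intro s hs0 hs1 m
    induction m with
    | zero => simpa using hfrac s hs0 hs1
    | succ m ih =>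
      obtain ⟨c, hc, C, hC, h⟩ := ih
      refine ⟨c, hc, C * (1 + (s + m) / x₀), by positivity, fun x hx => ?_⟩
      have hx0 : 0 < x := hx₀.trans_le hx
      obtain ⟨h1, h2⟩ := h x hx
      have h3 : Real.Gamma (x + (s + (m + 1 : ℕ))) = (x + (s + m)) * Real.Gamma (x + (s + m)) := by
        rw [← Real.Gamma_add_one (by positivity)]
        push_cast
        ring_nf
      have h4 : x ^ (s + (m + 1 : ℕ)) = x * x ^ (s + m) := by
        rw [← Real.rpow_one_add' hx0.le (by positivity)]
        push_cast
        ring_nf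
      have h5 : x + (s + m) ≤ (1 + (s + m) / x₀) * x := by
        have : s + m ≤ (s + m) / x₀ * x := by
          rw [div_mul_eq_mul_div, le_div_iff₀ hx₀]
          gcongr
        linarith
      have hpow : 0 < x ^ (s + m) := Real.rpow_pos_of_pos hx0 _
      rw [h3, h4, mul_div_assoc]
      constructor
      · calc c * (x * x ^ (s + m)) = x * (c * x ^ (s + m)) := by ring
          _ ≤ (x + (s + m)) * (Real.Gamma (x + (s + m)) / Real.Gamma x) := by
              gcongr
              have : (0 : ℝ) ≤ s + m := by positivity
              linarith
      · calc (x + (s + m)) * (Real.Gamma (x + (s + m)) / Real.Gamma x)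
            ≤ ((1 + (s + m) / x₀) * x) * (C * x ^ (s + m)) := by gcongr
          _ = _ := by ring
  have := hnat (Int.fract δ) (Int.fract_nonneg δ) (Int.fract_lt_one δ) ⌊δ⌋₊
  rwa [natCast_floor_eq_intCast_floor hδ, Int.fract_add_floor] at this

/-- The mixed second difference of `log Γ`. -/
noncomputable def logGammaDiff (x y t : ℝ) : ℝ :=
  Real.log (Real.Gamma (t + x + y)) + Real.log (Real.Gamma t) - Real.log (Real.Gamma (t + x)) -
    Real.log (Real.Gamma (t + y))

/-- In Euler's limit formula for `log Γ` the terms affine in the argument cancel in a mixed second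
difference, and the remaining logarithms combine into one positive series. -/
theorem hasSum_logGammaDiff {x y t : ℝ} (hx : 0 < x) (hy : 0 < y) (ht : 0 < t) :
    HasSum (fun m : ℕ => Real.log (1 + x * y / ((t + m) * (t + m + x + y))))
      (logGammaDiff x y t) := by
  -- The shift by one matches `logGammaSeq`, whose sum runs over `N + 1` terms.
  rw [hasSum_iff_tendsto_nat_of_nonneg (fun m => Real.log_nonneg (by
    have : 0 ≤ x * y / ((t + m) * (t + m + x + y)) := by positivity
    linarith)), ← tendsto_add_atTop_iff_nat 1]
  have h := (((Real.BohrMollerup.tendsto_log_gamma (by positivity : 0 < t + x + y)).add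
    (Real.BohrMollerup.tendsto_log_gamma ht)).sub
    (Real.BohrMollerup.tendsto_log_gamma (by positivity : 0 < t + x))).sub
    (Real.BohrMollerup.tendsto_log_gamma (by positivity : 0 < t + y))
  refine h.congr fun N => ?_
  have hterm : ∀ m : ℕ, Real.log (1 + x * y / ((t + m) * (t + m + x + y))) =
      Real.log (t + x + m) + Real.log (t + y + m) - Real.log (t + m) -
        Real.log (t + x + y + m) := by
    intro m
    rw [← Real.log_mul (by positivity) (by positivity), ← Real.log_div (by positivity)
      (by positivity), ← Real.log_div (by positivity) (by positivity)]
    congr 1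
    field_simp
    ring
  simp only [Real.BohrMollerup.logGammaSeq, hterm, Finset.sum_sub_distrib, Finset.sum_add_distrib]
  ring

/-- A telescoping series with exact sum `1 / t`, used as the comparison series for `logGammaDiff`.
-/
theorem hasSum_one_div_mul_add_one {t : ℝ} (ht : 0 < t) :
    HasSum (fun m : ℕ => 1 / ((t + m) * (t + m + 1))) (1 / t) := by
  rw [hasSum_iff_tendsto_nat_of_nonneg (fun m => by positivity)]
  have h1 : ∀ N : ℕ, ∑ m ∈ Finset.range N, 1 / ((t + m) * (t + m + 1)) = 1 / t - 1 / (t + N) := by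
    intro N
    induction N with
    | zero => simp
    | succ N ih =>
      rw [Finset.sum_range_succ, ih]
      push_cast
      field_simp
      ring
  simp_rw [h1]
  have h2 : Tendsto (fun N : ℕ => 1 / (t + (N : ℝ))) atTop (𝓝 0) := by
    simp_rw [one_div]
    exact tendsto_inv_atTop_zero.comp (tendsto_atTop_add_const_left _ t tendsto_natCast_atTop_atTop)
  simpa using tendsto_const_nhds.sub h2

theorem logGammaDiff_nonneg {x y t : ℝ} (hx : 0 < x) (hy : 0 < y) (ht : 0 < t) :
    0 ≤ logGammaDiff x y t :=
  (hasSum_logGammaDiff hx hy ht).nonneg fun m => Real.log_nonneg (by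
    have : 0 ≤ x * y / ((t + m) * (t + m + x + y)) := by positivity
    linarith)

theorem logGammaDiff_anti {x y t s : ℝ} (hx : 0 < x) (hy : 0 < y) (ht : 0 < t) (hts : t ≤ s) :
    logGammaDiff x y s ≤ logGammaDiff x y t := by
  refine hasSum_le (fun m => ?_) (hasSum_logGammaDiff hx hy (ht.trans_le hts))
    (hasSum_logGammaDiff hx hy ht)
  have := ht.trans_le hts
  refine Real.log_le_log (by positivity) ?_
  gcongr

/-- With `v = xy / ((t+m)(t+m+x+y))`, each term satisfies `v / (1 + v) ≤ log (1 + v) ≤ v`, and `v /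
(1 + v) = xy / ((t+m+x)(t+m+y))`. Both bounds are comparable to the telescoping terms, uniformly for
`t ≥ t₀`. -/
theorem exists_logGammaDiff_bounds {x y t₀ : ℝ} (hx : 0 < x) (hy : 0 < y) (ht₀ : 0 < t₀) :
    ∃ c > 0, ∃ C > 0, ∀ t, t₀ ≤ t → c / t ≤ logGammaDiff x y t ∧ logGammaDiff x y t ≤ C / t := by
  refine ⟨x * y / ((1 + x / t₀) * (1 + y / t₀)), by positivity, x * y * (1 + 1 / t₀), by positivity,
    fun t htt => ?_⟩
  have ht : 0 < t := ht₀.trans_le htt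
  have hcmp : ∀ (b : ℝ) (m : ℕ), 0 ≤ b → t + m + b ≤ (1 + b / t₀) * (t + m) := by
    intro b m hb
    have : b ≤ b / t₀ * (t + m) := by
      rw [div_mul_eq_mul_div, le_div_iff₀ ht₀]
      gcongr
      have : (0 : ℝ) ≤ m := by positivity
      linarith
    linarith
  constructor
  · rw [div_eq_mul_one_div]
    refine hasSum_le (fun m => ?_) ((hasSum_one_div_mul_add_one ht).mul_left _)
      (hasSum_logGammaDiff hx hy ht)
    have h1 : x * y / ((t + m + x) * (t + m + y)) ≤
        Real.log (1 + x * y / ((t + m) * (t + m + x + y))) := by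
      have h2 := Real.one_sub_inv_le_log_of_pos
        (by positivity : 0 < 1 + x * y / ((t + m) * (t + m + x + y)))
      refine le_trans (le_of_eq ?_) h2
      field_simp
      ring
    refine le_trans ?_ h1
    rw [div_mul_div_comm, mul_one]
    refine div_le_div_of_nonneg_left (by positivity) (by positivity) ?_
    have h5 : t + m ≤ t + m + 1 := by linarith
    calc (t + m + x) * (t + m + y) ≤ ((1 + x / t₀) * (t + m)) * ((1 + y / t₀) * (t + m)) := by
          have h3 := hcmp x m hx.le
          have h4 := hcmp y m hy.le
          gcongr
      _ ≤ ((1 + x / t₀) * (t + m)) * ((1 + y / t₀) * (t + m + 1)) := by gcongr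
      _ = (1 + x / t₀) * (1 + y / t₀) * ((t + m) * (t + m + 1)) := by ring
  · rw [div_eq_mul_one_div]
    refine hasSum_le (fun m => ?_) (hasSum_logGammaDiff hx hy ht)
      ((hasSum_one_div_mul_add_one ht).mul_left _)
    have h1 : Real.log (1 + x * y / ((t + m) * (t + m + x + y))) ≤
        x * y / ((t + m) * (t + m + x + y)) := by
      have := Real.log_le_sub_one_of_pos
        (by positivity : 0 < 1 + x * y / ((t + m) * (t + m + x + y)))
      linarith
    refine h1.trans ?_
    rw [mul_one_div, div_le_div_iff₀ (by positivity) (by positivity)]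
    have h5 : t + m ≤ t + m + x + y := by linarith
    have h3 : t + m + 1 ≤ (1 + 1 / t₀) * (t + m + x + y) :=
      (hcmp 1 m zero_le_one).trans (by gcongr)
    calc x * y * ((t + m) * (t + m + 1)) ≤
          x * y * ((t + m) * ((1 + 1 / t₀) * (t + m + x + y))) := by gcongr
      _ = _ := by ring

theorem exists_abs_log_Gamma_add_sub_le {δ x₀ : ℝ} (hδ : 0 ≤ δ) (hx₀ : 0 < x₀) :
    ∃ M, ∀ x, x₀ ≤ x →
      |Real.log (Real.Gamma (x + δ)) - Real.log (Real.Gamma x) - δ * Real.log x| ≤ M := by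
  obtain ⟨c, hc, C, hC, h⟩ := Real.exists_Gamma_add_div_bounds hδ hx₀
  refine ⟨max (-Real.log c) (Real.log C), fun x hx => ?_⟩
  have hx0 : 0 < x := hx₀.trans_le hx
  obtain ⟨h1, h2⟩ := h x hx
  have hG := Real.Gamma_pos_of_pos hx0
  have hG' := Real.Gamma_pos_of_pos (by linarith : 0 < x + δ)
  have hpow := Real.rpow_pos_of_pos hx0 δ
  have h3 := Real.log_le_log (by positivity) h1
  have h4 := Real.log_le_log (by positivity) h2
  rw [Real.log_mul hc.ne' hpow.ne', Real.log_rpow hx0, Real.log_div hG'.ne' hG.ne'] at h3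
  rw [Real.log_mul hC.ne' hpow.ne', Real.log_rpow hx0, Real.log_div hG'.ne' hG.ne'] at h4
  rw [abs_le]
  constructor
  · have := le_max_left (-Real.log c) (Real.log C)
    linarith
  · have := le_max_right (-Real.log c) (Real.log C)
    linarith

theorem exists_abs_log_sub_log_le {c C : ℝ} (hc : 0 < c) (hC : 0 < C) :
    ∃ M, ∀ x t : ℝ, 0 < x → c * x ≤ t → t ≤ C * x → |Real.log t - Real.log x| ≤ M := by
  refine ⟨max (-Real.log c) (Real.log C), fun x t hx h1 h2 => ?_⟩
  have h3 := Real.log_le_log (by positivity) h1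
  have h4 := Real.log_le_log (by nlinarith) h2
  rw [Real.log_mul hc.ne' hx.ne'] at h3
  rw [Real.log_mul hC.ne' hx.ne'] at h4
  rw [abs_le]
  constructor
  · have := le_max_left (-Real.log c) (Real.log C)
    linarith
  · have := le_max_right (-Real.log c) (Real.log C)
    linarith

/-- A function comparable to `X` may be replaced by `X` in the asymptotics of `log Γ`. -/
theorem exists_abs_log_Gamma_comp_sub_le {A : Type*} {T X : A → ℝ} {δ c C : ℝ} (hδ : 0 ≤ δ)
    (hc : 0 < c) (hC : 0 < C) (hX : ∀ α, 1 ≤ X α) (h1 : ∀ α, c * X α ≤ T α)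
    (h2 : ∀ α, T α ≤ C * X α) :
    ∃ M, ∀ α, |Real.log (Real.Gamma (T α + δ)) - Real.log (Real.Gamma (T α)) -
      δ * Real.log (X α)| ≤ M := by
  obtain ⟨M₁, hM₁⟩ := exists_abs_log_Gamma_add_sub_le hδ hc
  obtain ⟨M₂, hM₂⟩ := exists_abs_log_sub_log_le hc hC
  refine ⟨M₁ + δ * M₂, fun α => ?_⟩
  have hcT : c ≤ T α := by nlinarith [hX α, h1 α]
  have e1 := abs_le.1 (hM₁ (T α) hcT)
  have e2 := abs_le.1 (hM₂ (X α) (T α) (by linarith [hX α]) (h1 α) (h2 α))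
  rw [abs_le]
  constructor <;> nlinarith

theorem exists_sum_mul_bounds {ι : Type*} [Fintype ι] {b : ι → ℝ} (hb : ∀ i, 0 < b i) :
    ∃ c > 0, ∃ C > 0, ∀ x : ι → ℝ, (∀ i, 0 ≤ x i) →
      c * ∑ i, x i ≤ ∑ i, b i * x i ∧ ∑ i, b i * x i ≤ C * ∑ i, x i := by
  rcases isEmpty_or_nonempty ι with h | h
  · exact ⟨1, one_pos, 1, one_pos, fun x _ => by simp⟩
  obtain ⟨i₀, hi₀⟩ := Finite.exists_min b
  obtain ⟨i₁, hi₁⟩ := Finite.exists_max b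
  refine ⟨b i₀, hb _, b i₁, hb _, fun x hx => ?_⟩
  rw [Finset.mul_sum, Finset.mul_sum]
  exact ⟨Finset.sum_le_sum fun i _ => mul_le_mul_of_nonneg_right (hi₀ i) (hx i),
    Finset.sum_le_sum fun i _ => mul_le_mul_of_nonneg_right (hi₁ i) (hx i)⟩

/-! ### Logarithms of the monomial norms and their first differences -/

section Weights

variable {K : ℕ} {n : Fin K → ℕ}

/-- The sums `∑ⱼ (αⱼₖ + 1) / rⱼₖ` over a block. -/
noncomputable def blockSum (r : (k : Fin K) → Fin (n k) → ℝ) (α : (Σ k : Fin K, Fin (n k)) → ℕ)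
    (k : Fin K) : ℝ := ∑ j, ((α ⟨k, j⟩ : ℝ) + 1) / r k j

/-- The sum `∑ₖ aₖ⁻¹ ∑ⱼ (αⱼₖ + 1) / rⱼₖ`. -/
noncomputable def totalSum (a : Fin K → ℝ) (r : (k : Fin K) → Fin (n k) → ℝ)
    (α : (Σ k : Fin K, Fin (n k)) → ℕ) : ℝ := ∑ k, blockSum r α k / a k

/-- The logarithm of the squared norm of `z^α` in the Bergman space of an egg domain. -/
noncomputable def eggLogNormSq (a : Fin K → ℝ) (r : (k : Fin K) → Fin (n k) → ℝ)
    (α : (Σ k : Fin K, Fin (n k)) → ℕ) : ℝ :=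
  ∑ k, (Real.log (Real.Gamma (1 + blockSum r α k / a k)) -
    Real.log (Real.Gamma (1 + blockSum r α k)) +
    ∑ j, (Real.log (Real.pi / r k j) + Real.log (Real.Gamma ((α ⟨k, j⟩ + 1) / r k j)))) -
  Real.log (Real.Gamma (1 + totalSum a r α))

variable {a : Fin K → ℝ} {r : (k : Fin K) → Fin (n k) → ℝ}

theorem blockSum_nonneg (hr : ∀ k j, 0 < r k j) (α : (Σ k : Fin K, Fin (n k)) → ℕ) (k : Fin K) :
    0 ≤ blockSum r α k := Finset.sum_nonneg fun j _ => by have := hr k j; positivity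

theorem totalSum_nonneg (ha : ∀ k, 0 < a k) (hr : ∀ k j, 0 < r k j)
    (α : (Σ k : Fin K, Fin (n k)) → ℕ) : 0 ≤ totalSum a r α :=
  Finset.sum_nonneg fun k _ => div_nonneg (blockSum_nonneg hr α k) (ha k).le

theorem monomialNormSq_eggDomain_eq_exp (ha : ∀ k, 0 < a k) (hr : ∀ k j, 0 < r k j)
    (α : (Σ k : Fin K, Fin (n k)) → ℕ) :
    monomialNormSq (eggDomain n a r ha hr : Set ((Σ k : Fin K, Fin (n k)) → ℂ)) α =
      Real.exp (eggLogNormSq a r α) := by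
  have hG : ∀ k, 0 < Real.Gamma (1 + blockSum r α k) := fun k =>
    Real.Gamma_pos_of_pos (by linarith [blockSum_nonneg hr α k])
  have hGa : ∀ k, 0 < Real.Gamma (1 + blockSum r α k / a k) := fun k =>
    Real.Gamma_pos_of_pos (by have := div_nonneg (blockSum_nonneg hr α k) (ha k).le; linarith)
  have hS : 0 < Real.Gamma (1 + totalSum a r α) :=
    Real.Gamma_pos_of_pos (by linarith [totalSum_nonneg ha hr α])
  have hγ : ∀ k j, 0 < Real.Gamma (((α ⟨k, j⟩ : ℝ) + 1) / r k j) := fun k j =>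
    Real.Gamma_pos_of_pos (by have := hr k j; positivity)
  rw [monomialNormSq_eggDomain, eggLogNormSq, Real.exp_sub, Real.exp_log hS, Real.exp_sum]
  congr 1
  refine Finset.prod_congr rfl fun k _ => ?_
  rw [Real.exp_add, Real.exp_sub, Real.exp_log (hG k), Real.exp_log (hGa k), Real.exp_sum]
  congr 1
  refine Finset.prod_congr rfl fun j _ => ?_
  rw [Real.exp_add, Real.exp_log (hγ k j), Real.exp_log (by have := hr k j; positivity)]

theorem blockSum_add_single (α : (Σ k : Fin K, Fin (n k)) → ℕ) (i : Σ k : Fin K, Fin (n k))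
    (k : Fin K) : blockSum r (α + Pi.single i 1) k =
      blockSum r α k + if k = i.1 then 1 / r i.1 i.2 else 0 := by
  obtain ⟨k₀, j₀⟩ := i
  have h : ∀ j : Fin (n k), (((α + Pi.single ⟨k₀, j₀⟩ 1 : (Σ k : Fin K, Fin (n k)) → ℕ) ⟨k, j⟩ : ℝ)
      + 1) / r k j = (α ⟨k, j⟩ + 1) / r k j +
        (if (⟨k, j⟩ : Σ k : Fin K, Fin (n k)) = ⟨k₀, j₀⟩ then 1 / r k j else 0) := by
    intro j
    by_cases hj : (⟨k, j⟩ : Σ k : Fin K, Fin (n k)) = ⟨k₀, j₀⟩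
    · rw [Pi.add_apply, hj, Pi.single_eq_same, if_pos rfl]
      push_cast
      ring
    · rw [Pi.add_apply, Pi.single_eq_of_ne hj, if_neg hj]
      simp
  rw [blockSum, Finset.sum_congr rfl fun j _ => h j, Finset.sum_add_distrib]
  congr 1
  by_cases hk : k = k₀
  · subst hk
    simp
  · rw [if_neg hk]
    refine Finset.sum_eq_zero fun j _ => if_neg fun h => hk (congrArg Sigma.fst h)

theorem totalSum_add_single (α : (Σ k : Fin K, Fin (n k)) → ℕ) (i : Σ k : Fin K, Fin (n k)) :
    totalSum a r (α + Pi.single i 1) = totalSum a r α + 1 / r i.1 i.2 / a i.1 := by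
  simp only [totalSum, blockSum_add_single, add_div, Finset.sum_add_distrib, ite_div, zero_div,
    Finset.sum_ite_eq', Finset.mem_univ, if_true]

/-- The increment of the logarithm of the squared norm of the monomials. -/
theorem eggLogNormSq_add_single (α : (Σ k : Fin K, Fin (n k)) → ℕ)
    (i : Σ k : Fin K, Fin (n k)) :
    eggLogNormSq a r (α + Pi.single i 1) - eggLogNormSq a r α =
      (Real.log (Real.Gamma ((α i + 1) / r i.1 i.2 + 1 / r i.1 i.2)) -
        Real.log (Real.Gamma ((α i + 1) / r i.1 i.2))) +
      (Real.log (Real.Gamma (1 + blockSum r α i.1 / a i.1 + 1 / r i.1 i.2 / a i.1)) -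
        Real.log (Real.Gamma (1 + blockSum r α i.1 / a i.1))) -
      (Real.log (Real.Gamma (1 + blockSum r α i.1 + 1 / r i.1 i.2)) -
        Real.log (Real.Gamma (1 + blockSum r α i.1))) -
      (Real.log (Real.Gamma (1 + totalSum a r α + 1 / r i.1 i.2 / a i.1)) -
        Real.log (Real.Gamma (1 + totalSum a r α))) := by
  have hb : ∀ (f : Fin K → ℝ → ℝ), ∑ k, f k (blockSum r (α + Pi.single i 1) k) =
      ∑ k, f k (blockSum r α k) + (f i.1 (blockSum r α i.1 + 1 / r i.1 i.2) -
        f i.1 (blockSum r α i.1)) := by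
    intro f
    have : ∀ k, f k (blockSum r (α + Pi.single i 1) k) = f k (blockSum r α k) +
        if k = i.1 then (f i.1 (blockSum r α i.1 + 1 / r i.1 i.2) - f i.1 (blockSum r α i.1))
        else 0 := by
      intro k
      rw [blockSum_add_single]
      by_cases hk : k = i.1
      · subst hk; simp
      · simp [hk]
    simp only [this, Finset.sum_add_distrib, Finset.sum_ite_eq', Finset.mem_univ, if_true]
  have hg : ∑ s : Σ k : Fin K, Fin (n k), Real.log (Real.Gamma
        ((((α + Pi.single i 1 : (Σ k : Fin K, Fin (n k)) → ℕ) s : ℝ) + 1) / r s.1 s.2)) =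
      ∑ s : Σ k : Fin K, Fin (n k), Real.log (Real.Gamma (((α s : ℝ) + 1) / r s.1 s.2)) +
      (Real.log (Real.Gamma ((α i + 1) / r i.1 i.2 + 1 / r i.1 i.2)) -
        Real.log (Real.Gamma ((α i + 1) / r i.1 i.2))) := by
    have : ∀ s, Real.log (Real.Gamma
        ((((α + Pi.single i 1 : (Σ k : Fin K, Fin (n k)) → ℕ) s : ℝ) + 1) / r s.1 s.2)) =
        Real.log (Real.Gamma (((α s : ℝ) + 1) / r s.1 s.2)) + if s = i then
        (Real.log (Real.Gamma ((α i + 1) / r i.1 i.2 + 1 / r i.1 i.2)) -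
        Real.log (Real.Gamma ((α i + 1) / r i.1 i.2))) else 0 := by
      intro s
      by_cases hs : s = i
      · subst hs
        simp [add_div]
      · simp [hs]
    simp only [this, Finset.sum_add_distrib, Finset.sum_ite_eq', Finset.mem_univ, if_true]
  rw [Fintype.sum_sigma, Fintype.sum_sigma] at hg
  simp only [eggLogNormSq, Finset.sum_add_distrib, Finset.sum_sub_distrib, totalSum_add_single]
  rw [hb fun k x => Real.log (Real.Gamma (1 + x / a k)),
    hb fun k x => Real.log (Real.Gamma (1 + x)), hg]
  simp only [add_div, ← add_assoc]
  ring

end Weights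

/-! ### Size estimates for first and second differences -/

/-- The second difference is `O(1 / T)`, and `T` dominates both `X` and `Y`, hence their geometric
mean. This symmetric form lets the bound for `[Mᵢ, Mⱼ*]` split between `i` and `j`. -/
theorem exists_abs_logGammaDiff_comp_le {A : Type*} {T X Y : A → ℝ} {u v c : ℝ} (hu : 0 < u)
    (hv : 0 < v) (hc : 0 < c) (hX1 : ∀ β, 1 ≤ X β) (hY1 : ∀ β, 1 ≤ Y β) (hX : ∀ β, c * X β ≤ T β)
    (hY : ∀ β, c * Y β ≤ T β) :
    ∃ C, 0 ≤ C ∧ ∀ β, |logGammaDiff u v (T β)| ≤ C / √(X β * Y β) := by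
  obtain ⟨c₁, -, C, hC, h⟩ := exists_logGammaDiff_bounds hu hv hc
  refine ⟨C / c, by positivity, fun β => ?_⟩
  have hcT : c ≤ T β := by nlinarith [hX1 β, hX β]
  have hT : 0 < T β := hc.trans_le hcT
  rw [abs_of_nonneg (logGammaDiff_nonneg hu hv hT)]
  refine (h _ hcT).2.trans ?_
  have hXY : 0 < X β * Y β := mul_pos (by linarith [hX1 β]) (by linarith [hY1 β])
  rw [div_div]
  refine div_le_div_of_nonneg_left hC.le (by positivity) ?_
  refine le_of_sq_le_sq ?_ hT.le
  rw [mul_pow, Real.sq_sqrt hXY.le]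
  have h1 : 0 < X β := by linarith [hX1 β]
  have h2 : 0 < Y β := by linarith [hY1 β]
  nlinarith [mul_le_mul (hX β) (hY β) (by positivity) hT.le]

section Weights

variable {K : ℕ} {n : Fin K → ℕ}

/-- The number of exponents in a block plus their sum. -/
noncomputable def blockSize (α : (Σ k : Fin K, Fin (n k)) → ℕ) (k : Fin K) : ℝ :=
  ∑ j, ((α ⟨k, j⟩ : ℝ) + 1)

/-- The number of exponents plus their sum. -/
noncomputable def totalSize (α : (Σ k : Fin K, Fin (n k)) → ℕ) : ℝ := ∑ s, ((α s : ℝ) + 1)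

theorem le_blockSize (α : (Σ k : Fin K, Fin (n k)) → ℕ) (k : Fin K) (j : Fin (n k)) :
    (α ⟨k, j⟩ : ℝ) + 1 ≤ blockSize α k :=
  Finset.single_le_sum (f := fun j => (α ⟨k, j⟩ : ℝ) + 1) (fun _ _ => by positivity)
    (Finset.mem_univ j)

theorem blockSize_le_totalSize (α : (Σ k : Fin K, Fin (n k)) → ℕ) (k : Fin K) :
    blockSize α k ≤ totalSize α := by
  rw [totalSize, Fintype.sum_sigma]
  exact Finset.single_le_sum (f := fun k => ∑ j, ((α ⟨k, j⟩ : ℝ) + 1))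
    (fun _ _ => Finset.sum_nonneg fun _ _ => by positivity) (Finset.mem_univ k)

theorem one_le_blockSize (α : (Σ k : Fin K, Fin (n k)) → ℕ) (i : Σ k : Fin K, Fin (n k)) :
    1 ≤ blockSize α i.1 := le_trans (by simp) (le_blockSize α i.1 i.2)

variable {a : Fin K → ℝ} {r : (k : Fin K) → Fin (n k) → ℝ}

theorem div_le_blockSum (hr : ∀ k j, 0 < r k j) (α : (Σ k : Fin K, Fin (n k)) → ℕ)
    (i : Σ k : Fin K, Fin (n k)) : ((α i : ℝ) + 1) / r i.1 i.2 ≤ blockSum r α i.1 :=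
  Finset.single_le_sum (f := fun j => ((α ⟨i.1, j⟩ : ℝ) + 1) / r i.1 j)
    (fun j _ => by have := hr i.1 j; positivity) (Finset.mem_univ i.2)

theorem blockSum_div_le_totalSum (ha : ∀ k, 0 < a k) (hr : ∀ k j, 0 < r k j)
    (α : (Σ k : Fin K, Fin (n k)) → ℕ) (k : Fin K) : blockSum r α k / a k ≤ totalSum a r α :=
  Finset.single_le_sum (f := fun k => blockSum r α k / a k)
    (fun k _ => div_nonneg (blockSum_nonneg hr α k) (ha k).le) (Finset.mem_univ k)

theorem exists_blockSum_bounds (hr : ∀ k j, 0 < r k j) (k : Fin K) :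
    ∃ c > 0, ∃ C > 0, ∀ α : (Σ k : Fin K, Fin (n k)) → ℕ,
      c * blockSize α k ≤ blockSum r α k ∧ blockSum r α k ≤ C * blockSize α k := by
  obtain ⟨c, hc, C, hC, h⟩ := exists_sum_mul_bounds (b := fun j => (r k j)⁻¹)
    fun j => inv_pos.2 (hr k j)
  refine ⟨c, hc, C, hC, fun α => ?_⟩
  have := h (fun j => (α ⟨k, j⟩ : ℝ) + 1) fun j => by positivity
  simpa only [blockSum, blockSize, div_eq_inv_mul] using this

theorem exists_totalSum_bounds (ha : ∀ k, 0 < a k) (hr : ∀ k j, 0 < r k j) :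
    ∃ c > 0, ∃ C > 0, ∀ α : (Σ k : Fin K, Fin (n k)) → ℕ,
      c * totalSize α ≤ totalSum a r α ∧ totalSum a r α ≤ C * totalSize α := by
  obtain ⟨c, hc, C, hC, h⟩ := exists_sum_mul_bounds
    (b := fun s : Σ k : Fin K, Fin (n k) => (a s.1)⁻¹ * (r s.1 s.2)⁻¹)
    fun s => mul_pos (inv_pos.2 (ha s.1)) (inv_pos.2 (hr s.1 s.2))
  refine ⟨c, hc, C, hC, fun α => ?_⟩
  have := h (fun s => (α s : ℝ) + 1) fun s => by positivity
  simp only [totalSum, blockSum, totalSize, div_eq_inv_mul, Finset.mul_sum] at this ⊢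
  simpa only [Fintype.sum_sigma, mul_assoc] using this

/-- The leading term of the logarithm of `‖z^(α + εᵢ)‖² / ‖z^α‖²`. -/
noncomputable def eggWeightLog (a : Fin K → ℝ) (r : (k : Fin K) → Fin (n k) → ℝ)
    (i : Σ k : Fin K, Fin (n k)) (α : (Σ k : Fin K, Fin (n k)) → ℕ) : ℝ :=
  1 / r i.1 i.2 * Real.log (α i + 1) +
    (1 / r i.1 i.2 / a i.1 - 1 / r i.1 i.2) * Real.log (blockSize α i.1) -
    1 / r i.1 i.2 / a i.1 * Real.log (totalSize α)

/-- The increment consists of four Gamma quotients. Their arguments are comparable to `α i + 1`, to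
the block size (twice) and to the total size, so each quotient is a power of that size up to a
bounded factor. -/
theorem exists_abs_eggLogNormSq_sub_le (ha : ∀ k, 0 < a k) (hr : ∀ k j, 0 < r k j)
    (i : Σ k : Fin K, Fin (n k)) : ∃ M, ∀ α, |eggLogNormSq a r (α + Pi.single i 1) -
      eggLogNormSq a r α - eggWeightLog a r i α| ≤ M := by
  have hri := hr i.1 i.2
  have hai := ha i.1
  obtain ⟨c, hc, C, hC, hb⟩ := exists_blockSum_bounds hr i.1
  obtain ⟨c', hc', C', hC', ht⟩ := exists_totalSum_bounds ha hr
  have hx1 : ∀ α : (Σ k : Fin K, Fin (n k)) → ℕ, 1 ≤ (α i : ℝ) + 1 := fun α => by simp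
  have hX1 := fun α : (Σ k : Fin K, Fin (n k)) → ℕ => one_le_blockSize α i
  have hS1 : ∀ α : (Σ k : Fin K, Fin (n k)) → ℕ, 1 ≤ totalSize α := fun α =>
    (hX1 α).trans (blockSize_le_totalSize α i.1)
  obtain ⟨M₁, h₁⟩ := exists_abs_log_Gamma_comp_sub_le
    (T := fun α : (Σ k : Fin K, Fin (n k)) → ℕ => ((α i : ℝ) + 1) / r i.1 i.2)
    (X := fun α => (α i : ℝ) + 1) (δ := 1 / r i.1 i.2) (c := (r i.1 i.2)⁻¹) (C := (r i.1 i.2)⁻¹)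
    (by positivity) (by positivity) (by positivity) hx1
    (fun α => by rw [div_eq_inv_mul]) (fun α => by rw [div_eq_inv_mul])
  obtain ⟨M₂, h₂⟩ := exists_abs_log_Gamma_comp_sub_le
    (T := fun α : (Σ k : Fin K, Fin (n k)) → ℕ => 1 + blockSum r α i.1 / a i.1)
    (X := fun α => blockSize α i.1) (δ := 1 / r i.1 i.2 / a i.1) (c := c / a i.1)
    (C := 1 + C / a i.1) (by positivity) (by positivity) (by positivity) hX1
    (fun α => by
      rw [div_mul_eq_mul_div]
      have := div_le_div_of_nonneg_right (hb α).1 hai.le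
      linarith)
    (fun α => by
      rw [add_mul, div_mul_eq_mul_div]
      have := div_le_div_of_nonneg_right (hb α).2 hai.le
      linarith [hX1 α])
  obtain ⟨M₃, h₃⟩ := exists_abs_log_Gamma_comp_sub_le
    (T := fun α : (Σ k : Fin K, Fin (n k)) → ℕ => 1 + blockSum r α i.1)
    (X := fun α => blockSize α i.1) (δ := 1 / r i.1 i.2) (c := c)
    (C := 1 + C) (by positivity) (by positivity) (by positivity) hX1
    (fun α => by linarith [(hb α).1]) (fun α => by linarith [hX1 α, (hb α).2])
  obtain ⟨M₄, h₄⟩ := exists_abs_log_Gamma_comp_sub_le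
    (T := fun α : (Σ k : Fin K, Fin (n k)) → ℕ => 1 + totalSum a r α)
    (X := fun α => totalSize α) (δ := 1 / r i.1 i.2 / a i.1) (c := c')
    (C := 1 + C') (by positivity) (by positivity) (by positivity) hS1
    (fun α => by linarith [(ht α).1]) (fun α => by linarith [hS1 α, (ht α).2])
  refine ⟨M₁ + M₂ + M₃ + M₄, fun α => ?_⟩
  have e1 := abs_le.1 (h₁ α)
  have e2 := abs_le.1 (h₂ α)
  have e3 := abs_le.1 (h₃ α)
  have e4 := abs_le.1 (h₄ α)
  rw [eggLogNormSq_add_single, eggWeightLog, abs_le, sub_mul]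
  constructor <;> linarith

/-- The mixed second differences of the logarithm of the squared norm of the monomials. -/
theorem eggLogNormSq_second_difference (β : (Σ k : Fin K, Fin (n k)) → ℕ)
    (i j : Σ k : Fin K, Fin (n k)) :
    eggLogNormSq a r (β + Pi.single j 1 + Pi.single i 1) - eggLogNormSq a r (β + Pi.single j 1) -
      (eggLogNormSq a r (β + Pi.single i 1) - eggLogNormSq a r β) =
    (if i = j then logGammaDiff (1 / r j.1 j.2) (1 / r i.1 i.2) ((β i + 1) / r i.1 i.2) else 0) +
    (if i.1 = j.1 then
      logGammaDiff (1 / r j.1 j.2 / a j.1) (1 / r i.1 i.2 / a i.1)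
        (1 + blockSum r β i.1 / a i.1) -
      logGammaDiff (1 / r j.1 j.2) (1 / r i.1 i.2) (1 + blockSum r β i.1) else 0) -
    logGammaDiff (1 / r j.1 j.2 / a j.1) (1 / r i.1 i.2 / a i.1) (1 + totalSum a r β) := by
  rw [eggLogNormSq_add_single, eggLogNormSq_add_single, blockSum_add_single, totalSum_add_single]
  by_cases hij : i = j
  · subst hij
    simp only [if_true, logGammaDiff, Pi.add_apply, Pi.single_eq_same]
    push_cast
    simp only [add_div, ← add_assoc]
    ring
  · by_cases hk : i.1 = j.1
    · simp only [if_neg hij, logGammaDiff, Pi.add_apply, Pi.single_eq_of_ne hij,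
        add_zero, add_div, ← add_assoc, ← hk, if_true]
      ring
    · simp only [if_neg hij, if_neg hk, logGammaDiff, Pi.add_apply, Pi.single_eq_of_ne hij,
        add_zero, ← add_assoc]
      ring

/-- Every `logGammaDiff` that occurs has an argument bounded below by a multiple of both `β i + 1`
and `β j + 1`; the terms whose argument would see only one of them appear only for `i = j` or for
equal blocks. -/
theorem exists_abs_second_difference_le (ha : ∀ k, 0 < a k) (hr : ∀ k j, 0 < r k j)
    (i j : Σ k : Fin K, Fin (n k)) :
    ∃ C, 0 ≤ C ∧ ∀ β, |eggLogNormSq a r (β + Pi.single j 1 + Pi.single i 1) -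
      eggLogNormSq a r (β + Pi.single j 1) -
      (eggLogNormSq a r (β + Pi.single i 1) - eggLogNormSq a r β)| ≤
      C / √((β i + 1) * (β j + 1)) := by
  have hd : ∀ s : Σ k : Fin K, Fin (n k), 0 < 1 / r s.1 s.2 := fun s => by
    have := hr s.1 s.2; positivity
  have hda : ∀ s : Σ k : Fin K, Fin (n k), 0 < 1 / r s.1 s.2 / a s.1 := fun s => by
    have := hr s.1 s.2; have := ha s.1; positivity
  have hx1 : ∀ (s : Σ k : Fin K, Fin (n k)) (β : (Σ k : Fin K, Fin (n k)) → ℕ),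
    1 ≤ (β s : ℝ) + 1 := fun s β => by simp
  set c := min (1 / r i.1 i.2) (1 / r j.1 j.2) with hc
  set c' := min (1 / r i.1 i.2 / a i.1) (1 / r j.1 j.2 / a j.1) with hc'
  have hc0 : 0 < c := lt_min (hd i) (hd j)
  have hc0' : 0 < c' := lt_min (hda i) (hda j)
  have hxp : ∀ (s : Σ k : Fin K, Fin (n k)) (β : (Σ k : Fin K, Fin (n k)) → ℕ),
    (0 : ℝ) ≤ (β s : ℝ) + 1 := fun s β => by positivity
  have hbl : ∀ (s : Σ k : Fin K, Fin (n k)) (β : (Σ k : Fin K, Fin (n k)) → ℕ),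
      1 / r s.1 s.2 * ((β s : ℝ) + 1) ≤ blockSum r β s.1 := fun s β => by
    rw [one_div_mul_eq_div]; exact div_le_blockSum hr β s
  have hbla : ∀ (s : Σ k : Fin K, Fin (n k)) (β : (Σ k : Fin K, Fin (n k)) → ℕ),
      1 / r s.1 s.2 / a s.1 * ((β s : ℝ) + 1) ≤ blockSum r β s.1 / a s.1 := fun s β => by
    rw [div_mul_eq_mul_div]; exact div_le_div_of_nonneg_right (hbl s β) (ha s.1).le
  have hci : ∀ β : (Σ k : Fin K, Fin (n k)) → ℕ, c * ((β i : ℝ) + 1) ≤ blockSum r β i.1 := fun β =>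
    (mul_le_mul_of_nonneg_right (min_le_left _ _) (hxp i β)).trans (hbl i β)
  have hcj : ∀ β : (Σ k : Fin K, Fin (n k)) → ℕ, c * ((β j : ℝ) + 1) ≤ blockSum r β j.1 := fun β =>
    (mul_le_mul_of_nonneg_right (min_le_right _ _) (hxp j β)).trans (hbl j β)
  have hci' : ∀ β : (Σ k : Fin K, Fin (n k)) → ℕ, c' * ((β i : ℝ) + 1) ≤
    blockSum r β i.1 / a i.1 := fun β =>
    (mul_le_mul_of_nonneg_right (min_le_left _ _) (hxp i β)).trans (hbla i β)
  have hcj' : ∀ β : (Σ k : Fin K, Fin (n k)) → ℕ, c' * ((β j : ℝ) + 1) ≤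
    blockSum r β j.1 / a j.1 := fun β =>
    (mul_le_mul_of_nonneg_right (min_le_right _ _) (hxp j β)).trans (hbla j β)
  have hT := blockSum_div_le_totalSum (a := a) (r := r) ha hr
  have H1 : ∃ C, 0 ≤ C ∧ ∀ β : (Σ k : Fin K, Fin (n k)) → ℕ, |if i = j then
      logGammaDiff (1 / r j.1 j.2) (1 / r i.1 i.2) ((β i + 1) / r i.1 i.2) else 0| ≤
      C / √((β i + 1) * (β j + 1)) := by
    by_cases hij : i = j
    · obtain ⟨C, hC, h⟩ := exists_abs_logGammaDiff_comp_le (hd j) (hd i) (hd i) (hx1 i) (hx1 j)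
        (T := fun β => ((β i : ℝ) + 1) / r i.1 i.2)
        (fun β => by rw [one_div_mul_eq_div]) (fun β => by rw [one_div_mul_eq_div, hij])
      exact ⟨C, hC, fun β => by simpa only [if_pos hij] using h β⟩
    · exact ⟨0, le_rfl, fun β => by simp [hij]⟩
  have H2 : ∃ C, 0 ≤ C ∧ ∀ β : (Σ k : Fin K, Fin (n k)) → ℕ, |if i.1 = j.1 then
      logGammaDiff (1 / r j.1 j.2 / a j.1) (1 / r i.1 i.2 / a i.1)
        (1 + blockSum r β i.1 / a i.1) -
      logGammaDiff (1 / r j.1 j.2) (1 / r i.1 i.2) (1 + blockSum r β i.1) else 0| ≤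
      C / √((β i + 1) * (β j + 1)) := by
    by_cases hk : i.1 = j.1
    · obtain ⟨C, hC, h⟩ := exists_abs_logGammaDiff_comp_le (hda j) (hda i) hc0' (hx1 i) (hx1 j)
        (T := fun β => 1 + blockSum r β i.1 / a i.1)
        (fun β => by linarith [hci' β]) (fun β => by rw [hk]; linarith [hcj' β])
      obtain ⟨C', hC', h'⟩ := exists_abs_logGammaDiff_comp_le (hd j) (hd i) hc0 (hx1 i) (hx1 j)
        (T := fun β => 1 + blockSum r β i.1)
        (fun β => by linarith [hci β]) (fun β => by rw [hk]; linarith [hcj β])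
      refine ⟨C + C', by positivity, fun β => ?_⟩
      rw [if_pos hk, add_div]
      exact (abs_sub _ _).trans (add_le_add (h β) (h' β))
    · exact ⟨0, le_rfl, fun β => by simp [hk]⟩
  obtain ⟨C₁, hC₁, h₁⟩ := H1
  obtain ⟨C₂, hC₂, h₂⟩ := H2
  obtain ⟨C₃, hC₃, h₃⟩ := exists_abs_logGammaDiff_comp_le (hda j) (hda i) hc0' (hx1 i) (hx1 j)
    (T := fun β => 1 + totalSum a r β)
    (fun β => by linarith [hci' β, hT β i.1]) (fun β => by linarith [hcj' β, hT β j.1])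
  refine ⟨C₁ + C₂ + C₃, by positivity, fun β => ?_⟩
  rw [eggLogNormSq_second_difference, add_div (C₁ + C₂), add_div C₁]
  exact (abs_sub _ _).trans (add_le_add ((abs_add_le _ _).trans (add_le_add (h₁ β) (h₂ β))) (h₃ β))

end Weights

/-! ### Commutator weights and series over multi-indices -/

/-- The weight of the commutator in terms of the logarithms of the squared norms. -/
theorem commutatorWeight_eq_exp {σ : Type*} [DecidableEq σ] {W : (σ → ℕ) → ℝ}
    {w : σ → (σ → ℕ) → ℝ} (hw : ∀ i α, w i α = Real.exp ((W (α + Pi.single i 1) - W α) / 2))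
    (i j : σ) (β : σ → ℕ) :
    commutatorWeight w i j β =
      Real.exp ((W (β + Pi.single i 1) - W β + (W (β + Pi.single j 1) - W β)) / 2) *
      (1 - Real.exp (W (β + Pi.single j 1 + Pi.single i 1) - W (β + Pi.single j 1) -
        (W (β + Pi.single i 1) - W β))) := by
  simp only [commutatorWeight, hw, ← Real.exp_add, mul_sub, mul_one]
  congr 2
  · ring
  · rw [add_right_comm β (Pi.single i 1) (Pi.single j 1)]
    ring

/-- A product of summable nonnegative functions of separate variables is summable. -/
theorem summable_prod_apply {σ : Type*} [Fintype σ] [DecidableEq σ] {f : σ → ℕ → ℝ}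
    (hf0 : ∀ s m, 0 ≤ f s m) (hf : ∀ s, Summable (f s)) :
    Summable fun α : σ → ℕ => ∏ s, f s (α s) := by
  refine summable_of_sum_le (c := ∏ s, ∑' m, f s m)
    (fun α => Finset.prod_nonneg fun s _ => hf0 s _) fun u => ?_
  -- A finite set of multi-indices lies in the box of its coordinate projections, over which the sum
  -- factors.
  calc ∑ α ∈ u, ∏ s, f s (α s)
      ≤ ∑ α ∈ Fintype.piFinset fun s => u.image fun α => α s, ∏ s, f s (α s) :=
        Finset.sum_le_sum_of_subset_of_nonneg
          (fun α hα => Fintype.mem_piFinset.2 fun s => Finset.mem_image_of_mem _ hα)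
          fun α _ _ => Finset.prod_nonneg fun s _ => hf0 s _
    _ = ∏ s, ∑ m ∈ u.image fun α => α s, f s m := (Finset.prod_univ_sum _ _).symm
    _ ≤ ∏ s, ∑' m, f s m := Finset.prod_le_prod
        (fun s _ => Finset.sum_nonneg fun m _ => hf0 s m)
        fun s _ => (hf s).sum_le_tsum _ fun m _ => hf0 s m

theorem summable_prod_rpow {σ : Type*} [Fintype σ] [DecidableEq σ] {q : ℝ} (hq : 1 < q) :
    Summable fun α : σ → ℕ => ∏ s, ((α s : ℝ) + 1) ^ (-q) := by
  refine summable_prod_apply (f := fun _ m => ((m : ℝ) + 1) ^ (-q)) (fun _ m => by positivity)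
    fun _ => ?_
  have := (summable_nat_add_iff 1).2 (Real.summable_nat_rpow.2 (by linarith : -q < -1))
  simpa using this

/-- A summable family on `ℕ^σ` that is at least `c N^(-τ)` on dilated boxes with `|E|` sides. -/
theorem card_lt_of_summable {σ : Type*} [Fintype σ] [DecidableEq σ] {F : (σ → ℕ) → ℝ}
    (hF : Summable F) (E : Finset σ) (hE : E.Nonempty) {m : σ → ℕ}
    (hm : ∀ s, 1 ≤ m s) {c τ : ℝ} (hc : 0 < c)
    (h : ∀ N : ℕ, 1 ≤ N → ∀ β : σ → ℕ, (∀ s ∈ E, m s * N ≤ β s ∧ β s < 2 * (m s * N)) →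
      (∀ s ∉ E, β s = 0) → c * (N : ℝ) ^ (-τ) ≤ F β) :
    (E.card : ℝ) < τ := by
  by_contra! hτ
  obtain ⟨s₀, hs₀⟩ := hE
  obtain ⟨u, hu⟩ := summable_iff_vanishing_norm.1 hF c hc
  -- With this `N` the `s₀`-coordinate of every point of the box exceeds all those in `u`, so the
  -- box avoids `u` and its sum must be smaller than `c`.
  set N := u.sup (fun α => α s₀) + 1 with hN
  have hN1 : (1 : ℝ) ≤ N := by
    rw [hN]
    push_cast
    linarith [Nat.cast_nonneg (α := ℝ) (u.sup (fun α => α s₀))]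
  set B : Finset (σ → ℕ) := Fintype.piFinset fun s =>
    if s ∈ E then Finset.Ico (m s * N) (2 * (m s * N)) else {0} with hB
  have hBmem : ∀ β ∈ B, (∀ s ∈ E, m s * N ≤ β s ∧ β s < 2 * (m s * N)) ∧ ∀ s ∉ E, β s = 0 := by
    intro β hβ
    rw [hB, Fintype.mem_piFinset] at hβ
    refine ⟨fun s hs => ?_, fun s hs => ?_⟩
    · simpa [hs] using hβ s
    · simpa [hs] using hβ s
  have hdisj : Disjoint B u := by
    rw [Finset.disjoint_left]
    intro β hβ hβu
    have h1 := ((hBmem β hβ).1 s₀ hs₀).1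
    have h2 : β s₀ ≤ u.sup fun α => α s₀ := Finset.le_sup (f := fun α => α s₀) hβu
    have h3 := Nat.mul_le_mul_right N (hm s₀)
    omega
  have hcard : (N : ℝ) ^ E.card ≤ B.card := by
    rw [hB, Fintype.card_piFinset]
    have : N ^ E.card ≤ ∏ s, (if s ∈ E then Finset.Ico (m s * N) (2 * (m s * N)) else {0}).card := by
      rw [← Finset.prod_const, ← Fintype.prod_ite_mem]
      refine Finset.prod_le_prod' fun s _ => ?_
      split_ifs
      · rw [Nat.card_Ico]
        have := Nat.mul_le_mul_right N (hm s)
        omega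
      · simp
    exact_mod_cast this
  have hsum := hu B hdisj
  have hlow : c ≤ ∑ β ∈ B, F β := by
    calc c ≤ (N : ℝ) ^ E.card * (c * (N : ℝ) ^ (-τ)) := by
          rw [← Real.rpow_natCast, mul_left_comm, ← Real.rpow_add (by linarith)]
          exact le_mul_of_one_le_right hc.le (Real.one_le_rpow hN1 (by linarith))
      _ ≤ B.card * (c * (N : ℝ) ^ (-τ)) := by gcongr
      _ = ∑ β ∈ B, c * (N : ℝ) ^ (-τ) := by rw [Finset.sum_const, nsmul_eq_mul]
      _ ≤ ∑ β ∈ B, F β := Finset.sum_le_sum fun β hβ =>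
          h N (by omega) β (hBmem β hβ).1 (hBmem β hβ).2
  rw [Real.norm_eq_abs] at hsum
  linarith [le_abs_self (∑ β ∈ B, F β)]

/-- Both differences are of the order of the reciprocal argument, so a large enough ratio `M`
between the arguments makes the second at most half the lower bound of the first. -/
theorem exists_le_logGammaDiff_sub {x y t₀ C₀ c₀ : ℝ} (hx : 0 < x) (hy : 0 < y) (ht₀ : 0 < t₀)
    (hC₀ : 0 < C₀) (hc₀ : 0 < c₀) :
    ∃ M : ℕ, 1 ≤ M ∧ ∃ e > 0, ∀ N : ℕ, 1 ≤ N → ∀ t s : ℝ, t₀ ≤ t → t ≤ C₀ * N → t₀ ≤ s →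
      c₀ * (M * N) ≤ s → e / N ≤ logGammaDiff x y t - logGammaDiff x y s := by
  obtain ⟨c, hc, C, hC, h⟩ := exists_logGammaDiff_bounds hx hy ht₀
  obtain ⟨M, hM⟩ := exists_nat_gt (2 * C * C₀ / (c * c₀))
  have hM0 : 0 < (M : ℝ) := lt_of_le_of_lt (by positivity) hM
  refine ⟨M, by exact_mod_cast hM0, c / (2 * C₀), by positivity, fun N hN t s ht htN hs hsN => ?_⟩
  have hN0 : 0 < (N : ℝ) := by exact_mod_cast hN
  have h1 := (h t ht).1
  have h2 := (h s hs).2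
  have h3 : c / (C₀ * N) ≤ c / t := div_le_div_of_nonneg_left hc.le (by linarith) htN
  have h4 : C / s ≤ C / (c₀ * (M * N)) := div_le_div_of_nonneg_left hC.le (by positivity) hsN
  have h5 : C / (c₀ * (M * N)) ≤ c / (2 * C₀ * N) := by
    rw [div_lt_iff₀ (by positivity)] at hM
    rw [div_le_div_iff₀ (by positivity) (by positivity)]
    nlinarith
  have h6 : c / (C₀ * N) = c / (2 * C₀) / N + c / (2 * C₀ * N) := by field_simp; ring
  linarith

/-! ### Lower bounds on boxes and the dominating series -/

section Weights

variable {K : ℕ} {n : Fin K → ℕ} {a : Fin K → ℝ} {r : (k : Fin K) → Fin (n k) → ℝ}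

theorem totalSize_le {α : (Σ k : Fin K, Fin (n k)) → ℕ} {B : ℝ} (h : ∀ s, (α s : ℝ) + 1 ≤ B) :
    totalSize α ≤ Fintype.card (Σ k : Fin K, Fin (n k)) * B := by
  rw [totalSize, ← nsmul_eq_mul]
  exact Finset.sum_le_card_nsmul _ _ _ fun s _ => h s

/-- Here block size and total size both lie between `N` and `B * N`, so only the factor `((α i + 1)
/ N) ^ (1 / r)` matters. The sign of `1 / (ra) - 1 / r` depends on `a`, whence the absolute value.
-/
theorem le_eggWeightLog (ha : ∀ k, 0 < a k) (hr : ∀ k j, 0 < r k j)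
    {i : Σ k : Fin K, Fin (n k)} {α : (Σ k : Fin K, Fin (n k)) → ℕ} {N B : ℝ} (hN : 1 ≤ N)
    (hB : 1 ≤ B) (h1 : N ≤ blockSize α i.1) (h2 : totalSize α ≤ B * N) :
    1 / r i.1 i.2 * (Real.log (α i + 1) - Real.log N) -
      (|1 / r i.1 i.2 / a i.1 - 1 / r i.1 i.2| + 1 / r i.1 i.2 / a i.1) * Real.log B ≤
      eggWeightLog a r i α := by
  have hri := hr i.1 i.2
  have hai := ha i.1
  have hle := blockSize_le_totalSize α i.1
  have e1 := Real.log_le_log (by linarith) h1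
  have e2 := Real.log_le_log (by linarith) hle
  have e3 := Real.log_le_log (by linarith) h2
  rw [Real.log_mul (by linarith) (by linarith)] at e3
  have hlB := Real.log_nonneg hB
  have f1 : 1 / r i.1 i.2 / a i.1 * Real.log (totalSize α) ≤
      1 / r i.1 i.2 / a i.1 * (Real.log B + Real.log N) :=
    mul_le_mul_of_nonneg_left e3 (by positivity)
  have f2 : -(|1 / r i.1 i.2 / a i.1 - 1 / r i.1 i.2| * Real.log B) ≤
      (1 / r i.1 i.2 / a i.1 - 1 / r i.1 i.2) * (Real.log (blockSize α i.1) - Real.log N) := by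
    have g1 := neg_abs_le ((1 / r i.1 i.2 / a i.1 - 1 / r i.1 i.2) *
      (Real.log (blockSize α i.1) - Real.log N))
    rw [abs_mul, abs_of_nonneg (by linarith : 0 ≤ Real.log (blockSize α i.1) - Real.log N)] at g1
    have g2 := mul_le_mul_of_nonneg_left
      (by linarith : Real.log (blockSize α i.1) - Real.log N ≤ Real.log B)
      (abs_nonneg (1 / r i.1 i.2 / a i.1 - 1 / r i.1 i.2))
    linarith
  rw [eggWeightLog]
  linarith

/-- For `i = j` the four `logGammaDiff` terms form two pairs, coordinate against block and block
against total, each nonnegative by monotonicity. Making the other coordinates `M` times larger makes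
one pair at least `e / N`: the first if the block contains another coordinate, the second otherwise.
-/
theorem exists_le_second_difference (ha : ∀ k, 0 < a k) (hr : ∀ k j, 0 < r k j)
    {i i' : Σ k : Fin K, Fin (n k)} (hii : i' ≠ i) :
    ∃ M : ℕ, 1 ≤ M ∧ ∃ e > 0, ∀ N : ℕ, 1 ≤ N → ∀ β : (Σ k : Fin K, Fin (n k)) → ℕ,
      β i < 2 * N → (∀ s, s ≠ i → M * N ≤ β s) →
      e / N ≤ eggLogNormSq a r (β + Pi.single i 1 + Pi.single i 1) -
        eggLogNormSq a r (β + Pi.single i 1) -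
        (eggLogNormSq a r (β + Pi.single i 1) - eggLogNormSq a r β) := by
  have hri := hr i.1 i.2
  have hai := ha i.1
  have hd : 0 < 1 / r i.1 i.2 := by positivity
  have hda : 0 < 1 / r i.1 i.2 / a i.1 := by positivity
  have hG : ∀ β : (Σ k : Fin K, Fin (n k)) → ℕ, 1 / r i.1 i.2 ≤ ((β i : ℝ) + 1) / r i.1 i.2 :=
    fun β => div_le_div_of_nonneg_right (by simp) hri.le
  have hGS : ∀ β : (Σ k : Fin K, Fin (n k)) → ℕ, 0 ≤ blockSum r β i.1 / a i.1 := fun β =>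
    div_nonneg (blockSum_nonneg hr β i.1) hai.le
  have hlt : ∀ (β : (Σ k : Fin K, Fin (n k)) → ℕ) (N : ℕ), β i < 2 * N → (β i : ℝ) + 1 ≤ 2 * N :=
    fun β N h => by exact_mod_cast h
  by_cases hex : ∃ s, s ≠ i ∧ s.1 = i.1
  · obtain ⟨s, hsi, hs⟩ := hex
    have hrs := hr s.1 s.2
    obtain ⟨M, hM, e, he, h⟩ := exists_le_logGammaDiff_sub hd hd hd
      (C₀ := 2 / r i.1 i.2) (c₀ := 1 / r s.1 s.2) (by positivity) (by positivity)
    refine ⟨M, hM, e, he, fun N hN β hβi hβ => ?_⟩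
    have h1 := h N hN (((β i : ℝ) + 1) / r i.1 i.2) (1 + blockSum r β i.1) (hG β)
      (by rw [div_mul_eq_mul_div]; exact div_le_div_of_nonneg_right (hlt β N hβi) hri.le)
      (by linarith [hG β, div_le_blockSum hr β i]) (by
        have h2 := div_le_blockSum hr β s
        have h3 : ((M : ℝ) * N) ≤ β s := by exact_mod_cast hβ s hsi
        have h4 : 1 / r s.1 s.2 * (M * N) ≤ ((β s : ℝ) + 1) / r s.1 s.2 := by
          rw [one_div_mul_eq_div]; exact div_le_div_of_nonneg_right (by linarith) hrs.le
        have h5 : blockSum r β s.1 = blockSum r β i.1 := by rw [hs]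
        linarith)
    have h2 := logGammaDiff_anti hda hda (t := 1 + blockSum r β i.1 / a i.1)
      (s := 1 + totalSum a r β) (by linarith [hGS β])
      (by linarith [blockSum_div_le_totalSum ha hr β i.1])
    rw [eggLogNormSq_second_difference, if_pos rfl, if_pos rfl]
    linarith
  · push Not at hex
    have hii1 := hex i' hii
    have hri' := hr i'.1 i'.2
    have hai' := ha i'.1
    obtain ⟨M, hM, e, he, h⟩ := exists_le_logGammaDiff_sub hda hda one_pos
      (C₀ := 1 + 2 / r i.1 i.2 / a i.1) (c₀ := 1 / r i'.1 i'.2 / a i'.1) (by positivity)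
      (by positivity)
    refine ⟨M, hM, e, he, fun N hN β hβi hβ => ?_⟩
    have hN' : (1 : ℝ) ≤ N := by exact_mod_cast hN
    have hblock : blockSum r β i.1 = ((β i : ℝ) + 1) / r i.1 i.2 := by
      rw [blockSum]
      exact Finset.sum_eq_single i.2
        (fun j _ hj => absurd rfl (hex ⟨i.1, j⟩ fun hji => hj (eq_of_heq (Sigma.ext_iff.1 hji).2)))
        fun hni => absurd (Finset.mem_univ _) hni
    have h1 := h N hN (1 + blockSum r β i.1 / a i.1) (1 + totalSum a r β)
      (by linarith [hGS β])
      (by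
        have : blockSum r β i.1 ≤ 2 / r i.1 i.2 * N := by
          rw [hblock, div_mul_eq_mul_div]
          exact div_le_div_of_nonneg_right (hlt β N hβi) hri.le
        have := div_le_div_of_nonneg_right this hai.le
        rw [add_mul, div_mul_eq_mul_div _ (a i.1)]
        linarith)
      (by linarith [totalSum_nonneg ha hr β])
      (by
        have h2 := div_le_blockSum hr β i'
        have h3 : ((M : ℝ) * N) ≤ β i' := by exact_mod_cast hβ i' hii
        have h4 : 1 / r i'.1 i'.2 * (M * N) ≤ ((β i' : ℝ) + 1) / r i'.1 i'.2 := by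
          rw [one_div_mul_eq_div]; exact div_le_div_of_nonneg_right (by linarith) hri'.le
        have h5 := div_le_div_of_nonneg_right (h4.trans h2) hai'.le
        rw [div_mul_eq_mul_div]
        linarith [blockSum_div_le_totalSum ha hr β i'.1])
    have h2 := logGammaDiff_anti hd hd (t := ((β i : ℝ) + 1) / r i.1 i.2)
      (s := 1 + blockSum r β i.1) (by positivity) (by linarith [div_le_blockSum hr β i])
    rw [eggLogNormSq_second_difference, if_pos rfl, if_pos rfl]
    linarith

/-- The coordinate `i` is kept, the other coordinates of its block are bounded by the block size,
and the rest by the total size; this turns the comparison product into three nested quantities. -/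
theorem sum_log_le (i : Σ k : Fin K, Fin (n k)) (α : (Σ k : Fin K, Fin (n k)) → ℕ) :
    ∑ s, Real.log ((α s : ℝ) + 1) ≤ Real.log ((α i : ℝ) + 1) +
      ((n i.1 : ℝ) - 1) * Real.log (blockSize α i.1) +
      (∑ k, (n k : ℝ) - n i.1) * Real.log (totalSize α) := by
  have hlog : ∀ s, Real.log ((α s : ℝ) + 1) ≤ Real.log (blockSize α s.1) := fun s =>
    Real.log_le_log (by positivity) (le_blockSize α s.1 s.2)
  have hlog' : ∀ s, Real.log ((α s : ℝ) + 1) ≤ Real.log (totalSize α) := fun s =>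
    Real.log_le_log (by positivity) ((le_blockSize α s.1 s.2).trans (blockSize_le_totalSize α s.1))
  have h1 : ∑ j, Real.log ((α ⟨i.1, j⟩ : ℝ) + 1) ≤ Real.log ((α i : ℝ) + 1) +
      ((n i.1 : ℝ) - 1) * Real.log (blockSize α i.1) := by
    rw [← Finset.add_sum_erase _ _ (Finset.mem_univ i.2)]
    refine add_le_add le_rfl ?_
    have := Finset.sum_le_card_nsmul (Finset.univ.erase i.2)
      (fun j => Real.log ((α ⟨i.1, j⟩ : ℝ) + 1)) (Real.log (blockSize α i.1))
      fun j _ => hlog ⟨i.1, j⟩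
    rwa [Finset.card_erase_of_mem (Finset.mem_univ _), Finset.card_univ, Fintype.card_fin,
      nsmul_eq_mul, Nat.cast_pred i.2.pos] at this
  have h2 : ∑ k ∈ Finset.univ.erase i.1, ∑ j, Real.log ((α ⟨k, j⟩ : ℝ) + 1) ≤
      (∑ k, (n k : ℝ) - n i.1) * Real.log (totalSize α) := by
    rw [← Finset.add_sum_erase _ _ (Finset.mem_univ i.1), add_sub_cancel_left, Finset.sum_mul]
    refine Finset.sum_le_sum fun k _ => ?_
    have := Finset.sum_le_card_nsmul Finset.univ
      (fun j => Real.log ((α ⟨k, j⟩ : ℝ) + 1)) (Real.log (totalSize α)) fun j _ => hlog' ⟨k, j⟩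
    rwa [Finset.card_univ, Fintype.card_fin, nsmul_eq_mul] at this
  rw [Fintype.sum_sigma, ← Finset.add_sum_erase _ _ (Finset.mem_univ i.1)]
  exact add_le_add h1 h2

/-- Summability of the powers of the leading term of the commutator weights. -/
theorem summable_exp_eggWeightLog_sub (hr : ∀ k j, 0 < r k j) {p : ℝ}
    (i : Σ k : Fin K, Fin (n k)) (h1 : ∑ k, (n k : ℝ) < p)
    (h2 : n i.1 ≠ 1 → r i.1 i.2 * (∑ k, (n k : ℝ) - 1) < p)
    (h3 : a i.1 * r i.1 i.2 * (∑ k, (n k : ℝ) - n i.1) < p) (hai : 0 < a i.1) :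
    Summable fun α => Real.exp (p * (eggWeightLog a r i α - Real.log ((α i : ℝ) + 1))) := by
  have hri := hr i.1 i.2
  set d : ℝ := ∑ k, (n k : ℝ) with hd
  have key : ∀ A B : ℝ, A < B → ∀ᶠ η in 𝓝[>] (0 : ℝ), (1 + η) * A < B := by
    intro A B hAB
    have : Tendsto (fun η : ℝ => (1 + η) * A) (𝓝 0) (𝓝 ((1 + 0) * A)) :=
      Continuous.tendsto (by fun_prop) 0
    rw [add_zero, one_mul] at this
    exact (this.mono_left nhdsWithin_le_nhds).eventually_lt_const hAB
  have h2' : n i.1 ≠ 1 → d - 1 < p * (1 / r i.1 i.2) := fun h => by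
    rw [mul_one_div, lt_div_iff₀ hri, mul_comm]; exact h2 h
  have h3' : d - n i.1 < p * (1 / r i.1 i.2 / a i.1) := by
    rw [div_div, mul_one_div, lt_div_iff₀ (by positivity)]
    linarith
  -- The hypotheses are strict, so they survive a factor `1 + η`, which leaves room for the
  -- convergent product.
  have hev : ∀ᶠ η in 𝓝[>] (0 : ℝ), (1 + η) * d < p ∧ (1 + η) * (d - n i.1) <
      p * (1 / r i.1 i.2 / a i.1) ∧ (n i.1 ≠ 1 → (1 + η) * (d - 1) < p * (1 / r i.1 i.2)) ∧
      0 < η := by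
    refine (key _ _ h1).and ((key _ _ h3').and (Filter.Eventually.and ?_ self_mem_nhdsWithin))
    by_cases hn : n i.1 = 1
    · simp [hn]
    · exact (key _ _ (h2' hn)).mono fun η h _ => h
  obtain ⟨η, e1, e3, e2, hη⟩ := hev.exists
  refine (summable_prod_rpow (by linarith : 1 < 1 + η)).of_nonneg_of_le
    (fun α => (Real.exp_pos _).le) fun α => ?_
  have hprod : ∏ s, ((α s : ℝ) + 1) ^ (-(1 + η)) =
      Real.exp (-(1 + η) * ∑ s, Real.log ((α s : ℝ) + 1)) := by
    rw [Finset.mul_sum, Real.exp_sum]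
    refine Finset.prod_congr rfl fun s _ => ?_
    rw [Real.rpow_def_of_pos (by positivity), mul_comm]
  rw [hprod, Real.exp_le_exp]
  have hsum := sum_log_le i α
  rw [← hd] at hsum
  set y := Real.log ((α i : ℝ) + 1) with hy
  set Z := Real.log (blockSize α i.1) with hZ
  set Y := Real.log (totalSize α) with hY
  have hy0 : 0 ≤ y := Real.log_nonneg (by simp)
  have hyZ : y ≤ Z := Real.log_le_log (by positivity) (le_blockSize α i.1 i.2)
  have hZY : Z ≤ Y := Real.log_le_log (by linarith [one_le_blockSize α i])
    (blockSize_le_totalSize α i.1)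
  -- In the nonnegative variables `y`, `Z - y`, `Y - Z` the exponent has coefficients `-p`, `-p/r`,
  -- `-p/(ra)`, while the bound for the sum of logarithms has `d`, `d - 1`, `d - n`; they are
  -- compared one by one.
  have f0 := mul_le_mul_of_nonneg_left hsum (by linarith : 0 ≤ 1 + η)
  have f1 := mul_le_mul_of_nonneg_right e1.le hy0
  have f3 := mul_le_mul_of_nonneg_right e3.le (sub_nonneg.2 hZY)
  have f2 : (1 + η) * (d - 1) * (Z - y) ≤ p * (1 / r i.1 i.2) * (Z - y) := by
    by_cases hn : n i.1 = 1
    -- In a block of one variable the middle term vanishes, so no condition on `r (d - 1)` is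
    -- needed.
    · have : Z = y := by
        rw [hZ, hy, blockSize]
        congr 1
        have : Subsingleton (Fin (n i.1)) := by rw [hn]; infer_instance
        exact Finset.sum_eq_single i.2 (fun j _ hj => absurd (Subsingleton.elim _ _) hj)
          fun h => absurd (Finset.mem_univ _) h
      rw [this, sub_self, mul_zero, mul_zero]
    · exact mul_le_mul_of_nonneg_right (e2 hn).le (sub_nonneg.2 hyZ)
  rw [eggWeightLog, ← hy, ← hZ, ← hY]
  linarith

end Weights

/-! ### Sufficient and necessary conditions for summability -/

section Weights

variable {K : ℕ} {n : Fin K → ℕ}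

/-- The weights of the multiplications by the coordinates on the Bergman space of an egg domain. -/
noncomputable def eggWeight (a : Fin K → ℝ) (r : (k : Fin K) → Fin (n k) → ℝ)
    (i : Σ k : Fin K, Fin (n k)) (α : (Σ k : Fin K, Fin (n k)) → ℕ) : ℝ :=
  Real.exp ((eggLogNormSq a r (α + Pi.single i 1) - eggLogNormSq a r α) / 2)

variable {a : Fin K → ℝ} {r : (k : Fin K) → Fin (n k) → ℝ}

theorem isEssentiallyNormalBergmanModule_eggDomain_iff (ha : ∀ k, 0 < a k)
    (hr : ∀ k j, 0 < r k j) {p : ℝ} (hp : 0 < p) :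
    IsEssentiallyNormalBergmanModule p (eggDomain n a r ha hr) (isBounded_eggDomain n a r ha hr) ↔
      ∀ i j, Summable (fun β => |commutatorWeight (eggWeight a r) i j β| ^ p) ∧
        Summable (fun α => if α i = 0 ∧ i = j then
          Real.exp (p * (eggLogNormSq a r (α + Pi.single i 1) - eggLogNormSq a r α)) else 0) := by
  rw [isEssentiallyNormalBergmanModule_iff (isBounded_eggDomain n a r ha hr)
    (isCompleteReinhardt_eggDomain ha hr)
    (fun α => by rw [monomialNormSq_eggDomain_eq_exp]; exact Real.exp_pos _)
    (w := eggWeight a r) (fun i α => by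
      rw [monomialNormSq_eggDomain_eq_exp, monomialNormSq_eggDomain_eq_exp, ← Real.exp_sub,
        eggWeight, Real.exp_half]) hp]
  have h : ∀ i (α : (Σ k : Fin K, Fin (n k)) → ℕ), |eggWeight a r i α ^ 2| ^ p =
      Real.exp (p * (eggLogNormSq a r (α + Pi.single i 1) - eggLogNormSq a r α)) := by
    intro i α
    rw [eggWeight, ← Real.exp_nat_mul, Real.abs_exp, ← Real.exp_mul]
    congr 1
    push_cast
    ring
  simp only [h]

/-- Up to a constant the commutator weight is at most `exp ((u + v) / 2)`, where `u`, `v` are the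
logarithms of the terms for `i` and `j`: the square root in the bound for the second difference
supplies half of each logarithm. -/
theorem summable_commutatorWeight_eggWeight (ha : ∀ k, 0 < a k) (hr : ∀ k j, 0 < r k j) {p : ℝ}
    (hp : 0 < p) (hs : ∀ i : Σ k : Fin K, Fin (n k),
      Summable fun α => Real.exp (p * (eggWeightLog a r i α - Real.log ((α i : ℝ) + 1))))
    (i j : Σ k : Fin K, Fin (n k)) :
    Summable (fun β => |commutatorWeight (eggWeight a r) i j β| ^ p) := by
  obtain ⟨C, hC, h⟩ := exists_abs_second_difference_le ha hr i j
  obtain ⟨M₁, hM₁⟩ := exists_abs_eggLogNormSq_sub_le ha hr i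
  obtain ⟨M₂, hM₂⟩ := exists_abs_eggLogNormSq_sub_le ha hr j
  set C' := Real.exp ((M₁ + M₂) / 2) * (C * Real.exp C) with hC'
  have hC'0 : 0 ≤ C' := by positivity
  refine (((hs i).add (hs j)).mul_left (C' ^ p)).of_nonneg_of_le (fun β => by positivity)
    fun β => ?_
  set u := eggWeightLog a r i β - Real.log ((β i : ℝ) + 1) with hu
  set v := eggWeightLog a r j β - Real.log ((β j : ℝ) + 1) with hv
  have hle : |commutatorWeight (eggWeight a r) i j β| ≤ C' * Real.exp ((u + v) / 2) := by
    rw [commutatorWeight_eq_exp (w := eggWeight a r) (W := eggLogNormSq a r) (fun _ _ => rfl),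
      abs_mul, Real.abs_exp]
    set L := eggLogNormSq a r (β + Pi.single j 1 + Pi.single i 1) -
      eggLogNormSq a r (β + Pi.single j 1) -
      (eggLogNormSq a r (β + Pi.single i 1) - eggLogNormSq a r β) with hL
    have hxy : (1 : ℝ) ≤ ((β i : ℝ) + 1) * ((β j : ℝ) + 1) := by
      have h1 : (0 : ℝ) ≤ β i := Nat.cast_nonneg _
      have h2 : (0 : ℝ) ≤ β j := Nat.cast_nonneg _
      nlinarith [mul_nonneg h1 h2]
    have hsq : √(((β i : ℝ) + 1) * ((β j : ℝ) + 1)) =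
        Real.exp ((Real.log ((β i : ℝ) + 1) + Real.log ((β j : ℝ) + 1)) / 2) := by
      rw [← Real.log_mul (by positivity) (by positivity), Real.exp_half,
        Real.exp_log (by positivity)]
    have hL1 : |L| ≤ C * Real.exp (-((Real.log ((β i : ℝ) + 1) + Real.log ((β j : ℝ) + 1)) / 2)) := by
      rw [Real.exp_neg, ← hsq, ← div_eq_mul_inv]
      exact h β
    have hL2 : |L| ≤ C := (h β).trans (div_le_self hC (Real.one_le_sqrt.2 hxy))
    -- The inequality `|1 - exp L| ≤ |L| exp |L|`, with `|L|` bounded by `C`.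
    have hexp : |1 - Real.exp L| ≤ |L| * Real.exp C := by
      have hmono := Real.exp_le_exp.2 hL2
      have h1 := Real.add_one_le_exp L
      have h2 := Real.add_one_le_exp (-L)
      have h3 : (1 : ℝ) ≤ Real.exp C := Real.one_le_exp hC
      have h4 : Real.exp L * Real.exp (-L) = 1 := by rw [← Real.exp_add]; simp
      have h5 := Real.exp_le_exp.2 ((le_abs_self L).trans hL2)
      have h6 := Real.exp_pos L
      rcases le_total 0 L with hL0 | hL0
      · rw [abs_of_nonneg hL0, abs_of_nonpos (by linarith)]
        nlinarith
      · rw [abs_of_nonpos hL0, abs_of_nonneg (by linarith [Real.exp_le_one_iff.2 hL0])]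
        nlinarith
    have hD : Real.exp ((eggLogNormSq a r (β + Pi.single i 1) - eggLogNormSq a r β +
        (eggLogNormSq a r (β + Pi.single j 1) - eggLogNormSq a r β)) / 2) ≤
        Real.exp ((M₁ + M₂) / 2) * Real.exp ((eggWeightLog a r i β + eggWeightLog a r j β) / 2) := by
      rw [← Real.exp_add, Real.exp_le_exp]
      linarith [(abs_le.1 (hM₁ β)).2, (abs_le.1 (hM₂ β)).2]
    calc _ ≤ Real.exp ((M₁ + M₂) / 2) *
          Real.exp ((eggWeightLog a r i β + eggWeightLog a r j β) / 2) *
          (C * Real.exp (-((Real.log ((β i : ℝ) + 1) + Real.log ((β j : ℝ) + 1)) / 2)) *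
            Real.exp C) := by
            refine mul_le_mul hD (hexp.trans ?_) (abs_nonneg _) (by positivity)
            exact mul_le_mul_of_nonneg_right hL1 (Real.exp_pos _).le
      _ = C' * (Real.exp ((eggWeightLog a r i β + eggWeightLog a r j β) / 2) *
          Real.exp (-((Real.log ((β i : ℝ) + 1) + Real.log ((β j : ℝ) + 1)) / 2))) := by
            rw [hC']; ring
      _ = C' * Real.exp ((u + v) / 2) := by
            rw [← Real.exp_add, hu, hv]
            congr 2
            ring
  calc |commutatorWeight (eggWeight a r) i j β| ^ p ≤ (C' * Real.exp ((u + v) / 2)) ^ p :=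
        Real.rpow_le_rpow (abs_nonneg _) hle hp.le
    _ = C' ^ p * Real.exp ((p * u + p * v) / 2) := by
        rw [Real.mul_rpow hC'0 (Real.exp_pos _).le, ← Real.exp_mul]
        congr 2
        ring
    -- The exponential of a mean is at most the larger of the two exponentials.
    _ ≤ C' ^ p * (Real.exp (p * u) + Real.exp (p * v)) := by
        refine mul_le_mul_of_nonneg_left ?_ (by positivity)
        rcases le_total (p * u) (p * v) with huv | huv
        · have := Real.exp_le_exp.2 (by linarith : (p * u + p * v) / 2 ≤ p * v)
          linarith [Real.exp_pos (p * u)]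
        · have := Real.exp_le_exp.2 (by linarith : (p * u + p * v) / 2 ≤ p * u)
          linarith [Real.exp_pos (p * v)]

/-- On the face `α i = 0` the correction `log (α i + 1)` is zero, so the series that dominates the
commutators also dominates the boundary terms. -/
theorem summable_exp_eggLogNormSq_sub (ha : ∀ k, 0 < a k) (hr : ∀ k j, 0 < r k j) {p : ℝ}
    (hp : 0 < p) {i : Σ k : Fin K, Fin (n k)}
    (hs : Summable fun α => Real.exp (p * (eggWeightLog a r i α - Real.log ((α i : ℝ) + 1))))
    (P : Prop) [Decidable P] :
    Summable (fun α : (Σ k : Fin K, Fin (n k)) → ℕ => if α i = 0 ∧ P then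
      Real.exp (p * (eggLogNormSq a r (α + Pi.single i 1) - eggLogNormSq a r α)) else 0) := by
  obtain ⟨M, hM⟩ := exists_abs_eggLogNormSq_sub_le ha hr i
  refine (hs.mul_left (Real.exp (p * M))).of_nonneg_of_le (fun α => ?_) fun α => ?_
  · split_ifs <;> positivity
  · split_ifs with h
    · rw [← Real.exp_add, Real.exp_le_exp, ← mul_add, h.1]
      refine mul_le_mul_of_nonneg_left ?_ hp.le
      simp only [Nat.cast_zero, zero_add, Real.log_one, sub_zero]
      linarith [(abs_le.1 (hM α)).2]
    · positivity

/-- On boxes with all coordinates of order `N` the squared shift weights stay bounded below and the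
second difference is at least `e / N`. About `N ^ d` terms of size at least `c * N ^ (-p)` force `d
< p`. -/
theorem card_lt_of_summable_commutatorWeight (ha : ∀ k, 0 < a k) (hr : ∀ k j, 0 < r k j) {p : ℝ}
    (hp : 0 < p) {i i' : Σ k : Fin K, Fin (n k)} (hii : i' ≠ i)
    (hs : Summable (fun β => |commutatorWeight (eggWeight a r) i i β| ^ p)) :
    (Fintype.card (Σ k : Fin K, Fin (n k)) : ℝ) < p := by
  obtain ⟨M, hM, e, he, h⟩ := exists_le_second_difference ha hr hii
  obtain ⟨M₁, hM₁⟩ := exists_abs_eggLogNormSq_sub_le ha hr i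
  set B : ℝ := Fintype.card (Σ k : Fin K, Fin (n k)) * (2 * M) with hB
  have hM' : (1 : ℝ) ≤ M := by exact_mod_cast hM
  have hcard : (1 : ℝ) ≤ Fintype.card (Σ k : Fin K, Fin (n k)) := by
    exact_mod_cast Fintype.card_pos_iff.2 ⟨i⟩
  have hB1 : 1 ≤ B := by rw [hB]; nlinarith
  set Q := (|1 / r i.1 i.2 / a i.1 - 1 / r i.1 i.2| + 1 / r i.1 i.2 / a i.1) * Real.log B with hQ
  refine card_lt_of_summable hs Finset.univ ⟨i, Finset.mem_univ _⟩
    -- The coordinate `i` has scale `N` and the others scale `M * N`, so all are below `2 * M * N`,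
    -- which explains `B`.
    (m := fun s => if s = i then 1 else M) (c := (Real.exp (-(Q + M₁)) * e) ^ p) (fun s => by
      split_ifs
      · exact le_rfl
      · exact hM) (by positivity) fun N hN β hβ _ => ?_
  have hN' : (1 : ℝ) ≤ N := by exact_mod_cast hN
  have hβi := hβ i (Finset.mem_univ _)
  rw [if_pos rfl, one_mul] at hβi
  have hβs : ∀ s, s ≠ i → M * N ≤ β s ∧ β s < 2 * (M * N) := fun s hs => by
    have := hβ s (Finset.mem_univ _)
    rwa [if_neg hs] at this
  have hdiff := h N hN β hβi.2 fun s hs => (hβs s hs).1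
  have hNi : (N : ℝ) ≤ β i := by exact_mod_cast hβi.1
  have hlow := le_eggWeightLog ha hr (i := i) (α := β) hN' hB1
    (by linarith [le_blockSize β i.1 i.2]) (by
      rw [hB, mul_assoc]
      refine totalSize_le fun s => ?_
      have hle : β s + 1 ≤ 2 * (M * N) := by
        by_cases hsi : s = i
        · have := Nat.mul_le_mul_right N hM
          rw [hsi]; omega
        · have := (hβs s hsi).2
          omega
      have : ((β s : ℝ) + 1) ≤ 2 * (M * N) := by exact_mod_cast hle
      linarith)
  rw [← hQ] at hlow
  have hlog : 0 ≤ 1 / r i.1 i.2 * (Real.log (β i + 1) - Real.log N) := by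
    have := hr i.1 i.2
    refine mul_nonneg (by positivity) (sub_nonneg.2 (Real.log_le_log (by linarith) (by linarith)))
  have hN0 : (0 : ℝ) < N := by linarith
  rw [Real.rpow_neg hN0.le, ← div_eq_mul_inv, ← Real.div_rpow (by positivity) hN0.le]
  refine Real.rpow_le_rpow (by positivity) ?_ hp.le
  rw [commutatorWeight_eq_exp (w := eggWeight a r) (W := eggLogNormSq a r) (fun _ _ => rfl),
    abs_mul, Real.abs_exp,
    mul_div_assoc]
  refine mul_le_mul (Real.exp_le_exp.2 ?_) ?_ (by positivity) (Real.exp_pos _).le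
  · linarith [(abs_le.1 (hM₁ β)).1]
  -- A positive second difference `L` gives `exp L - 1 ≥ L`.
  · rw [abs_sub_comm]
    refine le_trans ?_ (le_abs_self _)
    linarith [Real.add_one_le_exp (eggLogNormSq a r (β + Pi.single i 1 + Pi.single i 1) -
        eggLogNormSq a r (β + Pi.single i 1) -
        (eggLogNormSq a r (β + Pi.single i 1) - eggLogNormSq a r β))]

/-- A lower bound for the boundary weights on dilated boxes forces a lower bound for `p`. -/
theorem card_lt_of_summable_boundary (ha : ∀ k, 0 < a k) (hr : ∀ k j, 0 < r k j) {p : ℝ}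
    (hp : 0 < p) {i : Σ k : Fin K, Fin (n k)} (E : Finset (Σ k : Fin K, Fin (n k)))
    (hE : E.Nonempty) (hiE : i ∉ E) {θ Q : ℝ}
    (hlow : ∀ N : ℕ, 1 ≤ N → ∀ α : (Σ k : Fin K, Fin (n k)) → ℕ,
      (∀ s ∈ E, N ≤ α s ∧ α s < 2 * N) → (∀ s ∉ E, α s = 0) →
      -θ * Real.log N - Q ≤ eggWeightLog a r i α)
    (hs : Summable (fun α : (Σ k : Fin K, Fin (n k)) → ℕ => if α i = 0 ∧ i = i then
      Real.exp (p * (eggLogNormSq a r (α + Pi.single i 1) - eggLogNormSq a r α)) else 0)) :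
    (E.card : ℝ) < p * θ := by
  obtain ⟨M, hM⟩ := exists_abs_eggLogNormSq_sub_le ha hr i
  refine card_lt_of_summable hs E hE (m := fun _ => 1) (c := Real.exp (-(p * (Q + M))))
    (fun _ => le_rfl) (Real.exp_pos _) fun N hN α h1 h2 => ?_
  have hN' : (0 : ℝ) < N := by exact_mod_cast hN
  simp only [one_mul] at h1
  rw [if_pos ⟨h2 i hiE, rfl⟩, Real.rpow_def_of_pos hN', ← Real.exp_add, Real.exp_le_exp]
  have := mul_le_mul_of_nonneg_left (hlow N hN α h1 h2) hp.le
  have := mul_le_mul_of_nonneg_left (abs_le.1 (hM α)).1 hp.le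
  linarith

/-- On the face `α i = 0` with all other coordinates of order `N`, the coordinate `i'` keeps the
block size of order `N`. The squared weight is then at least a multiple of `N ^ (-1/r)` on about `N
^ (d - 1)` points. -/
theorem mul_card_sub_one_lt_of_summable_boundary (ha : ∀ k, 0 < a k) (hr : ∀ k j, 0 < r k j)
    {p : ℝ} (hp : 0 < p) {i i' : Σ k : Fin K, Fin (n k)} (hii : i' ≠ i) (hk : i'.1 = i.1)
    (hs : Summable (fun α : (Σ k : Fin K, Fin (n k)) → ℕ => if α i = 0 ∧ i = i then
      Real.exp (p * (eggLogNormSq a r (α + Pi.single i 1) - eggLogNormSq a r α)) else 0)) :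
    r i.1 i.2 * (Fintype.card (Σ k : Fin K, Fin (n k)) - 1) < p := by
  have hri := hr i.1 i.2
  set B : ℝ := Fintype.card (Σ k : Fin K, Fin (n k)) * 2 with hB
  have hcard : (1 : ℝ) ≤ Fintype.card (Σ k : Fin K, Fin (n k)) := by
    exact_mod_cast Fintype.card_pos_iff.2 ⟨i⟩
  have h := card_lt_of_summable_boundary ha hr hp (i := i) (Finset.univ.erase i)
    ⟨i', Finset.mem_erase.2 ⟨hii, Finset.mem_univ _⟩⟩ (by simp) (θ := 1 / r i.1 i.2)
    (Q := (|1 / r i.1 i.2 / a i.1 - 1 / r i.1 i.2| + 1 / r i.1 i.2 / a i.1) * Real.log B)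
    (fun N hN α h1 h2 => by
      have hN' : (1 : ℝ) ≤ N := by exact_mod_cast hN
      have hα : α i = 0 := h2 i (by simp)
      have hi' : (N : ℝ) ≤ α i' := by exact_mod_cast (h1 i' (by simp [hii])).1
      have hbl : blockSize α i'.1 = blockSize α i.1 := by rw [hk]
      have := le_eggWeightLog ha hr (i := i) (α := α) hN' (by linarith : 1 ≤ B)
        (by linarith [le_blockSize α i'.1 i'.2]) (by
          rw [hB, mul_assoc]
          refine totalSize_le fun s => ?_
          have hle : α s + 1 ≤ 2 * N := by
            by_cases hsi : s = i
            · rw [hsi]; omega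
            · have := (h1 s (by simp [hsi])).2
              omega
          exact_mod_cast hle)
      rw [hα, Nat.cast_zero, zero_add, Real.log_one] at this
      linarith) hs
  rw [Finset.card_erase_of_mem (Finset.mem_univ _), Finset.card_univ,
    Nat.cast_pred (Fintype.card_pos_iff.2 ⟨i⟩), mul_one_div, lt_div_iff₀ hri] at h
  linarith

/-- With the whole block of `i` equal to zero its size is constant. The squared weight is then at
least a multiple of `N ^ (-1/(ra))`, on about `N ^ (d - n)` points when the other blocks are of
order `N`. -/
theorem mul_card_sub_lt_of_summable_boundary (ha : ∀ k, 0 < a k) (hr : ∀ k j, 0 < r k j)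
    {p : ℝ} (hp : 0 < p) {i i' : Σ k : Fin K, Fin (n k)} (hk : i'.1 ≠ i.1)
    (hs : Summable (fun α : (Σ k : Fin K, Fin (n k)) → ℕ => if α i = 0 ∧ i = i then
      Real.exp (p * (eggLogNormSq a r (α + Pi.single i 1) - eggLogNormSq a r α)) else 0)) :
    a i.1 * r i.1 i.2 * (∑ k, (n k : ℝ) - n i.1) < p := by
  have hri := hr i.1 i.2
  have hai := ha i.1
  set B : ℝ := Fintype.card (Σ k : Fin K, Fin (n k)) * 2 with hB
  have hcard : (1 : ℝ) ≤ Fintype.card (Σ k : Fin K, Fin (n k)) := by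
    exact_mod_cast Fintype.card_pos_iff.2 ⟨i⟩
  have h := card_lt_of_summable_boundary ha hr hp (i := i)
    ((Finset.univ.erase i.1).sigma fun _ => Finset.univ)
    ⟨i', by simp [hk]⟩ (by simp) (θ := 1 / r i.1 i.2 / a i.1)
    (Q := -(1 / r i.1 i.2 / a i.1 - 1 / r i.1 i.2) * Real.log (n i.1) +
      1 / r i.1 i.2 / a i.1 * Real.log B)
    (fun N hN α h1 h2 => by
      have hN' : (1 : ℝ) ≤ N := by exact_mod_cast hN
      have hα : α i = 0 := h2 i (by simp)
      have hbl : blockSize α i.1 = n i.1 := by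
        rw [blockSize, Finset.sum_congr rfl fun j _ => by
          rw [h2 ⟨i.1, j⟩ (by simp), Nat.cast_zero, zero_add]]
        simp
      have htot : totalSize α ≤ B * N := by
        rw [hB, mul_assoc]
        refine totalSize_le fun s => ?_
        have hle : α s + 1 ≤ 2 * N := by
          by_cases hsi : s.1 = i.1
          · rw [h2 s (by simp [hsi])]; omega
          · have := (h1 s (by simp [hsi])).2
            omega
        exact_mod_cast hle
      have hlog := Real.log_le_log (by
        linarith [one_le_blockSize α i, blockSize_le_totalSize α i.1]) htot
      rw [Real.log_mul (by linarith) (by linarith)] at hlog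
      have := mul_le_mul_of_nonneg_left hlog (by positivity : 0 ≤ 1 / r i.1 i.2 / a i.1)
      rw [eggWeightLog, hα, hbl, Nat.cast_zero, zero_add, Real.log_one]
      linarith) hs
  rw [Finset.card_sigma, div_div, mul_one_div, lt_div_iff₀ (by positivity)] at h
  have hsum : ((∑ k ∈ Finset.univ.erase i.1, (Finset.univ : Finset (Fin (n k))).card : ℕ) : ℝ) =
      ∑ k, (n k : ℝ) - n i.1 := by
    rw [← Finset.add_sum_erase _ _ (Finset.mem_univ i.1), add_sub_cancel_left]
    push_cast
    simp
  rw [hsum] at h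
  linarith

end Weights

/-! ### Dimension one -/

section OneVariable

variable {K : ℕ} {n : Fin K → ℕ} {a : Fin K → ℝ} {r : (k : Fin K) → Fin (n k) → ℝ}

/-- With one variable the block and total Gamma factors cancel, and `Γ(1 + γ) = γ Γ(γ)` leaves a
ratio free of `a` and `r`: the domain is a disc. -/
theorem eggLogNormSq_add_single_of_subsingleton [Subsingleton (Σ k : Fin K, Fin (n k))]
    (hn : ∀ k, 0 < n k) (ha : ∀ k, 0 < a k)
    (hr : ∀ k j, 0 < r k j) (i : Σ k : Fin K, Fin (n k)) (α : (Σ k : Fin K, Fin (n k)) → ℕ) :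
    eggLogNormSq a r (α + Pi.single i 1) - eggLogNormSq a r α =
      Real.log (((α i : ℝ) + 1) / (α i + 2)) := by
  have hri := hr i.1 i.2
  have hai := ha i.1
  have hblock : blockSum r α i.1 = ((α i : ℝ) + 1) / r i.1 i.2 := by
    rw [blockSum]
    exact Finset.sum_eq_single i.2
      (fun j _ hj => absurd (eq_of_heq (Sigma.ext_iff.1
        (Subsingleton.elim (⟨i.1, j⟩ : Σ k : Fin K, Fin (n k)) i)).2) hj)
      fun hni => absurd (Finset.mem_univ _) hni
  have htotal : totalSum a r α = blockSum r α i.1 / a i.1 := by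
    rw [totalSum]
    exact Finset.sum_eq_single i.1
      (fun k _ hk => absurd (Sigma.ext_iff.1
        (Subsingleton.elim (⟨k, ⟨0, hn k⟩⟩ : Σ k : Fin K, Fin (n k)) i)).1 hk)
      fun hni => absurd (Finset.mem_univ _) hni
  rw [eggLogNormSq_add_single, htotal, hblock]
  set γ := ((α i : ℝ) + 1) / r i.1 i.2 with hγ
  have hγ0 : 0 < γ := by positivity
  have h1 : 1 + γ + 1 / r i.1 i.2 = γ + 1 / r i.1 i.2 + 1 := by ring
  have hq : γ / (γ + 1 / r i.1 i.2) = ((α i : ℝ) + 1) / (α i + 2) := by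
    rw [hγ]; field_simp; ring
  have hδ : 0 < γ + 1 / r i.1 i.2 := by positivity
  rw [h1, add_comm 1 γ, Real.Gamma_add_one hγ0.ne', Real.Gamma_add_one hδ.ne',
    Real.log_mul hγ0.ne' (Real.Gamma_pos_of_pos hγ0).ne',
    Real.log_mul hδ.ne' (Real.Gamma_pos_of_pos hδ).ne', ← hq, Real.log_div hγ0.ne' hδ.ne']
  ring

theorem abs_commutatorWeight_eggWeight_of_subsingleton [Subsingleton (Σ k : Fin K, Fin (n k))]
    (hn : ∀ k, 0 < n k) (ha : ∀ k, 0 < a k)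
    (hr : ∀ k j, 0 < r k j) (i : Σ k : Fin K, Fin (n k)) (β : (Σ k : Fin K, Fin (n k)) → ℕ) :
    |commutatorWeight (eggWeight a r) i i β| = 1 / (((β i : ℝ) + 2) * (β i + 3)) := by
  have h : ∀ α, eggWeight a r i α * eggWeight a r i α = ((α i : ℝ) + 1) / (α i + 2) := fun α => by
    rw [eggWeight, ← Real.exp_add, add_halves, eggLogNormSq_add_single_of_subsingleton hn ha hr,
      Real.exp_log (by positivity)]
  rw [commutatorWeight, h, h, Pi.add_apply, Pi.single_eq_same]
  push_cast
  rw [abs_of_nonpos, neg_sub]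
  · field_simp
    ring
  · rw [sub_nonpos, div_le_div_iff₀ (by positivity) (by positivity)]
    nlinarith

/-- The self-commutator weights decay like `m ^ (-2)`, so the threshold is `2p > 1`; the boundary
series has a single nonzero term. -/
theorem isEssentiallyNormalBergmanModule_eggDomain_iff_of_subsingleton
    [Subsingleton (Σ k : Fin K, Fin (n k))] [Nonempty (Σ k : Fin K, Fin (n k))]
    (hn : ∀ k, 0 < n k) (ha : ∀ k, 0 < a k) (hr : ∀ k j, 0 < r k j) {p : ℝ} (hp : 0 < p) :
    IsEssentiallyNormalBergmanModule p (eggDomain n a r ha hr) (isBounded_eggDomain n a r ha hr) ↔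
      1 / 2 < p := by
  rw [isEssentiallyNormalBergmanModule_eggDomain_iff ha hr hp]
  constructor
  · intro h
    obtain ⟨i⟩ := ‹Nonempty (Σ k : Fin K, Fin (n k))›
    -- On the box `β i + 1 ≤ 2N`, so `(β i + 2)(β i + 3) ≤ 12 N²`; the constant 20 is a generous
    -- bound.
    have := card_lt_of_summable (h i i).1 {i} ⟨i, by simp⟩ (m := fun _ => 1) (c := (1 / 20) ^ p)
      (τ := 2 * p) (fun _ => le_rfl) (by positivity) fun N hN β hβ _ => by
        have hN' : (1 : ℝ) ≤ N := by exact_mod_cast hN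
        have hβi : (β i : ℝ) + 1 ≤ 2 * N := by
          have := (hβ i (by simp)).2
          rw [one_mul] at this
          exact_mod_cast this
        rw [abs_commutatorWeight_eggWeight_of_subsingleton hn ha hr, Real.rpow_neg (by linarith),
          Real.rpow_mul (by linarith), ← div_eq_mul_inv, ← Real.div_rpow (by positivity)
            (by positivity)]
        refine Real.rpow_le_rpow (by positivity) ?_ hp.le
        rw [Real.rpow_two, div_div]
        refine one_div_le_one_div_of_le (by positivity) ?_
        have h0 : (0 : ℝ) ≤ β i := Nat.cast_nonneg _
        nlinarith
    rw [Finset.card_singleton, Nat.cast_one] at this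
    linarith
  · intro hp2 i j
    obtain rfl := Subsingleton.elim i j
    constructor
    · refine (summable_prod_rpow (σ := Σ k : Fin K, Fin (n k))
        (by linarith : 1 < 2 * p)).of_nonneg_of_le (fun β => by positivity) fun β => ?_
      rw [abs_commutatorWeight_eggWeight_of_subsingleton hn ha hr, Fintype.prod_subsingleton _ i,
        Real.rpow_neg (by positivity), Real.rpow_mul (by positivity), ← Real.inv_rpow
          (by positivity)]
      refine Real.rpow_le_rpow (by positivity) ?_ hp.le
      rw [Real.rpow_two, ← one_div]
      refine one_div_le_one_div_of_le (by positivity) ?_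
      have h0 : (0 : ℝ) ≤ β i := Nat.cast_nonneg _
      nlinarith
    · refine summable_of_hasFiniteSupport ((Set.finite_singleton 0).subset fun α hα => ?_)
      rw [Function.mem_support] at hα
      by_contra hne
      refine hα (if_neg fun h => hne ?_)
      ext s
      rw [Subsingleton.elim s i, h.1]
      rfl

end OneVariable

/-! ### Matching the summability conditions with the critical exponent -/

theorem theorem2 {K : ℕ} (hK : 0 < K) (n : Fin K → ℕ) (hn : ∀ k, 0 < n k)
    (a : Fin K → ℝ) (ha : ∀ k, 0 < a k)
    (r : (k : Fin K) → Fin (n k) → ℝ) (hr : ∀ k j, 0 < r k j)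
    (p : ℝ) (hp : 0 < p) :
    IsEssentiallyNormalBergmanModule p (eggDomain n a r ha hr) (isBounded_eggDomain n a r ha hr) ↔
      criticalExponent n a r < p := by
  have hcard : Fintype.card (Σ k : Fin K, Fin (n k)) = ∑ k, n k := by simp
  have hcard' : (Fintype.card (Σ k : Fin K, Fin (n k)) : ℝ) = ∑ k, (n k : ℝ) := by
    rw [hcard]; push_cast; rfl
  have i₀ : Σ k : Fin K, Fin (n k) := ⟨⟨0, hK⟩, ⟨0, hn _⟩⟩
  have hne : Nonempty (Σ k : Fin K, Fin (n k)) := ⟨i₀⟩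
  rw [criticalExponent]
  split_ifs with h1
  · have hsub : Subsingleton (Σ k : Fin K, Fin (n k)) :=
      Fintype.card_le_one_iff_subsingleton.1 (by rw [hcard, h1])
    exact isEssentiallyNormalBergmanModule_eggDomain_iff_of_subsingleton hn ha hr hp
  have hlt : 1 < Fintype.card (Σ k : Fin K, Fin (n k)) := by
    have := Fintype.card_pos_iff.2 hne
    omega
  rw [isEssentiallyNormalBergmanModule_eggDomain_iff ha hr hp, max_lt_iff]
  have hKne : Nonempty (Fin K) := ⟨⟨0, hK⟩⟩
  have hne' : ∀ k, Nonempty (Fin (n k)) := fun k => ⟨⟨0, hn k⟩⟩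
  have hmax : ∀ {ι : Type} [Finite ι] [Nonempty ι] (f : ι → ℝ), (⨆ x, f x) < p ↔ ∀ x, f x < p := by
    intro ι _ _ f
    refine ⟨fun h x => (le_ciSup (Set.finite_range f).bddAbove x).trans_lt h, fun h => ?_⟩
    obtain ⟨x, hx⟩ := exists_eq_ciSup_of_finite (f := f)
    rw [← hx]
    exact h x
  rw [hmax]
  constructor
  · intro h
    have hd : ∑ k, (n k : ℝ) < p := by
      obtain ⟨i', hi'⟩ := Fintype.exists_ne_of_one_lt_card hlt i₀
      rw [← hcard']
      exact card_lt_of_summable_commutatorWeight ha hr hp hi' (h i₀ i₀).1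
    have hA : ∀ i : Σ k : Fin K, Fin (n k), n i.1 ≠ 1 →
        r i.1 i.2 * (∑ k, (n k : ℝ) - 1) < p := by
      intro i hi
      obtain ⟨j, hj⟩ := Fintype.exists_ne_of_one_lt_card
        (by rw [Fintype.card_fin]; have := hn i.1; omega : 1 < Fintype.card (Fin (n i.1))) i.2
      rw [← hcard']
      exact mul_card_sub_one_lt_of_summable_boundary ha hr hp (i' := ⟨i.1, j⟩)
        (fun hji => hj (eq_of_heq (Sigma.ext_iff.1 hji).2)) rfl (h i i).2
    have hB : ∀ i : Σ k : Fin K, Fin (n k), a i.1 * r i.1 i.2 * (∑ k, (n k : ℝ) - n i.1) < p := by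
      intro i
      by_cases hex : ∃ i' : Σ k : Fin K, Fin (n k), i'.1 ≠ i.1
      · obtain ⟨i', hi'⟩ := hex
        exact mul_card_sub_lt_of_summable_boundary ha hr hp hi' (h i i).2
      -- With a single block `d - n k = 0`, and the condition reduces to `0 < p`.
      · push Not at hex
        have : ∑ k, (n k : ℝ) = n i.1 := Finset.sum_eq_single i.1
          (fun k _ hk => absurd (hex ⟨k, ⟨0, hn k⟩⟩) hk) fun hni => absurd (Finset.mem_univ _) hni
        rw [this, sub_self, mul_zero]
        exact hp
    refine ⟨hd, fun k => ?_⟩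
    rw [blockExponent]
    split_ifs with h2 h3
    · exact (hmax _).2 fun j => hB ⟨k, j⟩
    · exact max_lt ((hmax _).2 fun j => hA ⟨k, j⟩ h2) ((hmax _).2 fun j => hB ⟨k, j⟩)
    · refine max_lt (max_lt ((hmax _).2 fun j => hA ⟨k, j⟩ h2) ((hmax _).2 fun j => hB ⟨k, j⟩)) ?_
      obtain ⟨j, hj⟩ := Fintype.exists_ne_of_one_lt_card
        (by rw [Fintype.card_fin]; have := hn k; omega : 1 < Fintype.card (Fin (n k))) ⟨0, hn k⟩
      have : Nonempty {jl : Fin (n k) × Fin (n k) // jl.1 ≠ jl.2} := ⟨⟨(j, ⟨0, hn k⟩), hj⟩⟩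
      refine (hmax _).2 fun ⟨⟨j, l⟩, _⟩ => ?_
      have hrj := hr k j
      have hrl := hr k l
      have hak := ha k
      have e1 := hB ⟨k, j⟩
      have e2 := hB ⟨k, l⟩
      dsimp only at e1 e2 ⊢
      -- The quotient is the harmonic mean of `a r_j (d - n)` and `a r_l (d - n)`; adding the bounds
      -- for `j` and `l`, each divided by its exponent, gives the claim.
      rw [div_lt_iff₀ (by positivity)]
      have f1 : a k * (∑ k, (n k : ℝ) - n k) < p * (1 / r k j) := by
        rw [mul_one_div, lt_div_iff₀ hrj]; linarith
      have f2 : a k * (∑ k, (n k : ℝ) - n k) < p * (1 / r k l) := by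
        rw [mul_one_div, lt_div_iff₀ hrl]; linarith
      linarith
  · rintro ⟨hd, hq⟩
    have hs : ∀ i : Σ k : Fin K, Fin (n k), Summable fun α =>
        Real.exp (p * (eggWeightLog a r i α - Real.log ((α i : ℝ) + 1))) := by
      rintro ⟨k, j⟩
      have hqk := hq k
      rw [blockExponent] at hqk
      by_cases h2 : n k = 1
      · rw [if_pos h2, hmax] at hqk
        exact summable_exp_eggWeightLog_sub hr ⟨k, j⟩ hd (fun h => absurd h2 h) (hqk j) (ha k)
      -- For sufficiency the third family is discarded, so the cases `a k = 1` and `a k ≠ 1`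
      -- coincide.
      · have hqk' : max (⨆ j : Fin (n k), r k j * (∑ k, (n k : ℝ) - 1))
            (⨆ j : Fin (n k), a k * r k j * (∑ k, (n k : ℝ) - n k)) < p := by
          rw [if_neg h2] at hqk
          split_ifs at hqk
          · exact hqk
          · exact (le_max_left _ _).trans_lt hqk
        rw [max_lt_iff, hmax, hmax] at hqk'
        exact summable_exp_eggWeightLog_sub hr ⟨k, j⟩ hd (fun _ => hqk'.1 j) (hqk'.2 j) (ha k)
    exact fun i j => ⟨summable_commutatorWeight_eggWeight ha hr hp hs i j,
      summable_exp_eggLogNormSq_sub ha hr hp (hs i) _⟩
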